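/- Let $K$ be an algebraically closed field of characteristic $p>0$, let $d\ge 2$, and let $N\cong\mathbb Z^{d-1}$ be a lattice with dual lattice $M=\mathrm{Hom}(N,\mathbb Z)\cong\mathbb Z^{d-1}$. Let $X=X(\Delta)$ be the projective toric variety over $K$ of a complete fan $\Delta$ in $N_{\mathbb R}$; let $v_1,\dots,v_s\in N$ be the primitive generators of the rays of $\Delta$ and $D_1,\dots,D_s$ the corresponding torus-invariant prime divisors. Let $D=\sum_i a_iD_i$ be a very ample $T$-Cartier divisor, that is, $\mathcal O(D)$ is generated by its global sections $\chi^{u}$, $u\in P_D\cap M=\{u_1,\dots,u_r\}$, where $$P_D=\{u\in M_{\mathbb R} : \langle u,v_i\rangle\ge -a_i\ \text{for all } i\},$$ and $x\mapsto(\chi^{u_1}(x):\cdots:\chi^{u_r}(x))$ is a closed embedding $X\to\mathbb P^{r-1}$. Let $R=K[S]$ be the homogeneous coordinate ring of $X$ in this embedding, where $S\subset M\times\mathbb Z$ is the semigroup generated by $(u_1,1),\dots,(u_r,1)$, and let $\mathbf m$ be its graded maximal ideal. For an ideal $I\subset R$ of finite colength put $$e_{HK}(R,I)=\lim_{n\to\infty}\frac{\ell(R/I^{[p^n]})}{p^{nd}},\qquad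 e_0(R,I)=\lim_{n\to\infty}\frac{d!\,\ell(R/I^n)}{n^d},$$ where $I^{[q]}$ is the ideal generated by the $q$-th powers of the elements of $I$, and $d=\dim R$. Let $C_D\subset M_{\mathbb R}\times\mathbb R=\mathbb R^{d}$ be the convex cone spanned by $P_D\times\{1\}$, and for $v\in\mathbb Z^{d-1}$ let $W_v=v+[0,1]^{d-1}$. Define, for $\lambda\ge 0$, $$\varphi_D(\lambda)=\mathrm{Vol}_{d-1}\Bigl(\bigl(W_v\times\{z=\lambda+1\}\bigr)\setminus\bigcup_{u\in\mathbb Z^{d-1}}\bigl((u,1)+C_D\bigr)\Bigr).$$ Then the limits defining $e_{HK}(R,\mathbf m^k)$ and $e_0(R,\mathbf m^k)$ exist for every $k\ge 1$; the function $\varphi_D:[0,\infty)\to[0,\infty)$, which is defined in terms of the polytope $P_D$ only, does not depend on the choice of $v$, is continuous and has compact support; and $$\lim_{k\to\infty}\frac{e_{HK}(R,\mathbf m^k)-e_0(R,\mathbf m^k)/d!}{k^{d-1}}=\frac{e_0(R,\mathbf m)}{(d-1)!}\int_0^\infty\varphi_D(\lambda)\,d\lambda .$$ -/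

import Mathlib

open AlgebraicGeometry CategoryTheory CategoryTheory.Limits Filter Topology Pointwise


universe u

noncomputable section

namespace Toric

/-! ### Lattices, cones and fans

The lattice `N` and its dual lattice `M` are `ℤⁿ`, paired by the dot product. -/

/-- The inclusion of the lattice `ℤⁿ` in `ℝⁿ`. -/
def toReal {n : ℕ} (v : Fin n → ℤ) : Fin n → ℝ := fun i => (v i : ℝ)

lemma toReal_zero {n : ℕ} : toReal (0 : Fin n → ℤ) = 0 := by
  ext i; simp [toReal]

lemma toReal_add {n : ℕ} (v w : Fin n → ℤ) : toReal (v + w) = toReal v + toReal w := by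
  ext i; simp [toReal]

lemma toReal_nsmul {n : ℕ} (k : ℕ) (v : Fin n → ℤ) : toReal (k • v) = (k : ℝ) • toReal v := by
  ext i; simp [toReal]

/-- `τ` is a face of `σ`, i.e. the intersection of `σ` with a supporting hyperplane `u^⊥`, where
`u ∈ M` is nonnegative on `σ`. (For rational cones it makes no difference whether the linear form
`u` is required to be integral.) -/
def IsFace {n : ℕ} (τ σ : PointedCone ℝ (Fin n → ℝ)) : Prop :=
  ∃ u : Fin n → ℤ, (∀ x ∈ σ, 0 ≤ toReal u ⬝ᵥ x) ∧ ∀ x, x ∈ τ ↔ x ∈ σ ∧ toReal u ⬝ᵥ x = 0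

/-- A fan in `N_ℝ = ℝⁿ`: a finite set of strongly convex rational polyhedral cones, closed under
taking faces, in which any two cones meet along a common face. -/
structure Fan (n : ℕ) where
  cones : Set (PointedCone ℝ (Fin n → ℝ))
  finite : cones.Finite
  rational : ∀ σ ∈ cones, ∃ s : Finset (Fin n → ℤ), σ = PointedCone.hull ℝ (toReal '' (s : Set _))
  stronglyConvex : ∀ σ ∈ cones, ∀ x ∈ σ, -x ∈ σ → x = 0
  face_mem : ∀ σ ∈ cones, ∀ τ, IsFace τ σ → τ ∈ cones
  inter_isFace : ∀ σ ∈ cones, ∀ τ ∈ cones, IsFace (σ ⊓ τ) σ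

/-- The fan is complete: its cones cover `N_ℝ`. -/
def Fan.IsComplete {n : ℕ} (Δ : Fan n) : Prop := ∀ x, ∃ σ ∈ Δ.cones, x ∈ σ

/-- Primitive lattice vectors. -/
def IsPrimitive {n : ℕ} (v : Fin n → ℤ) : Prop :=
  ∀ (k : ℤ) (w : Fin n → ℤ), v = k • w → IsUnit k

/-- The one-dimensional cones of the fan, each given by its primitive generator. They index the
prime torus-invariant Weil divisors of the toric variety. -/
def Fan.rays {n : ℕ} (Δ : Fan n) : Set (Fin n → ℤ) :=
  {v | IsPrimitive v ∧ PointedCone.hull ℝ {toReal v} ∈ Δ.cones}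

/-! ### The toric variety of a fan -/

/-- The semigroup `S_σ = σ^∨ ∩ M`. -/
def dualMonoid {n : ℕ} (σ : PointedCone ℝ (Fin n → ℝ)) : AddSubmonoid (Fin n → ℤ) where
  carrier := {u | ∀ x ∈ σ, 0 ≤ toReal u ⬝ᵥ x}
  zero_mem' := by intro x _; simp [toReal_zero]
  add_mem' := by
    intro a b ha hb x hx
    rw [toReal_add, add_dotProduct]
    exact add_nonneg (ha x hx) (hb x hx)

lemma dualMonoid_anti {n : ℕ} {τ σ : PointedCone ℝ (Fin n → ℝ)} (h : τ ≤ σ) :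
    dualMonoid σ ≤ dualMonoid τ :=
  fun _ hu x hx => hu x (h hx)

/-- The inclusion `K[S_σ] → K[S_τ]` for `τ ⊆ σ`. -/
def restrictionMap (K : Type u) [Field K] {n : ℕ} {τ σ : PointedCone ℝ (Fin n → ℝ)}
    (h : τ ≤ σ) : AddMonoidAlgebra K (dualMonoid σ) →+* AddMonoidAlgebra K (dualMonoid τ) :=
  AddMonoidAlgebra.mapDomainRingHom K (AddSubmonoid.inclusion (dualMonoid_anti h))

lemma restrictionMap_single (K : Type u) [Field K] {n : ℕ} {τ σ : PointedCone ℝ (Fin n → ℝ)}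
    (h : τ ≤ σ) (a : dualMonoid σ) (r : K) :
    restrictionMap K h (AddMonoidAlgebra.single a r) =
      AddMonoidAlgebra.single (AddSubmonoid.inclusion (dualMonoid_anti h) a) r := by
  simp [restrictionMap]

/-- The diagram of affine toric charts `U_σ = Spec K[S_σ]`, `σ ∈ Δ`, and of the maps `U_τ → U_σ`
for `τ ⊆ σ` (that is, for `τ` a face of `σ`). -/
def Fan.diagram (K : Type u) [Field K] {n : ℕ} (Δ : Fan n) : Δ.cones ⥤ Scheme.{u} where
  obj σ := Spec (CommRingCat.of (AddMonoidAlgebra K (dualMonoid σ.1)))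
  map {τ σ} f := Spec.map (CommRingCat.ofHom (restrictionMap K (leOfHom f)))
  map_id σ := by
    rw [← Spec.map_id]
    congr 1
    ext1
    exact AddMonoidAlgebra.mapDomainRingHom_id
  map_comp {ρ τ σ} f g := by
    rw [← Spec.map_comp, ← CommRingCat.ofHom_comp]
    congr 2
    exact AddMonoidAlgebra.mapDomainRingHom_comp
      (AddSubmonoid.inclusion (dualMonoid_anti (leOfHom f)))
      (AddSubmonoid.inclusion (dualMonoid_anti (leOfHom g)))

lemma exists_add_nsmul_mem {n : ℕ} (s : Finset (Fin n → ℤ)) {τ σ : PointedCone ℝ (Fin n → ℝ)}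
    (hσ : σ = PointedCone.hull ℝ (toReal '' (s : Set _))) (u : Fin n → ℤ)
    (hu : ∀ x ∈ σ, 0 ≤ toReal u ⬝ᵥ x) (hτ : ∀ x, x ∈ τ ↔ x ∈ σ ∧ toReal u ⬝ᵥ x = 0)
    (w : Fin n → ℤ) (hw : w ∈ dualMonoid τ) : ∃ k : ℕ, w + k • u ∈ dualMonoid σ := by
  have key : ∀ v ∈ s, ∃ k : ℕ, ∀ m ≥ k, 0 ≤ toReal (w + m • u) ⬝ᵥ toReal v := by
    intro v hv
    have hvσ : toReal v ∈ σ := by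
      rw [hσ]; exact Submodule.subset_span ⟨v, hv, rfl⟩
    rcases (hu _ hvσ).eq_or_lt with h0 | hpos
    · refine ⟨0, fun m _ => ?_⟩
      have := hw _ ((hτ _).2 ⟨hvσ, h0.symm⟩)
      rw [toReal_add, toReal_nsmul, add_dotProduct, smul_dotProduct, ← h0]
      simpa using this
    · obtain ⟨k, hk⟩ := exists_nat_ge (-(toReal w ⬝ᵥ toReal v) / (toReal u ⬝ᵥ toReal v))
      refine ⟨k, fun m hm => ?_⟩
      rw [toReal_add, toReal_nsmul, add_dotProduct, smul_dotProduct, smul_eq_mul]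
      rw [div_le_iff₀ hpos] at hk
      have : (k : ℝ) ≤ m := by exact_mod_cast hm
      nlinarith
  choose! k hk using key
  refine ⟨s.sup k, fun x hx => ?_⟩
  rw [hσ] at hx
  induction hx using Submodule.span_induction with
  | mem x hx =>
    obtain ⟨v, hv, rfl⟩ := hx
    exact hk v hv _ (Finset.le_sup hv)
  | zero => simp
  | add x y _ _ hx hy => rw [dotProduct_add]; exact add_nonneg hx hy
  | smul c x _ hx =>
    have : c • x = (c : ℝ) • x := rfl
    rw [this, dotProduct_smul]
    exact mul_nonneg c.2 hx

/-- For a face `τ = σ ∩ u^⊥`, the map `U_τ → U_σ` is the inclusion of the principal open subset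
`χ^u ≠ 0`. -/
lemma isLocalization_restrictionMap (K : Type u) [Field K] {n : ℕ} (s : Finset (Fin n → ℤ))
    {τ σ : PointedCone ℝ (Fin n → ℝ)} (h : τ ≤ σ)
    (hσ : σ = PointedCone.hull ℝ (toReal '' (s : Set _))) (u : dualMonoid σ)
    (hτ : ∀ x, x ∈ τ ↔ x ∈ σ ∧ toReal u.1 ⬝ᵥ x = 0) :
    @IsLocalization.Away _ _ (AddMonoidAlgebra.single u 1 : AddMonoidAlgebra K (dualMonoid σ))
      (AddMonoidAlgebra K (dualMonoid τ)) _ (restrictionMap K h).toAlgebra := by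
  let _ := (restrictionMap K h).toAlgebra
  have hneg : -u.1 ∈ dualMonoid τ := by
    intro x hx
    have h1 : toReal (-u.1) ⬝ᵥ x = -(toReal u.1 ⬝ᵥ x) := by
      rw [← neg_dotProduct]; congr 1; ext i; simp [toReal]
    rw [h1, ((hτ x).1 hx).2, neg_zero]
  have halg (x : AddMonoidAlgebra K (dualMonoid σ)) :
      algebraMap _ (AddMonoidAlgebra K (dualMonoid τ)) x = restrictionMap K h x := rfl
  have hinj : Function.Injective (restrictionMap K h) :=
    AddMonoidAlgebra.mapDomain_injective (AddSubmonoid.inclusion_injective _)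
  have hpow (k : ℕ) : restrictionMap K h (AddMonoidAlgebra.single u 1 ^ k) =
      AddMonoidAlgebra.single (k • AddSubmonoid.inclusion (dualMonoid_anti h) u) 1 := by
    rw [map_pow, restrictionMap_single, AddMonoidAlgebra.single_pow, one_pow]
  refine (isLocalization_iff _ _).2 ⟨?_, ?_, ?_⟩
  · rintro ⟨_, k, rfl⟩
    rw [halg]
    dsimp only
    rw [map_pow, restrictionMap_single]
    refine IsUnit.pow k (IsUnit.of_mul_eq_one (AddMonoidAlgebra.single ⟨-u.1, hneg⟩ 1) ?_)
    rw [AddMonoidAlgebra.single_mul_single, AddMonoidAlgebra.one_def, one_mul]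
    congr 1
    ext1
    simp
  · intro z
    suffices H : ∃ (k : ℕ) (x : AddMonoidAlgebra K (dualMonoid σ)),
        z * restrictionMap K h (AddMonoidAlgebra.single u 1 ^ k) = restrictionMap K h x by
      obtain ⟨k, x, hx⟩ := H
      exact ⟨(x, ⟨_, k, rfl⟩), hx⟩
    induction z using AddMonoidAlgebra.induction_linear with
    | zero => exact ⟨0, 0, by simp⟩
    | add x y hx hy =>
      obtain ⟨k, a, ha⟩ := hx
      obtain ⟨l, b, hb⟩ := hy
      refine ⟨k + l, a * AddMonoidAlgebra.single u 1 ^ l + b * AddMonoidAlgebra.single u 1 ^ k, ?_⟩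
      rw [map_add, map_mul, map_mul, ← ha, ← hb, pow_add, map_mul]
      ring
    | single w r =>
      obtain ⟨k, hk⟩ := exists_add_nsmul_mem s hσ u.1 u.2 hτ w.1 w.2
      refine ⟨k, AddMonoidAlgebra.single ⟨_, hk⟩ r, ?_⟩
      rw [hpow, restrictionMap_single, AddMonoidAlgebra.single_mul_single, mul_one]
      congr 1
  · intro x y hxy
    exact ⟨1, by rw [hinj hxy]⟩

lemma Fan.exists_isLocalization (K : Type u) [Field K] {n : ℕ} (Δ : Fan n)
    {τ σ : PointedCone ℝ (Fin n → ℝ)} (hτ : τ ∈ Δ.cones) (hσ : σ ∈ Δ.cones) (h : τ ≤ σ) :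
    ∃ u : dualMonoid σ, ∀ x, x ∈ τ ↔ x ∈ σ ∧ toReal u.1 ⬝ᵥ x = 0 := by
  obtain ⟨u, hu, hu'⟩ := Δ.inter_isFace σ hσ τ hτ
  rw [inf_eq_right.2 h] at hu'
  exact ⟨⟨u, hu⟩, hu'⟩

/-- The charts of the toric variety are glued along open immersions. -/
instance Fan.isOpenImmersion_diagram_map (K : Type u) [Field K] {n : ℕ} (Δ : Fan n)
    {τ σ : Δ.cones} (f : τ ⟶ σ) : IsOpenImmersion ((Δ.diagram K).map f) := by
  obtain ⟨s, hs⟩ := Δ.rational _ σ.2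
  obtain ⟨u, hu⟩ := Δ.exists_isLocalization K τ.2 σ.2 (leOfHom f)
  let _ := (restrictionMap K (leOfHom f)).toAlgebra
  have := isLocalization_restrictionMap K s (leOfHom f) hs u hu
  exact IsOpenImmersion.of_isLocalization
    (AddMonoidAlgebra.single u 1 : AddMonoidAlgebra K (dualMonoid σ.1))

lemma range_restrictionMap (K : Type u) [Field K] {n : ℕ} (s : Finset (Fin n → ℤ))
    {τ σ : PointedCone ℝ (Fin n → ℝ)} (h : τ ≤ σ)
    (hσ : σ = PointedCone.hull ℝ (toReal '' (s : Set _))) (u : dualMonoid σ)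
    (hτ : ∀ x, x ∈ τ ↔ x ∈ σ ∧ toReal u.1 ⬝ᵥ x = 0) :
    Set.range (PrimeSpectrum.comap (restrictionMap K h)) =
      (PrimeSpectrum.basicOpen (AddMonoidAlgebra.single u (1 : K)) : Set _) := by
  let _ := (restrictionMap K h).toAlgebra
  have := isLocalization_restrictionMap K s h hσ u hτ
  exact PrimeSpectrum.localization_away_comap_range (AddMonoidAlgebra K (dualMonoid τ))
    (AddMonoidAlgebra.single u 1 : AddMonoidAlgebra K (dualMonoid σ))

instance Fan.isLocallyDirected_diagram (K : Type u) [Field K] {n : ℕ} (Δ : Fan n) :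
    (Δ.diagram K ⋙ Scheme.forget).IsLocallyDirected := by
  constructor
  intro i j k fi fj xi xj hx
  let l : Δ.cones := ⟨i.1 ⊓ j.1, Δ.face_mem _ i.2 _ (Δ.inter_isFace _ i.2 _ j.2)⟩
  let li : l ⟶ i := homOfLE (show i.1 ⊓ j.1 ≤ i.1 from inf_le_left)
  let lj : l ⟶ j := homOfLE (show i.1 ⊓ j.1 ≤ j.1 from inf_le_right)
  obtain ⟨s, hs⟩ := Δ.rational _ i.2
  obtain ⟨t, ht⟩ := Δ.rational _ k.2
  obtain ⟨u, hu⟩ := Δ.exists_isLocalization K j.2 k.2 (leOfHom fj)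
  have hxj : (PrimeSpectrum.comap (restrictionMap K (leOfHom fj)) xj) ∈
      PrimeSpectrum.basicOpen (AddMonoidAlgebra.single u (1 : K)) := by
    have := range_restrictionMap K t (leOfHom fj) ht u hu
    rw [← SetLike.mem_coe, ← this]
    exact ⟨xj, rfl⟩
  have hx' : PrimeSpectrum.comap (restrictionMap K (leOfHom fi)) xi =
    PrimeSpectrum.comap (restrictionMap K (leOfHom fj)) xj := hx
  rw [← hx'] at hxj
  have hl : ∀ x, x ∈ l.1 ↔ x ∈ i.1 ∧
      toReal (AddSubmonoid.inclusion (dualMonoid_anti (leOfHom fi)) u).1 ⬝ᵥ x = 0 := by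
    intro x
    change x ∈ i.1 ∧ x ∈ j.1 ↔ x ∈ i.1 ∧ toReal u.1 ⬝ᵥ x = 0
    rw [hu]
    exact ⟨fun h => ⟨h.1, h.2.2⟩, fun h => ⟨h.1, leOfHom fi h.1, h.2⟩⟩
  have hr := range_restrictionMap K s (leOfHom li) hs _ hl
  have hxi : xi ∈ Set.range (PrimeSpectrum.comap (restrictionMap K (leOfHom li))) := by
    rw [hr]
    intro hmem
    apply hxj
    change restrictionMap K (leOfHom fi) (AddMonoidAlgebra.single u 1) ∈ xi.asIdeal
    rw [restrictionMap_single]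
    exact hmem
  obtain ⟨z, hz⟩ := hxi
  refine ⟨l, li, lj, z, hz, ?_⟩
  have hinj : Function.Injective ((Δ.diagram K ⋙ Scheme.forget).map fj) :=
    ((Δ.diagram K).map fj).isOpenEmbedding.injective
  apply hinj
  rw [← hx]
  have h1 : (Δ.diagram K ⋙ Scheme.forget).map li z = xi := hz
  rw [← h1]
  have h2 : (Δ.diagram K ⋙ Scheme.forget).map lj ≫ (Δ.diagram K ⋙ Scheme.forget).map fj =
      (Δ.diagram K ⋙ Scheme.forget).map li ≫ (Δ.diagram K ⋙ Scheme.forget).map fi := by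
    rw [← Functor.map_comp, ← Functor.map_comp]
    rfl
  exact ConcreteCategory.congr_hom h2 z

/-- The toric variety `X(Δ)` over `K`, glued from the charts `U_σ = Spec K[S_σ]`. -/
def Fan.toricVariety (K : Type u) [Field K] {n : ℕ} (Δ : Fan n) : Scheme.{u} :=
  colimit (Δ.diagram K)

/-- The open immersion of the chart `U_σ` in the toric variety. -/
def Fan.chart (K : Type u) [Field K] {n : ℕ} (Δ : Fan n) (σ : Δ.cones) :
    Spec (CommRingCat.of (AddMonoidAlgebra K (dualMonoid σ.1))) ⟶ Δ.toricVariety K :=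
  colimit.ι (Δ.diagram K) σ

/-! ### Torus-invariant divisors

A `T`-divisor `D = ∑ a_v D_v` is given by its integer coefficients `a_v`, `v ∈ Δ.rays`. -/

/-- The `T`-divisor `D` is Cartier: on each chart `U_σ` it is principal, `D = div(χ^{-u})` for some
`u ∈ M`. -/
def Fan.IsCartier {n : ℕ} (Δ : Fan n) (a : Δ.rays → ℤ) : Prop :=
  ∀ σ ∈ Δ.cones, ∃ u : Fin n → ℤ, ∀ v : Δ.rays, toReal v.1 ∈ σ → u ⬝ᵥ v.1 = -a v

/-- The polytope `P_D = {u ∈ M_ℝ | ⟨u, v⟩ ≥ -a_v for all rays v}`. -/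
def Fan.polytope {n : ℕ} (Δ : Fan n) (a : Δ.rays → ℤ) : Set (Fin n → ℝ) :=
  {x | ∀ v : Δ.rays, -(a v : ℝ) ≤ x ⬝ᵥ toReal v.1}

/-- The set `P ∩ M` of lattice points. For `P = P_D`, the characters `χ^u` with `u ∈ P ∩ M` form a
basis of the space of global sections of `𝒪(D)`. -/
def latticePoints {n : ℕ} (P : Set (Fin n → ℝ)) : Set (Fin n → ℤ) := {u | toReal u ∈ P}

attribute [local instance] MvPolynomial.gradedAlgebra

/-- The projective space `ℙ^{r-1}` over `K` with homogeneous coordinates `Y_i`, `i ∈ A`,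
where `r = #A`. -/
abbrev projectiveSpace (K : Type u) [Field K] (A : Type) : Scheme.{u} :=
  Proj (MvPolynomial.homogeneousSubmodule A K)

/-- The ring map `K[Y_i : i ∈ A] → B`, `Y_i ↦ b_i`, into the ring of functions on `Spec B`. -/
def coordinateMap (K : Type u) [Field K] {A : Type} {B : Type u} [CommRing B] [Algebra K B]
    (b : A → B) : MvPolynomial A K →+* Γ(Spec (CommRingCat.of B), ⊤) :=
  (Scheme.ΓSpecIso (CommRingCat.of B)).inv.hom.comp
    (MvPolynomial.aeval b : MvPolynomial A K →ₐ[K] B).toRingHom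

lemma coordinateMap_irrelevant (K : Type u) [Field K] {A : Type} {B : Type u} [CommRing B]
    [Algebra K B] (b : A → B) (hb : Ideal.span (Set.range b) = ⊤) :
    (HomogeneousIdeal.irrelevant (MvPolynomial.homogeneousSubmodule A K)).toIdeal.map
      (coordinateMap K b) = ⊤ := by
  rw [coordinateMap, ← Ideal.map_map]
  suffices h : (HomogeneousIdeal.irrelevant (MvPolynomial.homogeneousSubmodule A K)).toIdeal.map
      (MvPolynomial.aeval b : MvPolynomial A K →ₐ[K] B).toRingHom = ⊤ by
    rw [h, Ideal.map_top]
  rw [eq_top_iff, ← hb, Ideal.span_le]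
  rintro _ ⟨i, rfl⟩
  have hX : (MvPolynomial.X i : MvPolynomial A K) ∈
      (HomogeneousIdeal.irrelevant (MvPolynomial.homogeneousSubmodule A K)).toIdeal := by
    rw [HomogeneousIdeal.mem_iff, HomogeneousIdeal.mem_irrelevant_iff, GradedRing.proj_apply]
    exact DirectSum.decompose_of_mem_ne _ (MvPolynomial.isHomogeneous_X K i) one_ne_zero
  have := Ideal.mem_map_of_mem (MvPolynomial.aeval b : MvPolynomial A K →ₐ[K] B).toRingHom hX
  simpa using this

/-- The morphism `Spec B → ℙ^{r-1}`, `x ↦ (b_1(x) : … : b_r(x))`, given by functions `b_i ∈ B` which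
generate the unit ideal. -/
def mapOfFunctions (K : Type u) [Field K] {A : Type} {B : Type u} [CommRing B] [Algebra K B]
    (b : A → B) (hb : Ideal.span (Set.range b) = ⊤) :
    Spec (CommRingCat.of B) ⟶ projectiveSpace K A :=
  Proj.fromOfGlobalSections (MvPolynomial.homogeneousSubmodule A K) (coordinateMap K b)
    (coordinateMap_irrelevant K b hb)

/-- The `T`-divisor `D` is very ample: the global sections `χ^u`, `u ∈ P_D ∩ M`, of `𝒪(D)` have no
common zero, and the morphism `φ_D : X(Δ) → ℙ^{r-1}`, `x ↦ (χ^{u_1}(x) : … : χ^{u_r}(x))`,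
is a closed embedding. On the chart `U_σ` the sheaf `𝒪(D)` is freely generated by a character
`χ^{u₀}` with `⟨u₀, v⟩ = -a_v` for all rays `v` in `σ`, the section `χ^u` is the multiple by the
function `χ^{u - u₀} ∈ K[S_σ]` of this generator, and `φ_D` is given by these functions. -/
def Fan.IsVeryAmple (K : Type u) [Field K] {n : ℕ} (Δ : Fan n) (a : Δ.rays → ℤ) : Prop :=
  ∃ f : Δ.toricVariety K ⟶ projectiveSpace K (latticePoints (Δ.polytope a)),
    IsClosedImmersion f ∧
    ∀ σ : Δ.cones, ∃ (u₀ : Fin n → ℤ) (s : latticePoints (Δ.polytope a) → dualMonoid σ.1)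
      (hs : Ideal.span (Set.range fun u =>
        (AddMonoidAlgebra.single (s u) 1 : AddMonoidAlgebra K (dualMonoid σ.1))) = ⊤),
      (∀ v : Δ.rays, toReal v.1 ∈ σ.1 → u₀ ⬝ᵥ v.1 = -a v) ∧
      (∀ u, (s u : Fin n → ℤ) = u.1 - u₀) ∧
      Δ.chart K σ ≫ f = mapOfFunctions K _ hs

/-! ### The homogeneous coordinate ring -/

/-- The semigroup generated by the points `(u, 1)`, `u ∈ P ∩ M`, in `M × ℤ`. -/
def coneSemigroup {n : ℕ} (P : Set (Fin n → ℝ)) : AddSubmonoid ((Fin n → ℤ) × ℤ) :=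
  AddSubmonoid.closure ((fun u => (u, (1 : ℤ))) '' latticePoints P)

/-- The semigroup ring `K[S] = K[χ^{(u,1)} : u ∈ P ∩ M]`, graded by the last coordinate. For
`P = P_D` it is the homogeneous coordinate ring of `X` in the embedding `φ_D`. -/
abbrev coordinateRing (K : Type u) [Field K] {n : ℕ} (P : Set (Fin n → ℝ)) : Type u :=
  AddMonoidAlgebra K (coneSemigroup P)

/-- The graded maximal ideal `⨁_{i ≥ 1} K[S]_i`. -/
def gradedMaximalIdeal (K : Type u) [Field K] {n : ℕ} (P : Set (Fin n → ℝ)) :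
    Ideal (coordinateRing K P) :=
  Ideal.span {f | ∃ s : coneSemigroup P, 0 < s.1.2 ∧ f = AddMonoidAlgebra.single s 1}

/-! ### Multiplicities -/

/-- The Krull dimension of `R`, as a natural number. -/
def krullDim (R : Type*) [CommRing R] : ℕ := ((ringKrullDim R).unbotD 0).toNat

/-- The length of the `R`-module `R/I`, as a real number. -/
def colength {R : Type*} [CommRing R] (I : Ideal R) : ℝ := ((Module.length R (R ⧸ I)).toNat : ℝ)

/-- The ideal `I^{[q]}` generated by the `q`-th powers of the elements of `I`. -/
def frobeniusPower {R : Type*} [CommRing R] (I : Ideal R) (q : ℕ) : Ideal R :=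
  Ideal.span ((fun x => x ^ q) '' (I : Set R))

/-- The sequence `d! ℓ(R/I^t) / t^d`, with `d = dim R`. -/
def samuelSeq {R : Type*} [CommRing R] (I : Ideal R) (t : ℕ) : ℝ :=
  ((krullDim R).factorial : ℝ) * colength (I ^ t) / (t : ℝ) ^ krullDim R

/-- The (Hilbert-Samuel) multiplicity `e_0(R, I) = lim_t d! ℓ(R/I^t) / t^d`. -/
def e0 {R : Type*} [CommRing R] (I : Ideal R) : ℝ := limUnder atTop (samuelSeq I)

/-- The sequence `ℓ(R/I^{[q]}) / q^d`, with `q = p^t` and `d = dim R`. -/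
def hilbertKunzSeq (p : ℕ) {R : Type*} [CommRing R] (I : Ideal R) (t : ℕ) : ℝ :=
  colength (frobeniusPower I (p ^ t)) / ((p ^ t : ℕ) : ℝ) ^ krullDim R

/-- The Hilbert-Kunz multiplicity `e_HK(R, I) = lim_t ℓ(R/I^{[q]}) / q^d`, `q = p^t`,
of a ring of characteristic `p`. -/
def eHK (p : ℕ) {R : Type*} [CommRing R] (I : Ideal R) : ℝ := limUnder atTop (hilbertKunzSeq p I)

/-! ### The function `φ_D` -/

/-- The unit cell `W_v = v + [0,1]ⁿ`. -/
def unitCell {n : ℕ} (v : Fin n → ℤ) : Set (Fin n → ℝ) := toReal v +ᵥ Set.Icc (0 : Fin n → ℝ) 1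

/-- The cone `C_D` in `M_ℝ × ℝ` spanned by `P × {1}`. -/
def coneOver {n : ℕ} (P : Set (Fin n → ℝ)) : PointedCone ℝ ((Fin n → ℝ) × ℝ) :=
  PointedCone.hull ℝ (P ×ˢ {1})

/-- The function `φ_D(lam) = Vol_n ((W_v × {z = lam + 1}) \ ⋃_{u ∈ ℤⁿ} ((u, 1) + C_D))`,
where `Vol_n` is the Lebesgue measure on `ℝⁿ × {z = lam + 1} ≃ ℝⁿ`. -/
def phi {n : ℕ} (P : Set (Fin n → ℝ)) (v : Fin n → ℤ) (lam : ℝ) : ℝ :=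
  (MeasureTheory.volume {x : Fin n → ℝ | (x, lam + 1) ∈ (unitCell v ×ˢ {lam + 1}) \
    ⋃ u : Fin n → ℤ, (toReal u, (1 : ℝ)) +ᵥ (coneOver P : Set ((Fin n → ℝ) × ℝ))}).toReal

end Toric

end

/-!
Write `d = n + 1`, `P = P_D`, `C = C_D`, `S` for the semigroup generated by the points `(u, 1)`,
`u ∈ P ∩ M`, and `𝔪` for the graded maximal ideal of `R = K[S]`.

*From the divisor to the polytope.* Very ampleness enters through two facts about `P`
(`Toric.IsSpanningPolytope`, `Toric.Fan.IsVeryAmple.isSpanningPolytope`). Since the sections `χ^u`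
generate `𝒪(D)` on each chart, in each direction the minimum over `P` is attained at a lattice
point, so that `P` is the convex hull of finitely many lattice points. Since `φ_D` is a
monomorphism, the differences of these lattice points generate `M`
(`Toric.Fan.IsVeryAmple.dualMonoid_le`): otherwise two different points of a chart with values in a
group algebra `K[M/L]` would have the same image in projective space. It follows that `S` generates
`M × ℤ` as a group, that `S` contains a translate of all lattice points of `C` (`exists_conductor`),
and that `dim R = d` (`AddMonoidAlgebra.ringKrullDim_eq_of_forall_exists`).

*Multiplicities are volumes.* The ideals `(𝔪^k)^t` and `(𝔪^k)^[q]` are spanned by monomials, and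
the colength of such an ideal is the number of monomials which it misses
(`AddMonoidAlgebra.length_quotient_monomialIdeal`). As `S` and the lattice points of `C` differ by
`o(q^d)` points up to degree `O(q)`, counting lattice points in dilates of a region gives
`e_0(𝔪^k) = d! vol {x ∈ C : height < k}`, which is `(d - 1)! k^d vol(P)`, and
`e_HK(𝔪^k) = vol(C ∖ ⋃ ((g, k) + C))`, the union being over the elements `(g, k)` of degree `k`
of `S` (`Toric.hilbertKunzRegion`).

*The limit.* The second region contains the truncated cone of the first, so by Cavalieri's principle
`e_HK(𝔪^k) - e_0(𝔪^k)/d!` is the integral over `lam > 0` of the volume of its slice at height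
`k + lam` (`volume_hilbertKunzRegion`). Up to a neighbourhood of the boundary of volume
`O(k^(d-2))`, this slice consists of the points of `k • P` which lie in no lattice translate of
`lam • P`. The set of such points is periodic, with volume `φ_D(lam)` in each unit cell, and `k • P`
contains about `k^(d-1) vol(P)` cells; so the slice divided by `k^(d-1)` tends to
`vol(P) φ_D(lam)` (`tendsto_volume_slice`). The slices vanish for large `lam`, uniformly in `k`, and
dominated convergence finishes the proof, since `vol(P) = e_0(𝔪)/(d - 1)!`.
-/

/-! ### Morphisms to projective space -/

namespace AlgebraicGeometry.Proj

/-- If a homogeneous element `t` goes to a unit, the morphism to `Proj` defined by global sections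
factors through the single affine chart `D₊(t)`. -/
theorem fromOfGlobalSections_eq_toSpecΓ_comp {X : Scheme.{u}} {A : Type u} {σ : Type*}
    [CommRing A] [SetLike σ A] [AddSubgroupClass σ A]
    (𝒜 : ℕ → σ) [GradedRing 𝒜] (f : A →+* Γ(X, ⊤))
    (hf : (HomogeneousIdeal.irrelevant 𝒜).toIdeal.map f = ⊤) {t : A} {d : ℕ} (hd : 0 < d)
    (ht : t ∈ 𝒜 d) (hu : IsUnit (f t)) :
    fromOfGlobalSections 𝒜 f hf = X.toSpecΓ ≫
      Spec.map (CommRingCat.ofHom ((IsLocalization.Away.lift (S := Localization.Away t) t hu).comp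
        (algebraMap (HomogeneousLocalization.Away 𝒜 t) (Localization.Away t)))) ≫
      awayι 𝒜 t ht hd := by
  have htop : X.basicOpen (f t) = ⊤ := Scheme.basicOpen_of_isUnit _ hu
  have hiso : IsIso (X.basicOpen (f t)).ι := by
    rw [htop]
    exact inferInstanceAs (IsIso X.topIso.hom)
  rw [← cancel_epi (X.basicOpen (f t)).ι]
  have h1 : (X.basicOpen (f t)).ι ≫ fromOfGlobalSections 𝒜 f hf =
      toBasicOpenOfGlobalSections 𝒜 f rfl hd ht ≫ (basicOpen 𝒜 t).ι :=
    (openCoverOfMapIrrelevantEqTop 𝒜 f hf).ι_glueMorphisms _ _ ⟨d, t, hd, ht⟩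
  rw [h1]
  simp only [toBasicOpenOfGlobalSections, Category.assoc, basicOpenIsoSpec_inv_ι]
  simp only [← Category.assoc]
  congr 1
  simp only [Category.assoc]
  have h2 : (CommRingCat.ofHom ((IsLocalization.map (M := .powers t) (T := .powers (f t))
        (Localization.Away (f t)) f (by rw [← Submonoid.map_le_iff_le_comap, Submonoid.map_powers])).comp
        (algebraMap (HomogeneousLocalization.Away 𝒜 t) (Localization.Away t)))) =
      CommRingCat.ofHom ((IsLocalization.Away.lift (S := Localization.Away t) t hu).comp
        (algebraMap (HomogeneousLocalization.Away 𝒜 t) (Localization.Away t))) ≫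
      CommRingCat.ofHom (algebraMap Γ(X, ⊤) (Localization.Away (f t))) := by
    rw [← CommRingCat.ofHom_comp, ← RingHom.comp_assoc]
    congr 2
    apply IsLocalization.ringHom_ext (M := .powers t)
    ext x
    simp
  rw [h2, Spec.map_comp, basicOpenIsoSpecAway_hom_SpecMap_assoc]
  have h3 : (X.isoOfEq (X.toSpecΓ_preimage_basicOpen (f t))).inv ≫
      (X.toSpecΓ ∣_ PrimeSpectrum.basicOpen (f t)) ≫
        Scheme.Opens.ι (X := Spec Γ(X, ⊤)) (PrimeSpectrum.basicOpen (f t)) =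
      (X.basicOpen (f t)).ι ≫ X.toSpecΓ := by
    refine (congrArg (_ ≫ ·) (morphismRestrict_ι X.toSpecΓ _)).trans ?_
    rw [← Category.assoc]
    exact congrArg (· ≫ X.toSpecΓ) (Scheme.isoOfEq_inv_ι _ _)
  exact congrArg (· ≫ Spec.map (CommRingCat.ofHom
    ((IsLocalization.Away.lift (S := Localization.Away t) t hu).comp
      (algebraMap (HomogeneousLocalization.Away 𝒜 t) (Localization.Away t))))) h3

end AlgebraicGeometry.Proj

namespace Toric

attribute [local instance] MvPolynomial.gradedAlgebra

theorem X_mem_homogeneousSubmodule (K : Type u) [Field K] {A : Type} (i : A) :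
    MvPolynomial.X i ∈ MvPolynomial.homogeneousSubmodule A K 1 :=
  MvPolynomial.isHomogeneous_X K i

/-- If `b i` is a unit, then `x ↦ (b_1(x) : … : b_r(x))` is the morphism to the affine chart
`Y_i ≠ 0` given by the functions `b_j / b_i`. -/
theorem exists_mapOfFunctions_eq (K : Type u) [Field K] {A : Type} {B : Type u} [CommRing B]
    [Algebra K B] (b : A → B) (hb : Ideal.span (Set.range b) = ⊤) (i : A) (hi : IsUnit (b i)) :
    ∃ γ : HomogeneousLocalization.Away (MvPolynomial.homogeneousSubmodule A K) (MvPolynomial.X i) →+* B,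
      (∀ (m : ℕ) (P : MvPolynomial A K) (hP : P ∈ MvPolynomial.homogeneousSubmodule A K (m • 1)),
        γ (HomogeneousLocalization.Away.mk _ (X_mem_homogeneousSubmodule K i) m P hP) *
          b i ^ m = MvPolynomial.aeval b P) ∧
      mapOfFunctions K b hb = Spec.map (CommRingCat.ofHom γ) ≫
        Proj.awayι _ (MvPolynomial.X i) (X_mem_homogeneousSubmodule K i) one_pos := by
  have hX : coordinateMap K b (MvPolynomial.X i) = (Scheme.ΓSpecIso (CommRingCat.of B)).inv.hom (b i) := by
    simp [coordinateMap]
  have hu : IsUnit (coordinateMap K b (MvPolynomial.X i)) := by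
    rw [hX]; exact hi.map _
  set g := (IsLocalization.Away.lift
      (S := Localization.Away (MvPolynomial.X i : MvPolynomial A K)) _ hu).comp
        (algebraMap (HomogeneousLocalization.Away (MvPolynomial.homogeneousSubmodule A K)
          (MvPolynomial.X i)) (Localization.Away (MvPolynomial.X i))) with hg
  refine ⟨(Scheme.ΓSpecIso (CommRingCat.of B)).hom.hom.comp g, ?_, ?_⟩
  · intro m P hP
    have hl : Localization.mk P (⟨MvPolynomial.X i ^ m, m, rfl⟩ :
        Submonoid.powers (MvPolynomial.X i : MvPolynomial A K)) *
        algebraMap _ (Localization.Away (MvPolynomial.X i : MvPolynomial A K))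
          ((MvPolynomial.X i : MvPolynomial A K) ^ m) =
          algebraMap _ _ P := by
      rw [Localization.mk_eq_mk']
      exact IsLocalization.mk'_spec _ _ _
    have h1 : g (HomogeneousLocalization.Away.mk _ (X_mem_homogeneousSubmodule K i) m P hP) *
        coordinateMap K b (MvPolynomial.X i) ^ m = coordinateMap K b P := by
      rw [hg, RingHom.comp_apply, HomogeneousLocalization.algebraMap_apply,
        HomogeneousLocalization.Away.val_mk, ← map_pow,
        ← IsLocalization.Away.lift_eq
          (S := Localization.Away (MvPolynomial.X i : MvPolynomial A K)) _ hu (MvPolynomial.X i ^ m),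
        ← map_mul, hl, IsLocalization.Away.lift_eq]
    have h2 := congrArg (Scheme.ΓSpecIso (CommRingCat.of B)).hom.hom h1
    have hinv : ∀ x : B, (Scheme.ΓSpecIso (CommRingCat.of B)).hom.hom
        ((Scheme.ΓSpecIso (CommRingCat.of B)).inv.hom x) = x := fun x => by
      rw [← RingHom.comp_apply, ← CommRingCat.hom_comp]
      simp
    rw [map_mul, map_pow, hX, hinv] at h2
    exact h2.trans (hinv _)
  · rw [mapOfFunctions, Proj.fromOfGlobalSections_eq_toSpecΓ_comp _ _ _ one_pos
      (X_mem_homogeneousSubmodule K i) hu, CommRingCat.ofHom_comp, Spec.map_comp]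
    simp [hg]

/-- Two points at which all the `b_j` take the same value, a unit, have the same image
`(1 : … : 1)` in projective space, though this value may differ between the two points. -/
theorem SpecMap_comp_mapOfFunctions_eq (K : Type u) [Field K] {A : Type} {B B' : Type u} [CommRing B]
    [CommRing B'] [Algebra K B] [Algebra K B'] (b : A → B) (hb : Ideal.span (Set.range b) = ⊤) (i : A)
    (hi : IsUnit (b i)) (f g : B →ₐ[K] B') (hf : ∀ j, f (b j) = f (b i)) (hg : ∀ j, g (b j) = g (b i)) :
    Spec.map (CommRingCat.ofHom f.toRingHom) ≫ mapOfFunctions K b hb =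
      Spec.map (CommRingCat.ofHom g.toRingHom) ≫ mapOfFunctions K b hb := by
  obtain ⟨γ, hγ, h⟩ := exists_mapOfFunctions_eq K b hb i hi
  rw [h, ← Spec.map_comp_assoc, ← Spec.map_comp_assoc, ← CommRingCat.ofHom_comp,
    ← CommRingCat.ofHom_comp]
  congr 3
  have key : ∀ (f : B →ₐ[K] B'), (∀ j, f (b j) = f (b i)) → ∀ (m : ℕ) (P : MvPolynomial A K)
      (hP : P ∈ MvPolynomial.homogeneousSubmodule A K (m • 1)),
      f (γ (HomogeneousLocalization.Away.mk _ (X_mem_homogeneousSubmodule K i) m P hP)) =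
        algebraMap K B' (MvPolynomial.aeval (fun _ => (1 : K)) P) := by
    intro f hf m P hP
    have h1 := congrArg f (hγ m P hP)
    have h2 : f (MvPolynomial.aeval b P) =
        algebraMap K B' (MvPolynomial.aeval (fun _ => (1 : K)) P) * f (b i) ^ m := by
      rw [MvPolynomial.aeval_def, MvPolynomial.aeval_def, MvPolynomial.eval₂_eq,
        MvPolynomial.eval₂_eq, map_sum, map_sum, Finset.sum_mul]
      refine Finset.sum_congr rfl fun e he => ?_
      have hdeg : ∑ j ∈ e.support, e j = m := by
        have := hP (MvPolynomial.mem_support_iff.1 he)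
        simpa [Finsupp.weight_apply, Finsupp.sum] using this
      simp only [map_mul, map_prod, map_pow, AlgHom.commutes, hf, Finset.prod_pow_eq_pow_sum, hdeg]
      simp
    rw [map_mul, h2, map_pow] at h1
    exact ((hi.map f).pow m).mul_right_cancel h1
  ext z
  obtain ⟨m, P, hP, rfl⟩ := HomogeneousLocalization.Away.mk_surjective _ (X_mem_homogeneousSubmodule K i) z
  exact (key f hf m P hP).trans (key g hg m P hP).symm

instance (K : Type u) [Field K] {n : ℕ} (Δ : Fan n) (σ : Δ.cones) :
    IsOpenImmersion (Δ.chart K σ) := by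
  have : Small.{u} Δ.cones := inferInstance
  have : Quiver.IsThin Δ.cones := inferInstance
  have : (Δ.diagram K ⋙ Scheme.forget).IsLocallyDirected := inferInstance
  have : ∀ {i j : Δ.cones} (f : i ⟶ j), IsOpenImmersion ((Δ.diagram K).map f) := inferInstance
  exact Scheme.IsLocallyDirected.instIsOpenImmersionι (Δ.diagram K) σ

/-- If monomials generate the unit ideal, then one of them is a unit. -/
theorem exists_add_eq_zero_of_span_eq_top (K : Type u) [Field K] {G ι : Type*} [AddCommMonoid G]
    (s : ι → G) (hs : Ideal.span (Set.range fun i =>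
      (AddMonoidAlgebra.single (s i) 1 : AddMonoidAlgebra K G)) = ⊤) : ∃ i d, d + s i = 0 := by
  have h1 : (AddMonoidAlgebra.single 0 1 : AddMonoidAlgebra K G) ∈
      Ideal.span (AddMonoidAlgebra.of' K G '' Set.range s) := by
    rw [← Set.range_comp]
    exact (Ideal.eq_top_iff_one _).1 hs
  rw [AddMonoidAlgebra.mem_ideal_span_of'_image] at h1
  obtain ⟨_, ⟨i, rfl⟩, d, h⟩ := h1 0 (by simp)
  exact ⟨i, d, h.symm⟩

theorem isUnit_single_of_add_eq_zero (K : Type u) [Field K] {G : Type*} [AddCommMonoid G] {a b : G}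
    (h : b + a = 0) : IsUnit (AddMonoidAlgebra.single a 1 : AddMonoidAlgebra K G) := by
  refine IsUnit.of_mul_eq_one (AddMonoidAlgebra.single b 1) ?_
  rw [AddMonoidAlgebra.single_mul_single, add_comm, h, one_mul]
  rfl

/-- As `φ_D` is a monomorphism, the differences of the lattice points of `P_D` generate a group
which contains the characters that are regular on a chart: if they lie in `L`, then the points
`χ^m ↦ [m]` and `χ^m ↦ 1` of the chart `U_σ` with values in `K[M/L]` have the same image in
projective space, so that they coincide. -/
theorem Fan.IsVeryAmple.dualMonoid_le (K : Type u) [Field K] {n : ℕ} {Δ : Fan n} {a : Δ.rays → ℤ}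
    (hD : Δ.IsVeryAmple K a) (L : AddSubgroup (Fin n → ℤ))
    (hL : ∀ u ∈ latticePoints (Δ.polytope a), ∀ w ∈ latticePoints (Δ.polytope a), u - w ∈ L)
    (σ : Δ.cones) {m : Fin n → ℤ} (hm : m ∈ dualMonoid σ.1) : m ∈ L := by
  obtain ⟨f, hf, h⟩ := hD
  obtain ⟨u₀, s, hs, -, hsu, hcomp⟩ := h σ
  obtain ⟨i, d, hd⟩ := exists_add_eq_zero_of_span_eq_top K s hs
  let π : dualMonoid σ.1 →+ (Fin n → ℤ) ⧸ L := (QuotientAddGroup.mk' L).comp (dualMonoid σ.1).subtype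
  let F : AddMonoidAlgebra K (dualMonoid σ.1) →ₐ[K] AddMonoidAlgebra K ((Fin n → ℤ) ⧸ L) :=
    AddMonoidAlgebra.mapDomainAlgHom K K π
  let G : AddMonoidAlgebra K (dualMonoid σ.1) →ₐ[K] AddMonoidAlgebra K ((Fin n → ℤ) ⧸ L) :=
    AddMonoidAlgebra.mapDomainAlgHom K K 0
  have hFG : Spec.map (CommRingCat.ofHom F.toRingHom) ≫ mapOfFunctions K _ hs =
      Spec.map (CommRingCat.ofHom G.toRingHom) ≫ mapOfFunctions K _ hs := by
    refine SpecMap_comp_mapOfFunctions_eq K _ hs i (isUnit_single_of_add_eq_zero K hd) F G ?_ ?_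
    · intro j
      have : π (s j) = π (s i) := by
        refine (QuotientAddGroup.eq_iff_sub_mem).2 ?_
        simp only [AddSubmonoid.subtype_apply, hsu]
        rw [sub_sub_sub_cancel_right]
        exact hL _ j.2 _ i.2
      simp [F, this]
    · intro j
      simp [G]
  rw [← hcomp] at hFG
  have hFG' := (cancel_mono _).1 hFG
  have h2 : CommRingCat.ofHom F.toRingHom = CommRingCat.ofHom G.toRingHom := Spec.map_injective hFG'
  have h3 : F (AddMonoidAlgebra.single ⟨m, hm⟩ 1) = G (AddMonoidAlgebra.single ⟨m, hm⟩ 1) :=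
    congrArg (fun φ => φ.hom (AddMonoidAlgebra.single ⟨m, hm⟩ 1)) h2
  have h4 : π ⟨m, hm⟩ = 0 := by
    simpa [F, G, AddMonoidAlgebra.single_left_inj] using h3
  exact (QuotientAddGroup.eq_zero_iff m).1 h4

end Toric

/-! ### Rational cones -/

namespace Toric

theorem mem_hull_image_finset {E ι : Type*} [AddCommGroup E] [Module ℝ E] (s : Finset ι)
    (f : ι → E) (x : E) : x ∈ PointedCone.hull ℝ (f '' (s : Set ι)) ↔
      ∃ t : ι → ℝ, (∀ i, 0 ≤ t i) ∧ x = ∑ i ∈ s, t i • f i := by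
  constructor
  · intro hx
    obtain ⟨c, hc⟩ := (Submodule.mem_span_image_finset_iff_exists_fun _).1 hx
    classical
    refine ⟨fun i => if h : i ∈ s then (c ⟨i, h⟩ : ℝ) else 0, fun i => ?_, ?_⟩
    · dsimp only
      split_ifs with h
      · exact (c ⟨i, h⟩).2
      · exact le_rfl
    · rw [← hc, ← Finset.sum_coe_sort s]
      exact Finset.sum_congr rfl fun i _ => by dsimp only; rw [dif_pos i.2]; rfl
  · rintro ⟨t, ht, rfl⟩
    exact sum_mem fun i hi => Submodule.smul_mem _ (⟨t i, ht i⟩ : {c : ℝ // 0 ≤ c})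
      (Submodule.subset_span ⟨i, hi, rfl⟩)

theorem smul_mem_cone {E : Type*} [AddCommGroup E] [Module ℝ E] {C : PointedCone ℝ E} {x : E}
    (hx : x ∈ C) {t : ℝ} (ht : 0 ≤ t) : t • x ∈ C :=
  Submodule.smul_mem C (⟨t, ht⟩ : {c : ℝ // 0 ≤ c}) hx

theorem toReal_dotProduct {n : ℕ} (u v : Fin n → ℤ) :
    toReal u ⬝ᵥ toReal v = ((u ⬝ᵥ v : ℤ) : ℝ) := by
  simp [dotProduct, toReal]

theorem toReal_injective {n : ℕ} : Function.Injective (toReal : (Fin n → ℤ) → Fin n → ℝ) := by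
  intro u v h
  ext i
  have := congrFun h i
  exact Int.cast_injective this

theorem toReal_neg {n : ℕ} (v : Fin n → ℤ) : toReal (-v) = -toReal v := by
  ext i; simp [toReal]

theorem toReal_sub {n : ℕ} (v w : Fin n → ℤ) : toReal (v - w) = toReal v - toReal w := by
  ext i; simp [toReal]

theorem toReal_zsmul {n : ℕ} (k : ℤ) (v : Fin n → ℤ) : toReal (k • v) = (k : ℝ) • toReal v := by
  ext i; simp [toReal]

/-- A real linear form which is positive on finitely many integral vectors can be replaced by an
integral one: round a large multiple of it. -/
theorem exists_int_dotProduct_pos_of_real {n : ℕ} (T : Finset (Fin n → ℤ)) (y : Fin n → ℝ)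
    (hy : ∀ w ∈ T, 0 < y ⬝ᵥ toReal w) : ∃ z : Fin n → ℤ, ∀ w ∈ T, 0 < z ⬝ᵥ w := by
  have key : ∀ w ∈ T, ∀ᶠ N : ℕ in atTop, 0 < (fun i => ⌊(N : ℝ) * y i⌋) ⬝ᵥ w := by
    intro w hw
    have hlim : Tendsto (fun N : ℕ => (N : ℝ) * (y ⬝ᵥ toReal w)) atTop atTop :=
      tendsto_natCast_atTop_atTop.atTop_mul_const (hy w hw)
    filter_upwards [hlim.eventually_gt_atTop (∑ i, |(w i : ℝ)|)] with N hN
    have h1 : (N : ℝ) * (y ⬝ᵥ toReal w) - ∑ i, |(w i : ℝ)| ≤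
        (((fun i => ⌊(N : ℝ) * y i⌋) ⬝ᵥ w : ℤ) : ℝ) := by
      simp only [dotProduct, toReal, Int.cast_sum, Int.cast_mul, Finset.mul_sum]
      rw [← Finset.sum_sub_distrib]
      refine Finset.sum_le_sum fun i _ => ?_
      have h2 : |(N : ℝ) * y i - ⌊(N : ℝ) * y i⌋| ≤ 1 := by
        rw [abs_le]
        constructor <;> linarith [Int.floor_le ((N : ℝ) * y i), Int.lt_floor_add_one ((N : ℝ) * y i)]
      have h3 : |((N : ℝ) * y i - ⌊(N : ℝ) * y i⌋) * w i| ≤ |(w i : ℝ)| := by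
        rw [abs_mul]
        exact mul_le_of_le_one_left (abs_nonneg _) h2
      nlinarith [(abs_le.1 h3).2]
    have : (0 : ℝ) < (((fun i => ⌊(N : ℝ) * y i⌋) ⬝ᵥ w : ℤ) : ℝ) := by linarith
    exact_mod_cast this
  obtain ⟨N, hN⟩ := ((Filter.eventually_all_finset T).2 key).exists
  exact ⟨_, hN⟩

/-- An integral form of Gordan's theorem of the alternative, relative to the line spanned by `v`. -/
theorem exists_int_dotProduct_pos {n : ℕ} (T : Finset (Fin n → ℤ)) (v : Fin n → ℤ)
    (h : ∀ t : (Fin n → ℤ) → ℝ, (∀ w, 0 ≤ t w) → ∑ w ∈ T, t w = 1 → ∀ c : ℝ,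
      ∑ w ∈ T, t w • toReal w ≠ c • toReal v) :
    ∃ u : Fin n → ℤ, u ⬝ᵥ v = 0 ∧ ∀ w ∈ T, 0 < u ⬝ᵥ w := by
  classical
  have hcomp : IsCompact (convexHull ℝ (toReal '' (T : Set (Fin n → ℤ)))) :=
    Set.Finite.isCompact_convexHull ℝ (T.finite_toSet.image _)
  have hdisj : Disjoint (convexHull ℝ (toReal '' (T : Set (Fin n → ℤ))))
      (Submodule.span ℝ {toReal v} : Set (Fin n → ℝ)) := by
    rw [Set.disjoint_left]
    intro x hx hx'
    obtain ⟨c, rfl⟩ := Submodule.mem_span_singleton.1 hx'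
    rw [← Finset.coe_image, Finset.mem_convexHull'] at hx
    obtain ⟨t, ht, ht1, htx⟩ := hx
    rw [Finset.sum_image toReal_injective.injOn] at ht1 htx
    refine h (fun w => if w ∈ T then t (toReal w) else 0) ?_ ?_ c ?_
    · intro w
      split_ifs with hw
      · exact ht _ (Finset.mem_image_of_mem _ hw)
      · exact le_rfl
    · rw [← ht1]
      exact Finset.sum_congr rfl fun w hw => if_pos hw
    · rw [← htx]
      exact Finset.sum_congr rfl fun w hw => by rw [if_pos hw]
  obtain ⟨f, a, b, hfa, hab, hfb⟩ := geometric_hahn_banach_compact_closed (convex_convexHull ℝ _)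
    hcomp (Submodule.convex _) (Submodule.closed_of_finiteDimensional _) hdisj
  have hb0 : b < 0 := by simpa using hfb 0 (zero_mem _)
  have hfv : f (toReal v) = 0 := by
    by_contra hne
    have := hfb ((b / f (toReal v)) • toReal v)
      (Submodule.smul_mem _ _ (Submodule.mem_span_singleton_self _))
    rw [map_smul, smul_eq_mul, div_mul_cancel₀ _ hne] at this
    exact lt_irrefl _ this
  set y : Fin n → ℝ := fun i => -f (Pi.single i 1) with hy
  have hfy : ∀ x, y ⬝ᵥ x = -f x := by
    intro x
    conv_rhs => rw [← Finset.univ_sum_single x]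
    rw [map_sum, dotProduct, ← Finset.sum_neg_distrib]
    refine Finset.sum_congr rfl fun i _ => ?_
    have : (Pi.single i (x i) : Fin n → ℝ) = x i • Pi.single i 1 := by
      rw [← Pi.single_smul]; simp
    rw [this, map_smul, smul_eq_mul, hy]
    ring
  have hyT : ∀ w ∈ T, 0 < y ⬝ᵥ toReal w := by
    intro w hw
    rw [hfy]
    linarith [hfa (toReal w) (subset_convexHull ℝ _ ⟨w, hw, rfl⟩)]
  by_cases hv : v = 0
  · obtain ⟨z, hz⟩ := exists_int_dotProduct_pos_of_real T y hyT
    exact ⟨z, by simp [hv], hz⟩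
  have hvv : 0 < v ⬝ᵥ v := by
    refine lt_of_le_of_ne (Finset.sum_nonneg fun i _ => mul_self_nonneg _) fun h0 => hv ?_
    exact dotProduct_self_eq_zero.1 h0.symm
  -- Rounding `y` leaves the hyperplane `v^⊥`; projecting back to it, scaled to keep integrality,
  -- amounts to testing against the projections of the vectors of `T`.
  obtain ⟨z, hz⟩ := exists_int_dotProduct_pos_of_real
    (T.image fun w => (v ⬝ᵥ v) • w - (v ⬝ᵥ w) • v) y (by
      intro c hc
      obtain ⟨w, hw, rfl⟩ := Finset.mem_image.1 hc
      rw [toReal_sub, toReal_zsmul, toReal_zsmul, dotProduct_sub, dotProduct_smul, dotProduct_smul,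
        hfy (toReal v), hfv, neg_zero, smul_zero, sub_zero]
      exact mul_pos (by exact_mod_cast hvv) (hyT w hw))
  refine ⟨(v ⬝ᵥ v) • z - (z ⬝ᵥ v) • v, ?_, ?_⟩
  · simp only [sub_dotProduct, smul_dotProduct, smul_eq_mul]
    ring
  · intro w hw
    have := hz _ (Finset.mem_image_of_mem _ hw)
    simp only [dotProduct_sub, dotProduct_smul, sub_dotProduct, smul_dotProduct, smul_eq_mul] at this ⊢
    linarith [mul_comm (z ⬝ᵥ v) (v ⬝ᵥ w)]

/-- A nonzero lattice vector is a positive multiple of a primitive one. -/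
theorem exists_primitive {n : ℕ} {v : Fin n → ℤ} (hv : v ≠ 0) :
    ∃ (g : ℤ) (w : Fin n → ℤ), 0 < g ∧ v = g • w ∧ IsPrimitive w := by
  have hne : (Finset.univ : Finset (Fin n)).gcd v ≠ 0 := by
    intro h
    rw [Finset.gcd_eq_zero_iff] at h
    exact hv (funext fun i => h i (Finset.mem_univ i))
  have hpos : 0 < (Finset.univ : Finset (Fin n)).gcd v := by
    refine lt_of_le_of_ne ?_ hne.symm
    rw [← Finset.normalize_gcd]
    exact Int.nonneg_iff_normalize_eq_self _ |>.1 (by simp)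
  choose w hw using fun i => Finset.gcd_dvd (f := v) (Finset.mem_univ i)
  refine ⟨_, w, hpos, funext hw, ?_⟩
  intro k w' hk
  have h1 : (Finset.univ : Finset (Fin n)).gcd v * k ∣ (Finset.univ : Finset (Fin n)).gcd v := by
    refine Finset.dvd_gcd fun i _ => ?_
    conv_rhs => rw [hw i, hk]
    exact ⟨w' i, by simp [mul_assoc]⟩
  exact isUnit_of_dvd_one ((mul_dvd_mul_iff_left hne).1 (by simpa using h1))

theorem self_mem_hull {E : Type*} [AddCommGroup E] [Module ℝ E] (x : E) :
    x ∈ PointedCone.hull ℝ {x} :=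
  Submodule.mem_span_singleton_self x

theorem hull_toReal_zsmul {n : ℕ} {g : ℤ} (hg : 0 < g) (w : Fin n → ℤ) :
    PointedCone.hull ℝ {toReal (g • w)} = PointedCone.hull ℝ {toReal w} := by
  have hgR : (0 : ℝ) < g := by exact_mod_cast hg
  refine le_antisymm (Submodule.span_le.2 ?_) (Submodule.span_le.2 ?_)
  · rintro _ rfl
    rw [toReal_zsmul]
    exact smul_mem_cone (self_mem_hull _) hgR.le
  · rintro _ rfl
    have := smul_mem_cone (self_mem_hull (toReal (g • w))) (inv_nonneg.2 hgR.le)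
    rwa [toReal_zsmul, smul_smul, inv_mul_cancel₀ hgR.ne', one_smul, ← toReal_zsmul] at this

/-- If `u` vanishes at `v` and is positive on the other generators of a cone containing `v`, then
it cuts out the face spanned by `v` (the zero face if `v = 0`). -/
theorem mem_hull_singleton_iff {n : ℕ} {s : Finset (Fin n → ℤ)} {u v : Fin n → ℤ}
    (hv : toReal v ∈ PointedCone.hull ℝ (toReal '' (s : Set _))) (huv : u ⬝ᵥ v = 0)
    (hu : ∀ w ∈ s, w ≠ v → 0 < u ⬝ᵥ w) :
    (∀ x ∈ PointedCone.hull ℝ (toReal '' (s : Set _)), 0 ≤ toReal u ⬝ᵥ x) ∧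
    ∀ x, x ∈ PointedCone.hull ℝ {toReal v} ↔
      x ∈ PointedCone.hull ℝ (toReal '' (s : Set _)) ∧ toReal u ⬝ᵥ x = 0 := by
  have hu0 : ∀ w ∈ s, 0 ≤ toReal u ⬝ᵥ toReal w := fun w hw => by
    rw [toReal_dotProduct]
    by_cases hwv : w = v
    · rw [hwv, huv, Int.cast_zero]
    · exact_mod_cast (hu w hw hwv).le
  refine ⟨fun x hx => ?_, fun x => ⟨fun hx => ?_, fun ⟨hx, hx0⟩ => ?_⟩⟩
  · rw [mem_hull_image_finset] at hx
    obtain ⟨t, ht, rfl⟩ := hx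
    rw [dotProduct_sum]
    refine Finset.sum_nonneg fun w hw => ?_
    rw [dotProduct_smul]
    exact mul_nonneg (ht w) (hu0 w hw)
  · obtain ⟨c, rfl⟩ := Submodule.mem_span_singleton.1 hx
    refine ⟨Submodule.smul_mem _ _ hv, ?_⟩
    change toReal u ⬝ᵥ ((c : ℝ) • toReal v) = 0
    rw [dotProduct_smul, toReal_dotProduct, huv]
    simp
  · rw [mem_hull_image_finset] at hx
    obtain ⟨t, ht, rfl⟩ := hx
    rw [dotProduct_sum, Finset.sum_eq_zero_iff_of_nonneg (fun w hw => by
      rw [dotProduct_smul]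
      exact mul_nonneg (ht w) (hu0 w hw))] at hx0
    refine sum_mem fun w hw => ?_
    by_cases hwv : w = v
    · rw [hwv]
      exact smul_mem_cone (self_mem_hull _) (ht v)
    · have h1 := hx0 w hw
      have h2 : (0 : ℝ) < ((u ⬝ᵥ w : ℤ) : ℝ) := by exact_mod_cast hu w hw hwv
      rw [dotProduct_smul, toReal_dotProduct, smul_eq_mul, mul_eq_zero] at h1
      rw [h1.resolve_right h2.ne', zero_smul]
      exact zero_mem _

/-- Each cone of a fan is generated by the rays of the fan which it contains: the elements of a
minimal generating set span faces. -/
theorem Fan.le_hull_rays {n : ℕ} (Δ : Fan n) {σ : PointedCone ℝ (Fin n → ℝ)} (hσ : σ ∈ Δ.cones) :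
    σ ≤ PointedCone.hull ℝ (toReal '' {v | v ∈ Δ.rays ∧ toReal v ∈ σ}) := by
  classical
  obtain ⟨s, hs, hmin⟩ := WellFounded.has_min (measure Finset.card).wf
    {s : Finset (Fin n → ℤ) | σ = PointedCone.hull ℝ (toReal '' (s : Set _))} (Δ.rational σ hσ)
  have hs' : σ = PointedCone.hull ℝ (toReal '' (s : Set _)) := hs
  have hmem : ∀ w ∈ s, toReal w ∈ σ := fun w hw => by
    rw [hs']; exact Submodule.subset_span ⟨w, hw, rfl⟩
  have hirr : ∀ v ∈ s, toReal v ∉ PointedCone.hull ℝ (toReal '' ((s.erase v : Finset _) : Set _)) := by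
    intro v hv hv'
    refine hmin (s.erase v) ?_ (Finset.card_erase_lt_of_mem hv)
    refine le_antisymm (hs'.le.trans (Submodule.span_le.2 ?_)) ?_
    · rintro _ ⟨w, hw, rfl⟩
      by_cases hwv : w = v
      · rw [hwv]; exact hv'
      · exact Submodule.subset_span ⟨w, by simp [hwv, Finset.mem_coe.1 hw], rfl⟩
    · rw [hs']
      exact Submodule.span_mono (Set.image_mono (by simp))
  have hne : ∀ v ∈ s, v ≠ 0 := by
    rintro v hv rfl
    exact hirr 0 hv (by rw [toReal_zero]; exact zero_mem _)
  nth_rewrite 1 [hs']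
  refine Submodule.span_le.2 ?_
  rintro _ ⟨v, hv, rfl⟩
  rw [Finset.mem_coe] at hv
  have hgordan : ∃ u : Fin n → ℤ, u ⬝ᵥ v = 0 ∧ ∀ w ∈ s.erase v, 0 < u ⬝ᵥ w := by
    refine exists_int_dotProduct_pos _ v fun t ht ht1 c hc => ?_
    rcases lt_or_ge 0 c with hc0 | hc0
    · refine hirr v hv ?_
      have : toReal v = c⁻¹ • ∑ w ∈ s.erase v, t w • toReal w := by
        rw [hc, smul_smul, inv_mul_cancel₀ hc0.ne', one_smul]
      rw [this]
      exact smul_mem_cone ((mem_hull_image_finset _ _ _).2 ⟨t, ht, rfl⟩) (inv_nonneg.2 hc0.le)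
    · obtain ⟨w₀, hw₀, htw₀⟩ : ∃ w ∈ s.erase v, 0 < t w := by
        by_contra! hcon
        have : ∑ w ∈ s.erase v, t w ≤ 0 := Finset.sum_nonpos hcon
        linarith
      have h1 : -toReal w₀ ∈ σ := by
        have h2 : -toReal w₀ = (t w₀)⁻¹ •
            (∑ w ∈ (s.erase v).erase w₀, t w • toReal w + (-c) • toReal v) := by
          rw [neg_smul, ← hc, ← Finset.add_sum_erase _ _ hw₀]
          rw [show ∀ A B : Fin n → ℝ, A + -(B + A) = -B from fun A B => by abel, smul_neg, smul_smul,
            inv_mul_cancel₀ htw₀.ne', one_smul]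
        rw [h2]
        refine smul_mem_cone (add_mem (sum_mem fun w hw => smul_mem_cone (hmem w ?_) (ht w))
          (smul_mem_cone (hmem v hv) (neg_nonneg.2 hc0))) (inv_nonneg.2 htw₀.le)
        exact Finset.mem_of_mem_erase (Finset.mem_of_mem_erase hw)
      have h3 := Δ.stronglyConvex σ hσ _ (hmem w₀ (Finset.mem_of_mem_erase hw₀)) h1
      exact hne w₀ (Finset.mem_of_mem_erase hw₀) (toReal_injective (h3.trans toReal_zero.symm))
  obtain ⟨u, huv, hu⟩ := hgordan
  have hface : IsFace (PointedCone.hull ℝ {toReal v}) σ := by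
    have := mem_hull_singleton_iff (hs' ▸ hmem v hv) huv
      fun w hw hwv => hu w (Finset.mem_erase.2 ⟨hwv, hw⟩)
    rw [← hs'] at this
    exact ⟨u, this⟩
  have hcone := Δ.face_mem σ hσ _ hface
  obtain ⟨g, w, hg, rfl, hw⟩ := exists_primitive (hne v hv)
  have hvσ := hmem _ hv
  rw [hull_toReal_zsmul hg] at hcone
  have hgR : (0 : ℝ) < g := by exact_mod_cast hg
  rw [toReal_zsmul] at hvσ ⊢
  have hwσ : toReal w ∈ σ := by
    have := smul_mem_cone hvσ (inv_nonneg.2 hgR.le)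
    rwa [smul_smul, inv_mul_cancel₀ hgR.ne', one_smul] at this
  have hmem' : toReal w ∈ toReal '' {v | v ∈ Δ.rays ∧ toReal v ∈ σ} := ⟨w, ⟨⟨hw, hcone⟩, hwσ⟩, rfl⟩
  exact smul_mem_cone (Submodule.subset_span hmem') hgR.le

/-- Characters which are regular on an affine chart generate the whole lattice. -/
theorem Fan.exists_sub_mem_dualMonoid {n : ℕ} (Δ : Fan n) {σ : PointedCone ℝ (Fin n → ℝ)}
    (hσ : σ ∈ Δ.cones) (w : Fin n → ℤ) : ∃ u ∈ dualMonoid σ, w + u ∈ dualMonoid σ := by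
  classical
  obtain ⟨s, hs⟩ := Δ.rational σ hσ
  have hmem : ∀ w ∈ s, toReal w ∈ σ := fun w hw => by
    rw [hs]; exact Submodule.subset_span ⟨w, hw, rfl⟩
  have hgordan : ∃ u : Fin n → ℤ, u ⬝ᵥ (0 : Fin n → ℤ) = 0 ∧ ∀ w ∈ s.erase 0, 0 < u ⬝ᵥ w := by
    refine exists_int_dotProduct_pos _ 0 fun t ht ht1 c hc => ?_
    obtain ⟨w₀, hw₀, htw₀⟩ : ∃ w ∈ s.erase 0, 0 < t w := by
      by_contra! hcon
      have : ∑ w ∈ s.erase 0, t w ≤ 0 := Finset.sum_nonpos hcon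
      linarith
    rw [toReal_zero, smul_zero, ← Finset.add_sum_erase _ _ hw₀] at hc
    have h1 : -toReal w₀ ∈ σ := by
      have h2 : -toReal w₀ = (t w₀)⁻¹ • ∑ w ∈ (s.erase 0).erase w₀, t w • toReal w := by
        rw [eq_neg_of_add_eq_zero_right hc, smul_neg, smul_smul, inv_mul_cancel₀ htw₀.ne', one_smul]
      rw [h2]
      refine smul_mem_cone (sum_mem fun w hw => smul_mem_cone (hmem w ?_) (ht w))
        (inv_nonneg.2 htw₀.le)
      exact Finset.mem_of_mem_erase (Finset.mem_of_mem_erase hw)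
    have h3 := Δ.stronglyConvex σ hσ _ (hmem w₀ (Finset.mem_of_mem_erase hw₀)) h1
    exact Finset.ne_of_mem_erase hw₀ (toReal_injective (h3.trans toReal_zero.symm))
  obtain ⟨u, -, hu⟩ := hgordan
  have hface := mem_hull_singleton_iff (s := s) (v := 0) (by rw [toReal_zero]; exact zero_mem _)
    (dotProduct_zero u) fun w hw hw0 => hu w (Finset.mem_erase.2 ⟨hw0, hw⟩)
  rw [← hs] at hface
  obtain ⟨hpos, hzero⟩ := hface
  obtain ⟨k, hk⟩ := exists_add_nsmul_mem s hs u hpos hzero w (by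
    intro x hx
    obtain ⟨c, rfl⟩ := Submodule.mem_span_singleton.1 hx
    simp [toReal_zero])
  exact ⟨k • u, nsmul_mem (show u ∈ dualMonoid σ from hpos) k, hk⟩

/-! ### The polytope of a very ample divisor -/

/-- On each cone of the fan, the support function of `P_D` is given by a lattice point of `P_D`,
namely by a section `χ^u` which generates `𝒪(D)` on the chart. -/
theorem Fan.IsVeryAmple.exists_latticePoint_le {K : Type u} [Field K] {n : ℕ} {Δ : Fan n}
    {a : Δ.rays → ℤ} (hD : Δ.IsVeryAmple K a) {σ : PointedCone ℝ (Fin n → ℝ)} (hσ : σ ∈ Δ.cones) :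
    ∃ u ∈ latticePoints (Δ.polytope a), ∀ y ∈ σ, ∀ x ∈ Δ.polytope a, toReal u ⬝ᵥ y ≤ x ⬝ᵥ y := by
  obtain ⟨f, -, h⟩ := hD
  obtain ⟨u₀, s, hs, hu₀, hsu, -⟩ := h ⟨σ, hσ⟩
  obtain ⟨i, d, hd⟩ := exists_add_eq_zero_of_span_eq_top K s hs
  refine ⟨i.1, i.2, fun y hy x hx => ?_⟩
  have h1 : toReal i.1 ⬝ᵥ y ≤ toReal u₀ ⬝ᵥ y := by
    have h2 := d.2 y hy
    have h3 : (d : Fin n → ℤ) = -(i.1 - u₀) := by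
      rw [← hsu, eq_neg_iff_add_eq_zero]
      exact congrArg Subtype.val hd
    rw [h3, toReal_neg, toReal_sub, neg_dotProduct, sub_dotProduct] at h2
    linarith
  refine h1.trans ?_
  have hy' := Δ.le_hull_rays hσ hy
  clear h1 hy
  induction hy' using Submodule.span_induction with
  | mem y hy' =>
    obtain ⟨v, ⟨hv, hvσ⟩, rfl⟩ := hy'
    rw [toReal_dotProduct, hu₀ ⟨v, hv⟩ hvσ]
    simpa using hx ⟨v, hv⟩
  | zero => simp
  | add y z _ _ hy hz =>
    rw [dotProduct_add, dotProduct_add]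
    exact add_le_add hy hz
  | smul c y _ hy =>
    change toReal u₀ ⬝ᵥ ((c : ℝ) • y) ≤ x ⬝ᵥ ((c : ℝ) • y)
    rw [dotProduct_smul, dotProduct_smul]
    exact mul_le_mul_of_nonneg_left hy c.2

/-- The properties of `P_D` and of its lattice points, for `D` very ample, on which the
asymptotics depend: `P` is the convex hull of a finite nonempty set of lattice points, and the
differences of its lattice points generate the lattice. -/
structure IsSpanningPolytope {n : ℕ} (P : Set (Fin n → ℝ)) : Prop where
  finite : (latticePoints P).Finite
  nonempty : (latticePoints P).Nonempty
  eq_convexHull : P = convexHull ℝ (toReal '' latticePoints P)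
  mem_of_sub_mem : ∀ L : AddSubgroup (Fin n → ℤ),
    (∀ u ∈ latticePoints P, ∀ w ∈ latticePoints P, u - w ∈ L) → ∀ m, m ∈ L

theorem Fan.convex_polytope {n : ℕ} (Δ : Fan n) (a : Δ.rays → ℤ) : Convex ℝ (Δ.polytope a) := by
  intro x hx y hy s t hs ht hst v
  rw [add_dotProduct, smul_dotProduct, smul_dotProduct, smul_eq_mul, smul_eq_mul]
  have h1 := mul_le_mul_of_nonneg_left (hx v) hs
  have h2 := mul_le_mul_of_nonneg_left (hy v) ht
  have h3 : -(a v : ℝ) = s * -(a v : ℝ) + t * -(a v : ℝ) := by rw [← add_mul, hst, one_mul]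
  rw [h3]
  exact add_le_add h1 h2

/-- The support function of `P_D` is attained at lattice points in all directions, since the fan is
complete. Hence `P_D` is bounded and, by separation, the convex hull of its lattice points. -/
theorem Fan.IsVeryAmple.isSpanningPolytope {K : Type u} [Field K] {n : ℕ} {Δ : Fan n}
    {a : Δ.rays → ℤ} (hΔ : Δ.IsComplete) (hD : Δ.IsVeryAmple K a) :
    IsSpanningPolytope (Δ.polytope a) := by
  have hsupp : ∀ y, ∃ u ∈ latticePoints (Δ.polytope a), ∀ x ∈ Δ.polytope a,
      toReal u ⬝ᵥ y ≤ x ⬝ᵥ y := by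
    intro y
    obtain ⟨σ, hσ, hy⟩ := hΔ y
    obtain ⟨u, hu, h⟩ := hD.exists_latticePoint_le hσ
    exact ⟨u, hu, h y hy⟩
  have hfin : (latticePoints (Δ.polytope a)).Finite := by
    choose! lo hlo hlo' using hsupp
    refine (Set.finite_Icc (fun i => (lo (Pi.single i 1)) i)
      (fun i => (lo (-Pi.single i 1)) i)).subset fun w hw => ⟨fun i => ?_, fun i => ?_⟩
    · have := hlo' (Pi.single i 1) _ hw
      rw [dotProduct_single_one, dotProduct_single_one] at this
      exact Int.cast_le.1 this
    · have := hlo' (-Pi.single i 1) _ hw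
      rw [dotProduct_neg, dotProduct_neg, dotProduct_single_one, dotProduct_single_one,
        neg_le_neg_iff] at this
      exact Int.cast_le.1 this
  refine ⟨hfin, ?_, ?_, fun L hL m => ?_⟩
  · obtain ⟨u, hu, -⟩ := hsupp 0
    exact ⟨u, hu⟩
  · refine Set.Subset.antisymm (fun x hx => ?_) (convexHull_min ?_ (Δ.convex_polytope a))
    · by_contra hx'
      obtain ⟨f, c, hfc, hfx⟩ := geometric_hahn_banach_closed_point (convex_convexHull ℝ _)
        (Set.Finite.isCompact_convexHull ℝ (hfin.image toReal)).isClosed hx'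
      have hfy : ∀ z, z ⬝ᵥ (fun i => -f (Pi.single i 1)) = -f z := by
        intro z
        conv_rhs => rw [← Finset.univ_sum_single z]
        rw [map_sum, dotProduct, ← Finset.sum_neg_distrib]
        refine Finset.sum_congr rfl fun i _ => ?_
        have : (Pi.single i (z i) : Fin n → ℝ) = z i • Pi.single i 1 := by
          rw [← Pi.single_smul]; simp
        rw [this, map_smul, smul_eq_mul]
        ring
      obtain ⟨u, hu, h⟩ := hsupp (fun i => -f (Pi.single i 1))
      have h1 := h x hx
      rw [hfy, hfy] at h1
      have h2 := hfc (toReal u) (subset_convexHull ℝ _ ⟨u, hu, rfl⟩)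
      linarith
    · rintro _ ⟨u, hu, rfl⟩
      exact hu
  · obtain ⟨σ, hσ, -⟩ := hΔ 0
    obtain ⟨u, hu, hmu⟩ := Δ.exists_sub_mem_dualMonoid hσ m
    have h1 := hD.dualMonoid_le K L hL ⟨σ, hσ⟩ hu
    have h2 := hD.dualMonoid_le K L hL ⟨σ, hσ⟩ hmu
    simpa using L.sub_mem h2 h1

end Toric

/-! ### The cone over the polytope and its lattice points -/

namespace Toric

/-- The inclusion of the lattice `M × ℤ` in `M_ℝ × ℝ`. -/
def latticeEmb {n : ℕ} (w : (Fin n → ℤ) × ℤ) : (Fin n → ℝ) × ℝ := (toReal w.1, (w.2 : ℝ))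

theorem latticeEmb_add {n : ℕ} (v w : (Fin n → ℤ) × ℤ) :
    latticeEmb (v + w) = latticeEmb v + latticeEmb w := by
  simp [latticeEmb, toReal_add]

theorem latticeEmb_sub {n : ℕ} (v w : (Fin n → ℤ) × ℤ) :
    latticeEmb (v - w) = latticeEmb v - latticeEmb w := by
  simp [latticeEmb, toReal_sub]

theorem latticeEmb_nsmul {n : ℕ} (k : ℕ) (w : (Fin n → ℤ) × ℤ) :
    latticeEmb (k • w) = (k : ℝ) • latticeEmb w := by
  rw [latticeEmb, Prod.smul_fst, Prod.smul_snd, toReal_nsmul]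
  simp [latticeEmb]

/-- Nonnegative reals can be bounded below by natural numbers with any prescribed sum which is
small enough to survive the rounding. -/
theorem exists_nat_le_sum_eq {ι : Type*} (s : Finset ι) (t : ι → ℝ) (ht : ∀ i, 0 ≤ t i) (k : ℕ)
    (h : (k : ℝ) + s.card ≤ ∑ i ∈ s, t i) :
    ∃ m : ι → ℕ, (∀ i, (m i : ℝ) ≤ t i) ∧ ∑ i ∈ s, m i = k := by
  classical
  have h1 : k ≤ ∑ i ∈ s, ⌊t i⌋₊ := by
    have h2 : ∑ i ∈ s, t i ≤ ∑ i ∈ s, ((⌊t i⌋₊ : ℝ) + 1) :=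
      Finset.sum_le_sum fun i _ => (Nat.lt_floor_add_one _).le
    rw [Finset.sum_add_distrib, Finset.sum_const, nsmul_eq_mul, mul_one] at h2
    have : (k : ℝ) ≤ ∑ i ∈ s, (⌊t i⌋₊ : ℝ) := by linarith
    exact_mod_cast this
  have key : ∀ (s : Finset ι) (f : ι → ℕ) (k : ℕ), k ≤ ∑ i ∈ s, f i →
      ∃ m : ι → ℕ, (∀ i, m i ≤ f i) ∧ ∑ i ∈ s, m i = k := by
    intro s f
    induction s using Finset.induction_on with
    | empty => exact fun k hk => ⟨f, fun _ => le_rfl, by simp at hk; simp [hk]⟩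
    | insert a s ha ih =>
      intro k hk
      rw [Finset.sum_insert ha] at hk
      obtain ⟨m, hm, hms⟩ := ih (k - min k (f a)) (by omega)
      refine ⟨Function.update m a (min k (f a)), fun i => ?_, ?_⟩
      · by_cases hi : i = a
        · subst hi; simp
        · simpa [hi] using hm i
      · rw [Finset.sum_insert ha, Function.update_self, Finset.sum_congr rfl fun i hi =>
          Function.update_of_ne (ne_of_mem_of_not_mem hi ha) _ _, hms]
        omega
  obtain ⟨m, hm, hms⟩ := key s _ k h1
  exact ⟨m, fun i => (Nat.cast_le.2 (hm i)).trans (Nat.floor_le (ht i)), hms⟩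

theorem single_mem_coneSemigroup {n : ℕ} {P : Set (Fin n → ℝ)} {u : Fin n → ℤ}
    (hu : u ∈ latticePoints P) : ((u, 1) : (Fin n → ℤ) × ℤ) ∈ coneSemigroup P :=
  AddSubmonoid.subset_closure ⟨u, hu, rfl⟩

theorem latticeEmb_mem_coneOver {n : ℕ} {P : Set (Fin n → ℝ)} {s : (Fin n → ℤ) × ℤ}
    (hs : s ∈ coneSemigroup P) : latticeEmb s ∈ coneOver P := by
  induction hs using AddSubmonoid.closure_induction with
  | mem s hs =>
    obtain ⟨u, hu, rfl⟩ := hs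
    exact Submodule.subset_span ⟨hu, by simp [latticeEmb]⟩
  | zero =>
    convert zero_mem (coneOver P)
    simp [latticeEmb, toReal_zero]
  | add s t _ _ hs ht => rw [latticeEmb_add]; exact add_mem hs ht

theorem convex_coneOver {n : ℕ} (P : Set (Fin n → ℝ)) :
    Convex ℝ (coneOver P : Set ((Fin n → ℝ) × ℝ)) := fun _ hx _ hy _ _ hs ht _ =>
  add_mem (smul_mem_cone hx hs) (smul_mem_cone hy ht)

namespace IsSpanningPolytope

variable {n : ℕ} {P : Set (Fin n → ℝ)} (hP : IsSpanningPolytope P)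
include hP

theorem isCompact : IsCompact P := by
  rw [hP.eq_convexHull]
  exact Set.Finite.isCompact_convexHull ℝ (hP.finite.image _)

theorem convex : Convex ℝ P := by
  rw [hP.eq_convexHull]
  exact convex_convexHull ℝ _

/-- The cone is generated by the finitely many points `(w, 1)`, `w ∈ P ∩ M`. -/
theorem mem_coneOver_iff_exists_sum (x : (Fin n → ℝ) × ℝ) : x ∈ coneOver P ↔
    ∃ t : (Fin n → ℤ) → ℝ, (∀ w, 0 ≤ t w) ∧
      x = ∑ w ∈ hP.finite.toFinset, t w • ((toReal w, 1) : (Fin n → ℝ) × ℝ) := by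
  have h : coneOver P = PointedCone.hull ℝ
      ((fun w => ((toReal w, 1) : (Fin n → ℝ) × ℝ)) '' (hP.finite.toFinset : Set (Fin n → ℤ))) := by
    rw [Set.Finite.coe_toFinset]
    refine le_antisymm (Submodule.span_le.2 ?_) (Submodule.span_le.2 ?_)
    · rintro ⟨x, z⟩ ⟨hx, hz⟩
      obtain rfl : z = 1 := hz
      simp only at hx
      rw [hP.eq_convexHull] at hx
      refine convexHull_min (s := toReal '' latticePoints P)
        (t := {x | (x, (1 : ℝ)) ∈ PointedCone.hull ℝ ((fun w => ((toReal w, 1) :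
          (Fin n → ℝ) × ℝ)) '' latticePoints P)}) ?_ ?_ hx
      · rintro _ ⟨u, hu, rfl⟩
        exact Submodule.subset_span ⟨u, hu, rfl⟩
      · intro x hx y hy s t hs ht hst
        rw [Set.mem_ofPred_eq] at hx hy
        have := add_mem (smul_mem_cone hx hs) (smul_mem_cone hy ht)
        simpa [hst] using this
    · rintro _ ⟨u, hu, rfl⟩
      exact Submodule.subset_span ⟨hu, rfl⟩
  rw [h, mem_hull_image_finset]

theorem mem_coneOver_iff (x : Fin n → ℝ) (z : ℝ) :
    (x, z) ∈ coneOver P ↔ 0 ≤ z ∧ x ∈ z • P := by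
  constructor
  · intro h
    obtain ⟨t, ht, h⟩ := (hP.mem_coneOver_iff_exists_sum _).1 h
    have hx : x = ∑ w ∈ hP.finite.toFinset, t w • toReal w := by
      simpa [Prod.fst_sum] using congrArg Prod.fst h
    have hz : z = ∑ w ∈ hP.finite.toFinset, t w := by
      simpa [Prod.snd_sum] using congrArg Prod.snd h
    have hz0 : 0 ≤ z := hz ▸ Finset.sum_nonneg fun w _ => ht w
    refine ⟨hz0, ?_⟩
    rcases hz0.eq_or_lt with h0 | h0
    · obtain ⟨u, hu⟩ := hP.nonempty
      refine ⟨toReal u, hu, ?_⟩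
      rw [← h0] at hz ⊢
      have := (Finset.sum_eq_zero_iff_of_nonneg fun w _ => ht w).1 hz.symm
      simp only [zero_smul]
      rw [hx, Finset.sum_eq_zero fun w hw => by rw [this w hw, zero_smul]]
    · refine ⟨z⁻¹ • x, ?_, by simp [smul_smul, h0.ne']⟩
      rw [hx, Finset.smul_sum]
      have : ∑ w ∈ hP.finite.toFinset, z⁻¹ • t w • toReal w =
          ∑ w ∈ hP.finite.toFinset, (z⁻¹ * t w) • toReal w := by simp only [smul_smul]
      rw [this]
      refine hP.convex.sum_mem (fun w _ => mul_nonneg (inv_nonneg.2 hz0) (ht w)) ?_ ?_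
      · rw [← Finset.mul_sum, ← hz, inv_mul_cancel₀ h0.ne']
      · intro w hw
        exact hP.finite.mem_toFinset.1 hw
  · rintro ⟨hz, p, hp, rfl⟩
    have := smul_mem_cone (C := coneOver P) (x := (p, 1)) (Submodule.subset_span ⟨hp, rfl⟩) hz
    simpa using this

theorem isClosed_coneOver : IsClosed (coneOver P : Set ((Fin n → ℝ) × ℝ)) := by
  refine IsSeqClosed.isClosed fun x y hx hxy => ?_
  have h1 : ∀ i, 0 ≤ (x i).2 ∧ (x i).1 ∈ (x i).2 • P := fun i => (hP.mem_coneOver_iff _ _).1 (hx i)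
  choose h0 p hp hpx using h1
  obtain ⟨q, hq, φ, hφ, hlim⟩ := hP.isCompact.tendsto_subseq hp
  have h2 : Tendsto (fun i => (x i).2) atTop (𝓝 y.2) := (continuous_snd.tendsto y).comp hxy
  have h3 : Tendsto (fun i => (x i).1) atTop (𝓝 y.1) := (continuous_fst.tendsto y).comp hxy
  refine (hP.mem_coneOver_iff y.1 y.2).2 ⟨ge_of_tendsto' h2 h0, q, hq, ?_⟩
  refine tendsto_nhds_unique ?_ (h3.comp hφ.tendsto_atTop)
  have := (h2.comp hφ.tendsto_atTop).smul hlim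
  refine this.congr fun i => ?_
  exact hpx (φ i)

/-- A point of large height can be moved down by an element of degree `k` of the semigroup without
leaving the cone: round down the coefficients of the point with respect to the generators. -/
theorem exists_sub_mem_coneOver (k : ℕ) {x : Fin n → ℝ} {z : ℝ} (hx : (x, z) ∈ coneOver P)
    (hz : (k : ℝ) + hP.finite.toFinset.card ≤ z) :
    ∃ g : Fin n → ℤ, (g, (k : ℤ)) ∈ coneSemigroup P ∧ (x - toReal g, z - k) ∈ coneOver P := by
  obtain ⟨t, ht, h⟩ := (hP.mem_coneOver_iff_exists_sum _).1 hx
  have hzt : z = ∑ w ∈ hP.finite.toFinset, t w := by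
    simpa [Prod.snd_sum] using congrArg Prod.snd h
  obtain ⟨m, hm, hmk⟩ := exists_nat_le_sum_eq hP.finite.toFinset t ht k (hzt ▸ hz)
  have hg : (∑ w ∈ hP.finite.toFinset, m w • w, (k : ℤ)) =
      ∑ w ∈ hP.finite.toFinset, m w • ((w, 1) : (Fin n → ℤ) × ℤ) := by
    ext1
    · simp [Prod.fst_sum]
    · simp [Prod.snd_sum, ← hmk]
  refine ⟨∑ w ∈ hP.finite.toFinset, m w • w, ?_, ?_⟩
  · rw [hg]
    exact sum_mem fun w hw =>
      nsmul_mem (single_mem_coneSemigroup (hP.finite.mem_toFinset.1 hw)) _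
  · rw [hP.mem_coneOver_iff_exists_sum]
    refine ⟨fun w => t w - m w, fun w => sub_nonneg.2 (hm w), ?_⟩
    simp only [sub_smul, Finset.sum_sub_distrib]
    rw [← h]
    have : ∑ w ∈ hP.finite.toFinset, (m w : ℝ) • ((toReal w, 1) : (Fin n → ℝ) × ℝ) =
        latticeEmb (∑ w ∈ hP.finite.toFinset, m w • w, (k : ℤ)) := by
      rw [hg, show ∀ x, latticeEmb x = AddMonoidHom.mk' latticeEmb latticeEmb_add x from
        fun _ => rfl, map_sum]
      refine Finset.sum_congr rfl fun w _ => ?_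
      rw [AddMonoidHom.mk'_apply, latticeEmb_nsmul]
      simp [latticeEmb]
    rw [this]
    simp [latticeEmb]

theorem exists_sum_of_mem_coneSemigroup {s : (Fin n → ℤ) × ℤ} (hs : s ∈ coneSemigroup P) :
    ∃ m : (Fin n → ℤ) → ℕ, s = ∑ w ∈ hP.finite.toFinset, m w • ((w, 1) : (Fin n → ℤ) × ℤ) := by
  classical
  induction hs using AddSubmonoid.closure_induction with
  | mem s hs =>
    obtain ⟨u, hu, rfl⟩ := hs
    refine ⟨fun w => if w = u then 1 else 0, ?_⟩
    simp only [ite_smul, one_smul, zero_smul]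
    rw [Finset.sum_ite_eq', if_pos (hP.finite.mem_toFinset.2 hu)]
  | zero => exact ⟨0, by simp⟩
  | add s t _ _ hs ht =>
    obtain ⟨m, rfl⟩ := hs
    obtain ⟨l, rfl⟩ := ht
    refine ⟨m + l, ?_⟩
    rw [← Finset.sum_add_distrib]
    exact Finset.sum_congr rfl fun w _ => by rw [Pi.add_apply, add_smul]

/-- The analogue of `exists_sub_mem_coneOver` inside the semigroup, with room for subtracting
`q` copies of the element of degree `k`. -/
theorem exists_sub_mem_coneSemigroup (q k : ℕ) (hq : 0 < q) {s : (Fin n → ℤ) × ℤ}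
    (hs : s ∈ coneSemigroup P) (hsq : (q : ℤ) * (k + hP.finite.toFinset.card) ≤ s.2) :
    ∃ g : Fin n → ℤ, (g, (k : ℤ)) ∈ coneSemigroup P ∧
      s - q • ((g, k) : (Fin n → ℤ) × ℤ) ∈ coneSemigroup P := by
  obtain ⟨l, hl⟩ := hP.exists_sum_of_mem_coneSemigroup hs
  have hs2 : s.2 = ∑ w ∈ hP.finite.toFinset, (l w : ℤ) := by
    rw [hl]; simp [Prod.snd_sum]
  have hqR : (0 : ℝ) < q := by exact_mod_cast hq
  obtain ⟨m, hm, hmk⟩ := exists_nat_le_sum_eq hP.finite.toFinset (fun w => (l w : ℝ) / q)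
    (fun w => by positivity) k (by
      rw [← Finset.sum_div, le_div_iff₀ hqR, mul_comm]
      rw [hs2] at hsq
      exact_mod_cast hsq)
  have hm' : ∀ w, q * m w ≤ l w := fun w => by
    have := hm w
    rw [le_div_iff₀ hqR, mul_comm] at this
    exact_mod_cast this
  have hg : (∑ w ∈ hP.finite.toFinset, m w • w, (k : ℤ)) =
      ∑ w ∈ hP.finite.toFinset, m w • ((w, 1) : (Fin n → ℤ) × ℤ) := by
    ext1
    · simp [Prod.fst_sum]
    · simp [Prod.snd_sum, ← hmk]
  refine ⟨∑ w ∈ hP.finite.toFinset, m w • w, ?_, ?_⟩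
  · rw [hg]
    exact sum_mem fun w hw =>
      nsmul_mem (single_mem_coneSemigroup (hP.finite.mem_toFinset.1 hw)) _
  · have : s - q • ((∑ w ∈ hP.finite.toFinset, m w • w, (k : ℤ)) : (Fin n → ℤ) × ℤ) =
        ∑ w ∈ hP.finite.toFinset, (l w - q * m w) • ((w, 1) : (Fin n → ℤ) × ℤ) := by
      rw [hg, hl, Finset.smul_sum, ← Finset.sum_sub_distrib]
      refine Finset.sum_congr rfl fun w _ => ?_
      rw [sub_eq_iff_eq_add, smul_smul, ← add_smul, Nat.sub_add_cancel (hm' w)]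
    rw [this]
    exact sum_mem fun w hw =>
      nsmul_mem (single_mem_coneSemigroup (hP.finite.mem_toFinset.1 hw)) _

/-- The semigroup generates the lattice as a group. -/
theorem exists_add_mem_coneSemigroup (r : (Fin n → ℤ) × ℤ) :
    ∃ s ∈ coneSemigroup P, s + r ∈ coneSemigroup P := by
  let L : AddSubgroup ((Fin n → ℤ) × ℤ) :=
    { carrier := {r | ∃ s ∈ coneSemigroup P, s + r ∈ coneSemigroup P}
      zero_mem' := ⟨0, zero_mem _, by simp⟩
      add_mem' := by
        rintro r r' ⟨s, hs, h⟩ ⟨s', hs', h'⟩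
        refine ⟨s + s', add_mem hs hs', ?_⟩
        rw [add_add_add_comm]
        exact add_mem h h'
      neg_mem' := by
        rintro r ⟨s, hs, h⟩
        exact ⟨s + r, h, by simpa using hs⟩ }
  have h0 : ∀ m : Fin n → ℤ, ((m, 0) : (Fin n → ℤ) × ℤ) ∈ L := by
    refine hP.mem_of_sub_mem (L.comap (AddMonoidHom.inl _ _)) fun u hu w hw => ?_
    exact ⟨(w, 1), single_mem_coneSemigroup hw, by simpa using single_mem_coneSemigroup hu⟩
  obtain ⟨u, hu⟩ := hP.nonempty
  have h1 : ((u, 1) : (Fin n → ℤ) × ℤ) ∈ L :=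
    ⟨0, zero_mem _, by simpa using single_mem_coneSemigroup hu⟩
  have : r = (r.1 - r.2 • u, 0) + r.2 • (u, 1) := by ext1 <;> simp
  rw [this]
  exact L.add_mem (h0 _) (L.zsmul_mem h1 _)

/-- The semigroup contains a translate, by one of its elements, of all lattice points of the
cone: the fractional part of a lattice point lies in a finite box, and each `r` in this box is
carried into the semigroup by some `s r` in the semigroup. -/
theorem exists_conductor : ∃ c ∈ coneSemigroup P, ∀ w : (Fin n → ℤ) × ℤ,
    latticeEmb w ∈ coneOver P → c + w ∈ coneSemigroup P := by
  classical
  choose s hs hsr using hP.exists_add_mem_coneSemigroup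
  let b : (Fin n → ℤ) × ℤ := ∑ w ∈ hP.finite.toFinset, (fun i => |w i|, 1)
  let B : Finset ((Fin n → ℤ) × ℤ) := Finset.Icc (-b) b
  refine ⟨∑ r ∈ B, s r, sum_mem fun r _ => hs r, fun w hw => ?_⟩
  obtain ⟨t, ht, h⟩ := (hP.mem_coneOver_iff_exists_sum _).1 hw
  set e : (Fin n → ℤ) × ℤ :=
    ∑ v ∈ hP.finite.toFinset, ⌊t v⌋₊ • ((v, 1) : (Fin n → ℤ) × ℤ) with he
  have heS : e ∈ coneSemigroup P := sum_mem fun v hv =>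
      nsmul_mem (single_mem_coneSemigroup (hP.finite.mem_toFinset.1 hv)) _
  have hfract : ∀ v, |t v - ⌊t v⌋₊| ≤ 1 := fun v => by
    rw [abs_le]
    constructor <;> linarith [Nat.floor_le (ht v), Nat.lt_floor_add_one (t v)]
  have hr : w - e ∈ B := by
    have h1 : ∀ i, |(w - e).1 i| ≤ b.1 i := by
      intro i
      have h2 : (((w - e).1 i : ℤ) : ℝ) = ∑ v ∈ hP.finite.toFinset, (t v - ⌊t v⌋₊) * v i := by
        have h3 := congrFun (congrArg Prod.fst h) i
        have h4 : (w.1 i : ℝ) = ∑ v ∈ hP.finite.toFinset, t v * v i := by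
          simpa [latticeEmb, toReal, Prod.fst_sum, Finset.sum_apply] using h3
        simp only [sub_mul, Finset.sum_sub_distrib]
        rw [← h4]
        simp [he, Prod.fst_sum, Finset.sum_apply]
      have h5 : |(((w - e).1 i : ℤ) : ℝ)| ≤ ((b.1 i : ℤ) : ℝ) := by
        rw [h2]
        refine (Finset.abs_sum_le_sum_abs _ _).trans ?_
        have : ((b.1 i : ℤ) : ℝ) = ∑ v ∈ hP.finite.toFinset, |(v i : ℝ)| := by
          simp [b, Prod.fst_sum, Finset.sum_apply]
        rw [this]
        refine Finset.sum_le_sum fun v _ => ?_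
        rw [abs_mul]
        exact mul_le_of_le_one_left (abs_nonneg _) (hfract v)
      exact_mod_cast h5
    have h2 : |(w - e).2| ≤ b.2 := by
      have h2 : (((w - e).2 : ℤ) : ℝ) = ∑ v ∈ hP.finite.toFinset, (t v - ⌊t v⌋₊) := by
        have h3 : (w.2 : ℝ) = _ := congrArg Prod.snd h
        have h4 : (w.2 : ℝ) = ∑ v ∈ hP.finite.toFinset, t v := by
          simpa [latticeEmb, Prod.snd_sum] using h3
        simp only [Finset.sum_sub_distrib]
        rw [← h4]
        simp [he, Prod.snd_sum]
      have h5 : |(((w - e).2 : ℤ) : ℝ)| ≤ ((b.2 : ℤ) : ℝ) := by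
        rw [h2]
        refine (Finset.abs_sum_le_sum_abs _ _).trans ?_
        have : ((b.2 : ℤ) : ℝ) = ∑ v ∈ hP.finite.toFinset, (1 : ℝ) := by
          simp [b, Prod.snd_sum]
        rw [this]
        exact Finset.sum_le_sum fun v _ => hfract v
      exact_mod_cast h5
    exact Finset.mem_Icc.2 ⟨⟨fun i => (abs_le.1 (h1 i)).1, (abs_le.1 h2).1⟩,
      ⟨fun i => (abs_le.1 (h1 i)).2, (abs_le.1 h2).2⟩⟩
  rw [← Finset.add_sum_erase _ _ hr]
  have : s (w - e) + ∑ r ∈ B.erase (w - e), s r + w =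
      ∑ r ∈ B.erase (w - e), s r + (s (w - e) + (w - e)) + e := by abel
  rw [this]
  exact add_mem (add_mem (sum_mem fun r _ => hs r) (hsr _)) heS

end IsSpanningPolytope

end Toric

/-! ### Counting lattice points -/

open MeasureTheory

/-- Asymptotics of polynomial order do not change under a shift of the argument. The subtraction
`q - m` is truncated, but only for the finitely many `q < m`. -/
theorem tendsto_shift_div_pow {a : ℕ → ℝ} {d : ℕ} {v : ℝ} (m : ℕ)
    (h : Tendsto (fun q => a q / (q : ℝ) ^ d) atTop (𝓝 v)) :
    Tendsto (fun q => a (q + m) / (q : ℝ) ^ d) atTop (𝓝 v) ∧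
    Tendsto (fun q => a (q - m) / (q : ℝ) ^ d) atTop (𝓝 v) := by
  have h1 : Tendsto (fun q : ℕ => ((q + m : ℕ) : ℝ) / q) atTop (𝓝 1) := by
    have h2 : Tendsto (fun q : ℕ => 1 + (m : ℝ) / q) atTop (𝓝 (1 + 0)) :=
      tendsto_const_nhds.add (tendsto_const_div_atTop_nhds_zero_nat _)
    rw [add_zero] at h2
    refine h2.congr' ?_
    filter_upwards [eventually_gt_atTop 0] with q hq
    have : (q : ℝ) ≠ 0 := by positivity
    push_cast
    field_simp
  have h3 : Tendsto (fun q : ℕ => ((q - m : ℕ) : ℝ) / q) atTop (𝓝 1) := by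
    have h2 : Tendsto (fun q : ℕ => 1 - (m : ℝ) / q) atTop (𝓝 (1 - 0)) :=
      tendsto_const_nhds.sub (tendsto_const_div_atTop_nhds_zero_nat _)
    rw [sub_zero] at h2
    refine h2.congr' ?_
    filter_upwards [eventually_gt_atTop m] with q hq
    have : (q : ℝ) ≠ 0 := by
      have : 0 < q := by omega
      positivity
    rw [Nat.cast_sub hq.le]
    field_simp
  constructor
  · have h4 := (h.comp (tendsto_add_atTop_nat m)).mul (h1.pow d)
    rw [one_pow, mul_one] at h4
    refine h4.congr' ?_
    filter_upwards [eventually_gt_atTop 0] with q hq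
    have : (q : ℝ) ≠ 0 := by positivity
    have : ((q + m : ℕ) : ℝ) ≠ 0 := by positivity
    simp only [Function.comp, div_pow]
    field_simp
  · have h4 := (h.comp (tendsto_sub_atTop_nat m)).mul (h3.pow d)
    rw [one_pow, mul_one] at h4
    refine h4.congr' ?_
    filter_upwards [eventually_gt_atTop m] with q hq
    have : (q : ℝ) ≠ 0 := by
      have : 0 < q := by omega
      positivity
    have : ((q - m : ℕ) : ℝ) ≠ 0 := by
      have : 0 < q - m := by omega
      positivity
    simp only [Function.comp, div_pow]
    field_simp

/-- The number of lattice points in the dilates `q • s` is asymptotic to `vol(s) qᵈ`. -/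
theorem tendsto_ncard_int_div_pow {ι : Type*} [Fintype ι] {s : Set (ι → ℝ)}
    (hs₁ : Bornology.IsBounded s) (hs₂ : MeasurableSet s) (hs₃ : volume (frontier s) = 0) :
    Tendsto (fun q : ℕ => ({u : ι → ℤ | (fun i => (u i : ℝ)) ∈ (q : ℝ) • s}.ncard : ℝ) /
      (q : ℝ) ^ Fintype.card ι) atTop (𝓝 (volume.real s)) := by
  refine (tendsto_card_div_pow_atTop_volume s hs₁ hs₂ hs₃).congr' ?_
  filter_upwards [eventually_gt_atTop 0] with q hq
  have hq0 : (q : ℝ) ≠ 0 := by positivity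
  congr 2
  rw [Nat.card_coe_set_eq]
  have hinj : Function.Injective fun u : ι → ℤ => (q : ℝ)⁻¹ • (fun i => (u i : ℝ)) := by
    intro u v huv
    have := smul_right_injective _ (inv_ne_zero hq0) huv
    ext i
    exact Int.cast_injective (congrFun this i)
  rw [← Set.ncard_image_of_injective _ hinj]
  congr 1
  ext x
  constructor
  · rintro ⟨hx, y, hy, rfl⟩
    have h1 := (Module.Basis.mem_span_iff_repr_mem ℤ (Pi.basisFun ℝ ι) y).1 hy
    choose u hu using h1
    have hyu : y = fun i => (u i : ℝ) := by
      ext i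
      simpa using (hu i).symm
    refine ⟨u, ?_, ?_⟩
    · refine ⟨_, hx, ?_⟩
      simp [hyu, smul_smul, hq0]
    · simp [hyu]
  · rintro ⟨u, ⟨y, hy, hyu⟩, rfl⟩
    refine ⟨?_, ?_⟩
    · change (q : ℝ)⁻¹ • (fun i => (u i : ℝ)) ∈ s
      rw [← hyu]
      simpa [smul_smul, hq0] using hy
    · refine Set.smul_mem_smul_set ?_
      refine (Module.Basis.mem_span_iff_repr_mem ℤ (Pi.basisFun ℝ ι) _).2 fun i => ⟨u i, ?_⟩
      simp

namespace Toric

/-- `tendsto_ncard_int_div_pow` for the lattice `M × ℤ` in `M_ℝ × ℝ`. -/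
theorem tendsto_ncard_latticeEmb_div_pow {n : ℕ} {B : Set ((Fin n → ℝ) × ℝ)}
    (hB₁ : Bornology.IsBounded B) (hB₂ : MeasurableSet B) (hB₃ : volume (frontier B) = 0) :
    Tendsto (fun q : ℕ => ({w : (Fin n → ℤ) × ℤ | latticeEmb w ∈ (q : ℝ) • B}.ncard : ℝ) /
      (q : ℝ) ^ (n + 1)) atTop (𝓝 (volume.real B)) := by
  let Φ : ((Fin n → ℝ) × ℝ) ≃L[ℝ] (Fin (n + 1) → ℝ) :=
    (ContinuousLinearEquiv.prodComm ℝ (Fin n → ℝ) ℝ).trans (Fin.consEquivL ℝ fun _ => ℝ)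
  have hΦ : ∀ x z, Φ (x, z) = Fin.cons z x := fun x z => rfl
  have hmp : MeasurePreserving (Φ.symm : (Fin (n + 1) → ℝ) → (Fin n → ℝ) × ℝ) volume volume := by
    have h1 := (volume_preserving_piFinSuccAbove (fun _ : Fin (n + 1) => ℝ) 0)
    have h2 := (Measure.measurePreserving_swap (μ := (volume : Measure ℝ))
      (ν := (volume : Measure (Fin n → ℝ)))).comp h1
    have hfun : (Φ.symm : (Fin (n + 1) → ℝ) → (Fin n → ℝ) × ℝ) =
        Prod.swap ∘ MeasurableEquiv.piFinSuccAbove (fun _ : Fin (n + 1) => ℝ) 0 := by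
      funext f
      rw [ContinuousLinearEquiv.symm_apply_eq]
      exact (Fin.cons_self_tail f).symm
    rw [hfun]
    exact h2
  have himg : Φ '' B = Φ.symm ⁻¹' B := Φ.toEquiv.image_eq_preimage_symm B
  have hfr : frontier (Φ '' B) = Φ.symm ⁻¹' frontier B :=
    (Φ.toHomeomorph.image_frontier B).symm.trans (Φ.toEquiv.image_eq_preimage_symm _)
  have h := tendsto_ncard_int_div_pow (s := Φ '' B) (Φ.lipschitz.isBounded_image hB₁)
    (himg ▸ hmp.measurable hB₂) (by
      rw [hfr, hmp.measure_preimage isClosed_frontier.measurableSet.nullMeasurableSet, hB₃])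
  rw [himg, Measure.real, hmp.measure_preimage hB₂.nullMeasurableSet, ← himg, Fintype.card_fin] at h
  refine h.congr fun q => ?_
  congr 2
  have hinj : Function.Injective fun w : (Fin n → ℤ) × ℤ => (Fin.cons w.2 w.1 : Fin (n + 1) → ℤ) := by
    intro v w hvw
    simp only [Fin.cons_inj] at hvw
    exact Prod.ext hvw.2 hvw.1
  rw [← Set.ncard_image_of_injective _ hinj]
  congr 1
  have hcast : ∀ w : (Fin n → ℤ) × ℤ,
      (fun i => (((Fin.cons w.2 w.1 : Fin (n + 1) → ℤ) i : ℤ) : ℝ)) = Φ (latticeEmb w) := by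
    intro w
    rw [latticeEmb, hΦ]
    ext i
    refine Fin.cases ?_ (fun i => ?_) i <;> simp [toReal]
  have hmem : ∀ y, Φ y ∈ (q : ℝ) • Φ '' B ↔ y ∈ (q : ℝ) • B := by
    intro y
    rw [← Set.image_smul_comm]
    · exact Φ.injective.mem_set_image
    · intro b; exact map_smul Φ _ _
  ext u
  constructor
  · intro hu
    refine ⟨(Fin.tail u, u 0), ?_, Fin.cons_self_tail u⟩
    have := hcast (Fin.tail u, u 0)
    simp only [Fin.cons_self_tail] at this
    rw [Set.mem_ofPred_eq, this] at hu
    exact (hmem _).1 hu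
  · rintro ⟨w, hw, rfl⟩
    rw [Set.mem_ofPred_eq, hcast]
    exact (hmem _).2 hw

instance {n : ℕ} : (volume : Measure ((Fin n → ℝ) × ℝ)).IsAddHaarMeasure :=
  Measure.prod.instIsAddHaarMeasure volume volume

namespace IsSpanningPolytope

variable {n : ℕ} {P : Set (Fin n → ℝ)} (hP : IsSpanningPolytope P)
include hP

theorem nonneg_of_mem_coneSemigroup {s : (Fin n → ℤ) × ℤ} (hs : s ∈ coneSemigroup P) :
    0 ≤ s.2 := by
  have := ((hP.mem_coneOver_iff _ _).1 (latticeEmb_mem_coneOver hs)).1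
  exact Int.cast_nonneg_iff.1 this

/-- The part of the cone up to a given height is bounded. -/
theorem isBounded_coneOver (N : ℝ) :
    Bornology.IsBounded {x : (Fin n → ℝ) × ℝ | x ∈ coneOver P ∧ x.2 ≤ N} := by
  have h := (isCompact_Icc (a := (0 : ℝ)) (b := N)).prod hP.isCompact
  have hc : Continuous fun y : ℝ × (Fin n → ℝ) => ((y.1 • y.2, y.1) : (Fin n → ℝ) × ℝ) := by
    fun_prop
  refine (h.image hc).isBounded.subset ?_
  rintro ⟨x, z⟩ ⟨hx, hz⟩
  obtain ⟨h0, p, hp, rfl⟩ := (hP.mem_coneOver_iff x z).1 hx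
  exact ⟨(z, p), ⟨⟨h0, hz⟩, hp⟩, rfl⟩

theorem finite_of_le_cone (N : ℝ) :
    {w : (Fin n → ℤ) × ℤ | latticeEmb w ∈ coneOver P ∧ (w.2 : ℝ) ≤ N}.Finite := by
  classical
  obtain ⟨R, hR⟩ := (hP.isBounded_coneOver N).subset_closedBall 0
  let r : (Fin n → ℤ) × ℤ := (fun _ => ⌈R⌉, ⌈R⌉)
  refine (Set.finite_Icc (-r) r).subset fun w hw => ?_
  have h1 := hR hw
  rw [mem_closedBall_zero_iff, Prod.norm_def, max_le_iff] at h1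
  have h2 : ∀ i, |w.1 i| ≤ ⌈R⌉ := fun i => by
    have : |(w.1 i : ℝ)| ≤ R := (norm_le_pi_norm (latticeEmb w).1 i).trans h1.1
    have : |(w.1 i : ℝ)| ≤ ⌈R⌉ := this.trans (Int.le_ceil R)
    exact_mod_cast this
  have h3 : |w.2| ≤ ⌈R⌉ := by
    have : |(w.2 : ℝ)| ≤ R := h1.2
    have : |(w.2 : ℝ)| ≤ ⌈R⌉ := this.trans (Int.le_ceil R)
    exact_mod_cast this
  exact ⟨⟨fun i => (abs_le.1 (h2 i)).1, (abs_le.1 h3).1⟩,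
    ⟨fun i => (abs_le.1 (h2 i)).2, (abs_le.1 h3).2⟩⟩

omit hP in
theorem smul_mem_coneOver_iff {q : ℝ} (hq : 0 < q) {x : (Fin n → ℝ) × ℝ} :
    q • x ∈ coneOver P ↔ x ∈ coneOver P := by
  refine ⟨fun h => ?_, fun h => smul_mem_cone h hq.le⟩
  have := smul_mem_cone h (inv_nonneg.2 hq.le)
  rwa [smul_smul, inv_mul_cancel₀ hq.ne', one_smul] at this

/-- Almost all lattice points of the cone lie in the semigroup: by `exists_conductor`, the others
lie outside a fixed translate of the cone. -/
theorem tendsto_ncard_sdiff (N : ℕ) (hN : 1 ≤ N) :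
    Tendsto (fun q : ℕ => ({w : (Fin n → ℤ) × ℤ | latticeEmb w ∈ coneOver P ∧
      w ∉ coneSemigroup P ∧ (w.2 : ℝ) ≤ N * q}.ncard : ℝ) / (q : ℝ) ^ (n + 1)) atTop (𝓝 0) := by
  obtain ⟨c, hc, hcS⟩ := hP.exists_conductor
  obtain ⟨m, hm⟩ := Int.eq_ofNat_of_zero_le (hP.nonneg_of_mem_coneSemigroup hc)
  set A : ℕ → Set ((Fin n → ℤ) × ℤ) :=
    fun q => {w | latticeEmb w ∈ coneOver P ∧ (w.2 : ℝ) ≤ N * q} with hA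
  have hAfin : ∀ q, (A q).Finite := fun q => hP.finite_of_le_cone _
  set B : Set ((Fin n → ℝ) × ℝ) := {x | x ∈ coneOver P ∧ x.2 ≤ N} with hB
  have hBconv : Convex ℝ B :=
    (convex_coneOver P).inter (convex_halfSpace_le (LinearMap.snd ℝ _ _).isLinear _)
  have hBclosed : IsClosed B :=
    hP.isClosed_coneOver.inter (isClosed_le continuous_snd continuous_const)
  have hlim := tendsto_ncard_latticeEmb_div_pow (hP.isBounded_coneOver N)
    hBclosed.measurableSet (hBconv.addHaar_frontier volume)
  have hlimA : Tendsto (fun q : ℕ => ((A q).ncard : ℝ) / (q : ℝ) ^ (n + 1)) atTop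
      (𝓝 (volume.real B)) := by
    refine hlim.congr' ?_
    filter_upwards [eventually_gt_atTop 0] with q hq
    have hq0 : (0 : ℝ) < q := by positivity
    congr 3
    ext w
    rw [Set.mem_ofPred_eq, Set.mem_smul_set_iff_inv_smul_mem₀ hq0.ne']
    refine and_congr (smul_mem_coneOver_iff (inv_pos.2 hq0)) ?_
    change (q : ℝ)⁻¹ * (w.2 : ℝ) ≤ N ↔ (w.2 : ℝ) ≤ N * q
    rw [inv_mul_le_iff₀ hq0, mul_comm]
  have hdiff := hlimA.sub (tendsto_shift_div_pow m hlimA).2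
  rw [sub_self] at hdiff
  refine tendsto_of_tendsto_of_tendsto_of_le_of_le' tendsto_const_nhds hdiff
    (Eventually.of_forall fun q => by positivity) ?_
  filter_upwards [eventually_ge_atTop m] with q hq
  rw [← sub_div]
  gcongr
  have hsub : (fun w => c + w) '' A (q - m) ⊆ A q := by
    rintro _ ⟨w, ⟨hw, hwN⟩, rfl⟩
    refine ⟨by rw [latticeEmb_add]; exact add_mem (latticeEmb_mem_coneOver hc) hw, ?_⟩
    rw [Nat.cast_sub hq] at hwN
    have hN' : (1 : ℝ) ≤ N := by exact_mod_cast hN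
    have : ((c + w).2 : ℝ) = m + w.2 := by
      rw [Prod.snd_add, hm]; push_cast; rfl
    rw [this]
    nlinarith [Nat.cast_nonneg (α := ℝ) m]
  have h1 : {w : (Fin n → ℤ) × ℤ | latticeEmb w ∈ coneOver P ∧
      w ∉ coneSemigroup P ∧ (w.2 : ℝ) ≤ N * q} ⊆ A q \ (fun w => c + w) '' A (q - m) := by
    rintro w ⟨hw, hwS, hwN⟩
    refine ⟨⟨hw, hwN⟩, ?_⟩
    rintro ⟨v, ⟨hv, -⟩, rfl⟩
    exact hwS (hcS v hv)
  have h2 := Set.ncard_le_ncard h1 ((hAfin q).sdiff)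
  rw [Set.ncard_sdiff hsub ((hAfin _).image _), Set.ncard_image_of_injective _
    (add_right_injective c)] at h2
  have h3 : (A (q - m)).ncard ≤ (A q).ncard := by
    rw [← Set.ncard_image_of_injective (A (q - m)) (add_right_injective c)]
    exact Set.ncard_le_ncard hsub (hAfin q)
  rw [← Nat.cast_sub h3]
  exact_mod_cast h2

/-- If a family of sets of lattice points differs from the lattice points in the dilates of a
region only by boundedly many translates of points which the semigroup misses, then it has the
asymptotics of the region. -/
theorem tendsto_ncard_div_pow_of_sdiff {B : Set ((Fin n → ℝ) × ℝ)}
    (hB₁ : Bornology.IsBounded B) (hB₂ : MeasurableSet B) (hB₃ : volume (frontier B) = 0)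
    (X : ℕ → Set ((Fin n → ℤ) × ℤ)) (N M : ℕ) (hN : 1 ≤ N)
    (hfin : ∀ q : ℕ, 0 < q → (X q).Finite ∧
      {w : (Fin n → ℤ) × ℤ | latticeEmb w ∈ (q : ℝ) • B}.Finite)
    (h₁ : ∀ q : ℕ, 0 < q → (X q \ {w | latticeEmb w ∈ (q : ℝ) • B}).ncard ≤
      M * {w : (Fin n → ℤ) × ℤ | latticeEmb w ∈ coneOver P ∧
        w ∉ coneSemigroup P ∧ (w.2 : ℝ) ≤ N * q}.ncard)
    (h₂ : ∀ q : ℕ, 0 < q → {w | latticeEmb w ∈ (q : ℝ) • B} \ X q ⊆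
      {w : (Fin n → ℤ) × ℤ | latticeEmb w ∈ coneOver P ∧
        w ∉ coneSemigroup P ∧ (w.2 : ℝ) ≤ N * q}) :
    Tendsto (fun q : ℕ => ((X q).ncard : ℝ) / (q : ℝ) ^ (n + 1)) atTop (𝓝 (volume.real B)) := by
  have hE := hP.tendsto_ncard_sdiff N hN
  have hlim := tendsto_ncard_latticeEmb_div_pow hB₁ hB₂ hB₃
  have hlo := hlim.sub hE
  have hhi := hlim.add (hE.const_mul (M : ℝ))
  rw [sub_zero] at hlo
  rw [mul_zero, add_zero] at hhi
  refine tendsto_of_tendsto_of_tendsto_of_le_of_le' hlo hhi ?_ ?_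
  · filter_upwards [eventually_gt_atTop 0] with q hq
    rw [← sub_div]
    gcongr
    rw [sub_le_iff_le_add]
    have h3 := Set.ncard_le_ncard (h₂ q hq) ((hP.finite_of_le_cone (N * q)).subset
      fun w hw => ⟨hw.1, hw.2.2⟩)
    have h4 := Set.ncard_le_ncard_sdiff_add_ncard {w : (Fin n → ℤ) × ℤ | latticeEmb w ∈ (q : ℝ) • B}
      (X q) (hfin q hq).1
    have h5 := h4.trans (add_le_add_left h3 _)
    rw [add_comm] at h5
    exact_mod_cast h5
  · filter_upwards [eventually_gt_atTop 0] with q hq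
    rw [← mul_div_assoc, ← add_div]
    gcongr
    have h4 := Set.ncard_le_ncard_sdiff_add_ncard (X q)
      {w : (Fin n → ℤ) × ℤ | latticeEmb w ∈ (q : ℝ) • B} (hfin q hq).2
    have h5 := h4.trans (add_le_add_left (h₁ q hq) _)
    rw [add_comm] at h5
    exact_mod_cast h5

/-- The monomials of degree less than `k t` are those outside `(𝔪ᵏ)ᵗ`. -/
theorem tendsto_ncard_degree_lt (k : ℕ) :
    Tendsto (fun t : ℕ => ({s : (Fin n → ℤ) × ℤ | s ∈ coneSemigroup P ∧ s.2 < k * t}.ncard : ℝ) /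
      (t : ℝ) ^ (n + 1)) atTop
      (𝓝 (volume.real {x : (Fin n → ℝ) × ℝ | x ∈ coneOver P ∧ x.2 < k})) := by
  set B : Set ((Fin n → ℝ) × ℝ) := {x | x ∈ coneOver P ∧ x.2 < k} with hB
  have hBconv : Convex ℝ B :=
    (convex_coneOver P).inter (convex_halfSpace_lt (LinearMap.snd ℝ _ _).isLinear _)
  have hBmeas : MeasurableSet B := hP.isClosed_coneOver.measurableSet.inter
    (isOpen_lt continuous_snd continuous_const).measurableSet
  have hmem : ∀ t : ℕ, 0 < t → ∀ w : (Fin n → ℤ) × ℤ, latticeEmb w ∈ (t : ℝ) • B ↔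
      latticeEmb w ∈ coneOver P ∧ w.2 < k * t := by
    intro t ht w
    have ht0 : (0 : ℝ) < t := by positivity
    rw [Set.mem_smul_set_iff_inv_smul_mem₀ ht0.ne']
    refine and_congr (smul_mem_coneOver_iff (inv_pos.2 ht0)) ?_
    change (t : ℝ)⁻¹ * (w.2 : ℝ) < k ↔ w.2 < k * t
    rw [inv_mul_lt_iff₀ ht0, mul_comm]
    exact_mod_cast Iff.rfl
  refine hP.tendsto_ncard_div_pow_of_sdiff ((hP.isBounded_coneOver k).subset fun x hx =>
    ⟨hx.1, hx.2.le⟩) hBmeas (hBconv.addHaar_frontier volume) _ (k + 1) 0 (by omega) ?_ ?_ ?_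
  · refine fun t ht => ⟨(hP.finite_of_le_cone (k * t)).subset fun w hw =>
      ⟨latticeEmb_mem_coneOver hw.1, ?_⟩, (hP.finite_of_le_cone (k * t)).subset fun w hw =>
      ⟨((hmem t ht w).1 hw).1, ?_⟩⟩
    · exact_mod_cast hw.2.le
    · exact_mod_cast ((hmem t ht w).1 hw).2.le
  · intro t ht
    rw [zero_mul, Nat.le_zero]
    rw [Set.sdiff_eq_empty.2, Set.ncard_empty]
    intro w hw
    exact (hmem t ht w).2 ⟨latticeEmb_mem_coneOver hw.1, hw.2⟩
  · rintro t ht w ⟨hw, hwX⟩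
    have h1 := (hmem t ht w).1 hw
    refine ⟨h1.1, fun hS => hwX ⟨hS, h1.2⟩, ?_⟩
    have h2 : (w.2 : ℝ) ≤ k * t := by exact_mod_cast h1.2.le
    push_cast
    nlinarith [Nat.cast_nonneg (α := ℝ) t]

omit hP in
theorem volume_frontier_iInter_eq_zero {E ι : Type*} [TopologicalSpace E] [MeasureSpace E]
    (s : Set ι) (hs : s.Finite) (B : ι → Set E) (h : ∀ i ∈ s, volume (frontier (B i)) = 0) :
    volume (frontier (⋂ i ∈ s, B i)) = 0 := by
  induction s, hs using Set.Finite.induction_on with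
  | empty => simp
  | insert ha hs ih =>
    rw [Set.biInter_insert]
    refine measure_mono_null (frontier_inter_subset _ _) (measure_union_null ?_ ?_)
    · exact measure_mono_null Set.inter_subset_left (h _ (Set.mem_insert _ _))
    · exact measure_mono_null Set.inter_subset_right (ih fun i hi => h i (Set.mem_insert_of_mem _ hi))

/-- The region `C_D \ ⋃ ((g, k) + C_D)`, where `(g, k)` runs through the elements of degree `k` of
the semigroup. Its volume is `e_HK(𝔪ᵏ)`. -/
def _root_.Toric.hilbertKunzRegion (P : Set (Fin n → ℝ)) (k : ℕ) : Set ((Fin n → ℝ) × ℝ) :=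
  {x | x ∈ coneOver P ∧ ∀ g : Fin n → ℤ, (g, (k : ℤ)) ∈ coneSemigroup P →
    x - latticeEmb (g, (k : ℤ)) ∉ coneOver P}

/-- The height of the region exceeds `k` by an amount bounded independently of `k`. -/
theorem lt_of_mem_hilbertKunzRegion {k : ℕ} {x : (Fin n → ℝ) × ℝ}
    (hx : x ∈ hilbertKunzRegion P k) : x.2 < k + hP.finite.toFinset.card := by
  by_contra! hcon
  obtain ⟨g, hg, hgx⟩ := hP.exists_sub_mem_coneOver k hx.1 hcon
  exact hx.2 g hg hgx

theorem finite_degree_eq (k : ℕ) : {g : Fin n → ℤ | (g, (k : ℤ)) ∈ coneSemigroup P}.Finite :=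
  ((hP.finite_of_le_cone k).preimage (f := fun g : Fin n → ℤ => (g, (k : ℤ)))
    (fun _ _ _ _ h => congrArg Prod.fst h)).subset
    fun g hg => ⟨latticeEmb_mem_coneOver hg, by simp⟩

omit hP in
theorem hilbertKunzRegion_eq (k : ℕ) : hilbertKunzRegion P k =
    (coneOver P : Set ((Fin n → ℝ) × ℝ)) ∩
      ⋂ g ∈ {g : Fin n → ℤ | (g, (k : ℤ)) ∈ coneSemigroup P},
        ((fun x => x - latticeEmb (g, (k : ℤ))) ⁻¹' (coneOver P : Set ((Fin n → ℝ) × ℝ)))ᶜ := by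
  ext x
  simp [hilbertKunzRegion]

theorem measurableSet_hilbertKunzRegion (k : ℕ) : MeasurableSet (hilbertKunzRegion P k) := by
  rw [hilbertKunzRegion_eq]
  refine hP.isClosed_coneOver.measurableSet.inter
    (MeasurableSet.biInter (Set.to_countable _) fun g _ => ?_)
  exact (hP.isClosed_coneOver.preimage (continuous_sub_right _)).measurableSet.compl

theorem volume_frontier_hilbertKunzRegion (k : ℕ) :
    volume (frontier (hilbertKunzRegion P k)) = 0 := by
  rw [hilbertKunzRegion_eq]
  refine measure_mono_null (frontier_inter_subset _ _) (measure_union_null ?_ ?_)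
  · exact measure_mono_null Set.inter_subset_left ((convex_coneOver P).addHaar_frontier volume)
  · refine measure_mono_null Set.inter_subset_right
      (volume_frontier_iInter_eq_zero _ (hP.finite_degree_eq k) _ fun g _ => ?_)
    rw [frontier_compl]
    refine Convex.addHaar_frontier volume ?_
    have := (convex_coneOver P).translate_preimage_left (-latticeEmb (g, (k : ℤ)))
    simp only [← sub_eq_add_neg] at this
    exact this

/-- The monomials counted here are those outside the Frobenius power `(𝔪ᵏ)^[q]`. -/
theorem tendsto_ncard_hilbertKunz (k : ℕ) :
    Tendsto (fun q : ℕ => ({s : (Fin n → ℤ) × ℤ | s ∈ coneSemigroup P ∧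
      ∀ g : Fin n → ℤ, (g, (k : ℤ)) ∈ coneSemigroup P →
        s - q • ((g, k) : (Fin n → ℤ) × ℤ) ∉ coneSemigroup P}.ncard : ℝ) /
      (q : ℝ) ^ (n + 1)) atTop (𝓝 (volume.real (hilbertKunzRegion P k))) := by
  set c := hP.finite.toFinset.card with hc
  have hc1 : 1 ≤ c := by
    obtain ⟨u, hu⟩ := hP.nonempty
    exact Finset.card_pos.2 ⟨u, hP.finite.mem_toFinset.2 hu⟩
  have hmem : ∀ q : ℕ, 0 < q → ∀ w : (Fin n → ℤ) × ℤ,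
      latticeEmb w ∈ (q : ℝ) • hilbertKunzRegion P k ↔
      latticeEmb w ∈ coneOver P ∧ ∀ g : Fin n → ℤ, (g, (k : ℤ)) ∈ coneSemigroup P →
        latticeEmb (w - q • ((g, k) : (Fin n → ℤ) × ℤ)) ∉ coneOver P := by
    intro q hq w
    have hq0 : (0 : ℝ) < q := by positivity
    rw [Set.mem_smul_set_iff_inv_smul_mem₀ hq0.ne']
    refine and_congr (smul_mem_coneOver_iff (inv_pos.2 hq0)) (forall₂_congr fun g _ => not_congr ?_)
    rw [← smul_mem_coneOver_iff hq0, smul_sub, smul_smul, mul_inv_cancel₀ hq0.ne', one_smul,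
      latticeEmb_sub, latticeEmb_nsmul]
  have hlt : ∀ q : ℕ, 0 < q → ∀ w : (Fin n → ℤ) × ℤ,
      latticeEmb w ∈ (q : ℝ) • hilbertKunzRegion P k → (w.2 : ℝ) ≤ ((k + c : ℕ) : ℝ) * q := by
    intro q hq w hw
    have hq0 : (0 : ℝ) < q := by positivity
    rw [Set.mem_smul_set_iff_inv_smul_mem₀ hq0.ne'] at hw
    have h1 : (q : ℝ)⁻¹ * (w.2 : ℝ) < k + c := hP.lt_of_mem_hilbertKunzRegion hw
    rw [inv_mul_lt_iff₀ hq0, mul_comm] at h1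
    push_cast
    exact h1.le
  have hX : ∀ q : ℕ, 0 < q → ∀ s ∈ coneSemigroup P, (∀ g : Fin n → ℤ, (g, (k : ℤ)) ∈ coneSemigroup P →
        s - q • ((g, k) : (Fin n → ℤ) × ℤ) ∉ coneSemigroup P) →
        (s.2 : ℝ) ≤ ((k + c : ℕ) : ℝ) * q := by
    intro q hq s hs hsg
    by_contra! hcon
    obtain ⟨g, hg, hgs⟩ := hP.exists_sub_mem_coneSemigroup q k hq hs (by
      rw [mul_comm]
      exact_mod_cast hcon.le)
    exact hsg g hg hgs
  refine hP.tendsto_ncard_div_pow_of_sdiff ((hP.isBounded_coneOver (k + c)).subset fun x hx =>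
    ⟨hx.1, (hP.lt_of_mem_hilbertKunzRegion hx).le⟩) (hP.measurableSet_hilbertKunzRegion k)
    (hP.volume_frontier_hilbertKunzRegion k) _ (k + c) (hP.finite_degree_eq k).toFinset.card
    (by omega) ?_ ?_ ?_
  · exact fun q hq => ⟨(hP.finite_of_le_cone (((k + c : ℕ) : ℝ) * q)).subset fun w hw =>
      ⟨latticeEmb_mem_coneOver hw.1, hX q hq w hw.1 hw.2⟩,
      (hP.finite_of_le_cone (((k + c : ℕ) : ℝ) * q)).subset fun w hw =>
      ⟨((hmem q hq w).1 hw).1, hlt q hq w hw⟩⟩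
  · intro q hq
    set T : Set ((Fin n → ℤ) × ℤ) := {w | latticeEmb w ∈ coneOver P ∧
        w ∉ coneSemigroup P ∧ (w.2 : ℝ) ≤ ((k + c : ℕ) : ℝ) * q} with hT
    have hTfin : T.Finite := (hP.finite_of_le_cone _).subset fun w hw => ⟨hw.1, hw.2.2⟩
    have hsub : {s : (Fin n → ℤ) × ℤ | s ∈ coneSemigroup P ∧
        ∀ g : Fin n → ℤ, (g, (k : ℤ)) ∈ coneSemigroup P →
        s - q • ((g, k) : (Fin n → ℤ) × ℤ) ∉ coneSemigroup P} \
        {w | latticeEmb w ∈ (q : ℝ) • hilbertKunzRegion P k} ⊆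
        ⋃ g ∈ (hP.finite_degree_eq k).toFinset,
          (fun w => q • ((g, k) : (Fin n → ℤ) × ℤ) + w) '' T := by
      rintro s ⟨⟨hs, hsg⟩, hs'⟩
      have h1 : ¬ ∀ g : Fin n → ℤ, (g, (k : ℤ)) ∈ coneSemigroup P →
          latticeEmb (s - q • ((g, k) : (Fin n → ℤ) × ℤ)) ∉ coneOver P := fun h =>
        hs' ((hmem q hq s).2 ⟨latticeEmb_mem_coneOver hs, h⟩)
      push Not at h1
      obtain ⟨g, hg, hgs⟩ := h1
      refine Set.mem_biUnion ((hP.finite_degree_eq k).mem_toFinset.2 hg)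
        ⟨s - q • ((g, k) : (Fin n → ℤ) × ℤ), ⟨hgs, hsg g hg, ?_⟩, by simp⟩
      have h2 : (((s - q • ((g, k) : (Fin n → ℤ) × ℤ)).2 : ℤ) : ℝ) = s.2 - q * k := by simp
      rw [h2]
      have h3 := hX q hq s hs hsg
      have h4 : (0 : ℝ) ≤ q * k := by positivity
      linarith
    refine (Set.ncard_le_ncard hsub ?_).trans ?_
    · exact Set.Finite.biUnion (Finset.finite_toSet _) fun g _ => hTfin.image _
    · refine (Finset.set_ncard_biUnion_le _ _).trans ?_
      refine (Finset.sum_le_card_nsmul _ _ T.ncard fun g _ => ?_).trans (by rw [smul_eq_mul])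
      exact Set.ncard_image_le hTfin
  · rintro q hq w ⟨hw, hwX⟩
    have h1 := (hmem q hq w).1 hw
    refine ⟨h1.1, fun hS => hwX ⟨hS, fun g hg hgs => h1.2 g hg (latticeEmb_mem_coneOver hgs)⟩,
      hlt q hq w hw⟩

end IsSpanningPolytope

end Toric

/-! ### The function `φ_D` -/

namespace Toric

/-- The `ℤⁿ`-periodic set whose intersection with the unit cell has volume `φ_D(lam)`: the
complement of the translates of `lam • P` by lattice vectors. -/
def gapSet {n : ℕ} (P : Set (Fin n → ℝ)) (lam : ℝ) : Set (Fin n → ℝ) :=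
  {x | ∀ u : Fin n → ℤ, (x - toReal u, lam) ∉ coneOver P}

theorem mem_unitCell_iff {n : ℕ} (v : Fin n → ℤ) (x : Fin n → ℝ) :
    x ∈ unitCell v ↔ ∀ i, (v i : ℝ) ≤ x i ∧ x i ≤ v i + 1 := by
  rw [unitCell, Set.mem_vadd_set_iff_neg_vadd_mem, Set.mem_Icc, Pi.le_def, Pi.le_def,
    ← forall_and]
  refine forall_congr' fun i => ?_
  simp [toReal]

theorem phi_eq {n : ℕ} (P : Set (Fin n → ℝ)) (v : Fin n → ℤ) (lam : ℝ) :
    phi P v lam = volume.real (unitCell v ∩ gapSet P lam) := by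
  rw [phi, Measure.real]
  congr 2
  ext x
  have : ∀ u : Fin n → ℤ, (x, lam + 1) ∈ (toReal u, (1 : ℝ)) +ᵥ
      (coneOver P : Set ((Fin n → ℝ) × ℝ)) ↔ (x - toReal u, lam) ∈ coneOver P := by
    intro u
    rw [Set.mem_vadd_set_iff_neg_vadd_mem]
    have : -((toReal u, (1 : ℝ)) : (Fin n → ℝ) × ℝ) +ᵥ (x, lam + 1) = (x - toReal u, lam) := by
      ext1
      · simp [sub_eq_add_neg, add_comm]
      · simp
    rw [this]
    rfl
  simp [this, gapSet]

theorem add_mem_gapSet_iff {n : ℕ} {P : Set (Fin n → ℝ)} {lam : ℝ} (v : Fin n → ℤ)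
    (x : Fin n → ℝ) : toReal v + x ∈ gapSet P lam ↔ x ∈ gapSet P lam := by
  constructor
  · intro h u hu
    refine h (v + u) ?_
    rwa [toReal_add, add_sub_add_left_eq_sub]
  · intro h u hu
    refine h (u - v) ?_
    rw [toReal_sub]
    convert hu using 2
    abel

theorem phi_eq_phi_zero {n : ℕ} (P : Set (Fin n → ℝ)) (v : Fin n → ℤ) (lam : ℝ) :
    phi P v lam = phi P 0 lam := by
  rw [phi_eq, phi_eq, Measure.real, Measure.real, ← measure_preimage_add volume (toReal v)]
  congr 2
  ext x
  refine and_congr ?_ (add_mem_gapSet_iff v x)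
  rw [mem_unitCell_iff, mem_unitCell_iff]
  refine forall_congr' fun i => ?_
  simp only [Pi.add_apply, toReal, Pi.zero_apply, Int.cast_zero]
  constructor <;> rintro ⟨h1, h2⟩ <;> constructor <;> linarith

theorem unitCell_eq_Icc {n : ℕ} (v : Fin n → ℤ) :
    unitCell v = Set.Icc (toReal v) (toReal v + 1) := by
  ext x
  rw [mem_unitCell_iff, Set.mem_Icc, Pi.le_def, Pi.le_def, ← forall_and]
  rfl

namespace IsSpanningPolytope

variable {n : ℕ} {P : Set (Fin n → ℝ)} (hP : IsSpanningPolytope P)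
include hP

theorem measurableSet_gapSet (lam : ℝ) : MeasurableSet (gapSet P lam) := by
  have : gapSet P lam = ⋂ u : Fin n → ℤ, ((fun x => (x - toReal u, lam)) ⁻¹'
      (coneOver P : Set ((Fin n → ℝ) × ℝ)))ᶜ := by
    ext x; simp [gapSet]
  rw [this]
  refine MeasurableSet.iInter fun u => ?_
  exact (hP.isClosed_coneOver.preimage (by fun_prop)).measurableSet.compl

/-- At some height, the slice of the cone contains a large cube centred at a lattice point. The
centre is a sum of elements `d i` of the semigroup such that `d i ± R e_i` lie in the semigroup. -/
theorem exists_forall_add_mem_coneOver (R : ℕ) : ∃ (c : Fin n → ℤ) (m : ℕ),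
    ∀ x : Fin n → ℝ, (∀ i, |x i| ≤ R) → (toReal c + x, (m : ℝ)) ∈ coneOver P := by
  choose s hs hsr using hP.exists_add_mem_coneSemigroup
  let e : Fin n → (Fin n → ℤ) × ℤ := fun i => (Pi.single i (R : ℤ), 0)
  obtain ⟨d, hd, hd1, hd2⟩ : ∃ d : Fin n → (Fin n → ℤ) × ℤ, (∀ i, d i ∈ coneSemigroup P) ∧
      (∀ i, d i + e i ∈ coneSemigroup P) ∧ ∀ i, d i + -e i ∈ coneSemigroup P := by
    refine ⟨fun i => s (e i) + s (-e i), fun i => add_mem (hs _) (hs _), fun i => ?_, fun i => ?_⟩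
    · have := add_mem (hsr (e i)) (hs (-e i))
      rwa [add_right_comm] at this
    · have := add_mem (hs (e i)) (hsr (-e i))
      rwa [← add_assoc] at this
  have hsum : ∑ i, d i ∈ coneSemigroup P := sum_mem fun i _ => hd i
  obtain ⟨m, hm⟩ := Int.eq_ofNat_of_zero_le (hP.nonneg_of_mem_coneSemigroup hsum)
  refine ⟨(∑ i, d i).1, m, fun x hx => ?_⟩
  have hpiece : ∀ i, latticeEmb (d i) + ((Pi.single i (x i), 0) : (Fin n → ℝ) × ℝ) ∈ coneOver P := by
    intro i
    have h1 := latticeEmb_mem_coneOver (hd1 i)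
    have h2 := latticeEmb_mem_coneOver (hd2 i)
    have hxi := abs_le.1 (hx i)
    rcases Nat.eq_zero_or_pos R with hR | hR
    · have : x i = 0 := by rw [hR] at hxi; push_cast at hxi; linarith
      rw [this, Pi.single_zero]
      exact (add_zero (latticeEmb (d i))).symm ▸ latticeEmb_mem_coneOver (hd i)
    have hR' : (0 : ℝ) < R := by exact_mod_cast hR
    have h3 := add_mem (smul_mem_cone h1 (t := (R + x i) / (2 * R))
      (div_nonneg (by linarith) (by linarith)))
      (smul_mem_cone h2 (t := (R - x i) / (2 * R)) (div_nonneg (by linarith) (by linarith)))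
    convert h3 using 1
    have he : latticeEmb (e i) = (Pi.single i (R : ℝ), 0) := by
      ext j
      · by_cases hj : j = i
        · subst hj; simp [latticeEmb, toReal, e]
        · simp [latticeEmb, toReal, e, hj]
      · simp [latticeEmb, e]
    have he' : latticeEmb (-e i) = -latticeEmb (e i) := by
      ext1 <;> simp [latticeEmb, toReal_neg]
    rw [latticeEmb_add, latticeEmb_add, he', smul_add, smul_add, add_add_add_comm, ← add_smul,
      smul_neg, ← sub_eq_add_neg, ← sub_smul, ← add_div, ← sub_div]
    have h4 : (R + x i + (R - x i)) / (2 * R : ℝ) = 1 := by field_simp; ring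
    have h5 : (R + x i - (R - x i)) / (2 * R : ℝ) = x i / R := by field_simp; ring
    rw [h4, h5, one_smul, he]
    congr 1
    ext j
    · by_cases hj : j = i
      · subst hj
        simp [hR'.ne']
      · simp [hj]
    · simp
  have := sum_mem (S := coneOver P) (t := Finset.univ) fun i _ => hpiece i
  convert this using 1
  rw [Finset.sum_add_distrib]
  have h1 : ∑ i, latticeEmb (d i) = latticeEmb (∑ i, d i) := by
    rw [show ∀ x, latticeEmb x = AddMonoidHom.mk' latticeEmb latticeEmb_add x from
      fun _ => rfl, map_sum]
    rfl
  rw [h1]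
  ext1
  · simp [latticeEmb, Prod.fst_sum, Finset.univ_sum_single]
  · simp [latticeEmb, Prod.snd_sum, hm]

theorem slice_eq {z : ℝ} (hz : 0 ≤ z) : {x | (x, z) ∈ coneOver P} = z • P := by
  ext x
  exact (hP.mem_coneOver_iff x z).trans ⟨fun h => h.2, fun h => ⟨hz, h⟩⟩

theorem volume_slice {z : ℝ} (hz : 0 ≤ z) :
    volume.real {x | (x, z) ∈ coneOver P} = z ^ n * volume.real P := by
  rw [hP.slice_eq hz, Measure.real, Measure.addHaar_smul, ENNReal.toReal_mul, Measure.real]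
  simp [abs_of_nonneg (pow_nonneg hz n)]
  exact Or.inl (pow_nonneg hz n)

theorem volume_slice_lt_top (z : ℝ) : volume {x | (x, z) ∈ coneOver P} < ⊤ := by
  by_cases hz : 0 ≤ z
  · rw [hP.slice_eq hz]
    exact (hP.isCompact.smul z).measure_lt_top
  · have : {x | (x, z) ∈ coneOver P} = ∅ := by
      ext x
      simp only [Set.mem_ofPred_eq, Set.mem_empty_iff_false, iff_false]
      exact fun h => hz ((hP.mem_coneOver_iff x z).1 h).1
    rw [this]
    simp

theorem tendsto_ncard_slice :
    Tendsto (fun k : ℕ => ({u : Fin n → ℤ | (toReal u, (k : ℝ)) ∈ coneOver P}.ncard : ℝ) /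
      (k : ℝ) ^ n) atTop (𝓝 (volume.real P)) := by
  have := tendsto_ncard_int_div_pow hP.isCompact.isBounded hP.isCompact.measurableSet
    (hP.convex.addHaar_frontier volume)
  rw [Fintype.card_fin] at this
  refine this.congr fun k => ?_
  congr 3
  ext u
  rw [Set.mem_ofPred_eq, Set.mem_ofPred_eq, hP.mem_coneOver_iff]
  exact ⟨fun h => ⟨Nat.cast_nonneg k, h⟩, fun h => h.2⟩

theorem finite_slice (k : ℕ) : {u : Fin n → ℤ | (toReal u, (k : ℝ)) ∈ coneOver P}.Finite :=
  ((hP.finite_of_le_cone k).preimage (f := fun g : Fin n → ℤ => (g, (k : ℤ)))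
    (fun _ _ _ _ h => congrArg Prod.fst h)).subset fun g hg => by
      refine ⟨?_, by simp⟩
      simpa [latticeEmb] using hg

/-- If the unit cells which meet `Q` are indexed, up to the shift by `c`, by lattice points of
`K • P`, then their number bounds the volume of the periodic set `gapSet` inside `Q`. -/
theorem volume_inter_gapSet_le {lam : ℝ} {Q : Set (Fin n → ℝ)} {K : ℕ} {c : Fin n → ℤ}
    (h : ∀ x ∈ Q, (toReal ((fun i => ⌊x i⌋) + c), (K : ℝ)) ∈ coneOver P) :
    volume.real (Q ∩ gapSet P lam) ≤
      {u : Fin n → ℤ | (toReal u, (K : ℝ)) ∈ coneOver P}.ncard * phi P 0 lam := by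
  have hsub : Q ∩ gapSet P lam ⊆ ⋃ u ∈ (hP.finite_slice K).toFinset,
      (unitCell (u - c) ∩ gapSet P lam) := by
    rintro x ⟨hx, hxg⟩
    refine Set.mem_biUnion ((hP.finite_slice K).mem_toFinset.2 (h x hx)) ⟨?_, hxg⟩
    rw [add_sub_cancel_right, mem_unitCell_iff]
    exact fun i => ⟨Int.floor_le _, (Int.lt_floor_add_one _).le⟩
  have hfin : ∀ u : Fin n → ℤ, volume (unitCell u ∩ gapSet P lam) < ⊤ := fun u => by
    refine (measure_mono Set.inter_subset_left).trans_lt ?_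
    rw [unitCell_eq_Icc]
    exact isCompact_Icc.measure_lt_top
  refine (measureReal_mono hsub ?_).trans ((measureReal_biUnion_finset_le _ _).trans ?_)
  · exact (measure_biUnion_lt_top (Finset.finite_toSet _) fun u _ => hfin _).ne
  · rw [Set.ncard_eq_toFinset_card _ (hP.finite_slice K), ← nsmul_eq_mul]
    refine Finset.sum_le_card_nsmul _ _ _ fun u _ => ?_
    rw [← phi_eq, phi_eq_phi_zero]

/-- If `Q` contains the unit cells indexed, up to the shift by `c`, by the lattice points of
`K • P`, then their number bounds from below the volume of the periodic set `gapSet` inside `Q`. -/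
theorem le_volume_inter_gapSet {lam : ℝ} {Q : Set (Fin n → ℝ)} (hQ : volume Q ≠ ⊤) {K : ℕ}
    {c : Fin n → ℤ}
    (h : ∀ w : Fin n → ℤ, (toReal w, (K : ℝ)) ∈ coneOver P → unitCell (w + c) ⊆ Q) :
    {u : Fin n → ℤ | (toReal u, (K : ℝ)) ∈ coneOver P}.ncard * phi P 0 lam ≤
      volume.real (Q ∩ gapSet P lam) := by
  -- half-open cells, as the closed ones overlap
  set D : (Fin n → ℤ) → Set (Fin n → ℝ) := fun u =>
    Set.pi Set.univ (fun i => Set.Ico (toReal u i) ((toReal u + 1) i)) ∩ gapSet P lam with hD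
  have hDfloor : ∀ u, ∀ x ∈ D u, (fun i => ⌊x i⌋) = u := by
    rintro u x ⟨hx, -⟩
    ext i
    have := hx i (Set.mem_univ i)
    exact Int.floor_eq_iff.2 this
  have hvol : ∀ u, volume.real (D u) = phi P 0 lam := by
    intro u
    rw [← phi_eq_phi_zero P u, phi_eq, unitCell_eq_Icc]
    exact measureReal_congr (Measure.univ_pi_Ico_ae_eq_Icc.inter (ae_eq_refl _))
  have hsub : ⋃ u ∈ (hP.finite_slice K).toFinset, D (u + c) ⊆ Q ∩ gapSet P lam := by
    refine Set.iUnion₂_subset fun u hu => ?_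
    rintro x ⟨hx, hxg⟩
    refine ⟨h u ((hP.finite_slice K).mem_toFinset.1 hu) ?_, hxg⟩
    rw [mem_unitCell_iff]
    intro i
    have := hx i (Set.mem_univ i)
    exact ⟨this.1, this.2.le⟩
  refine le_trans (le_of_eq ?_) (measureReal_mono hsub
    ((measure_mono Set.inter_subset_left).trans_lt hQ.lt_top).ne)
  have hfin : ∀ u, volume (D u) ≠ ⊤ := by
    intro u
    refine ((measure_mono (t := unitCell u) ?_).trans_lt ?_).ne
    · rintro x ⟨hx, -⟩
      rw [mem_unitCell_iff]
      intro i
      have := hx i (Set.mem_univ i)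
      exact ⟨this.1, this.2.le⟩
    · rw [unitCell_eq_Icc]
      exact isCompact_Icc.measure_lt_top
  rw [measureReal_biUnion_finset (h := fun u _ => hfin _), Finset.sum_congr rfl fun u _ => hvol _, Finset.sum_const,
    nsmul_eq_mul, Set.ncard_eq_toFinset_card _ (hP.finite_slice K)]
  · intro u _ v _ huv
    rw [Function.onFun, Set.disjoint_left]
    intro x hx hx'
    exact huv (add_right_cancel ((hDfloor _ x hx).symm.trans (hDfloor _ x hx')))
  · intro u _
    exact (MeasurableSet.univ_pi fun i => measurableSet_Ico).inter (hP.measurableSet_gapSet lam)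

end IsSpanningPolytope

/-! ### Slices of the region of a Hilbert-Kunz multiplicity -/

theorem tendsto_add_pow_div_pow (n : ℕ) (c : ℝ) :
    Tendsto (fun k : ℕ => ((k : ℝ) + c) ^ n / (k : ℝ) ^ n) atTop (𝓝 1) := by
  have h2 : Tendsto (fun k : ℕ => (1 + c / (k : ℝ)) ^ n) atTop (𝓝 ((1 + 0) ^ n)) :=
    (tendsto_const_nhds.add (tendsto_const_div_atTop_nhds_zero_nat c)).pow n
  rw [add_zero, one_pow] at h2
  refine h2.congr' ?_
  filter_upwards [eventually_gt_atTop 0] with k hk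
  have : (k : ℝ) ≠ 0 := by positivity
  rw [← div_pow]
  congr 1
  field_simp

/-- The slice of the region at height `k + lam` arises from the slice of the cone by removing the
translates of `lam • P` by the elements of degree `k` of the semigroup. -/
theorem mem_slice_hilbertKunzRegion_iff {n : ℕ} {P : Set (Fin n → ℝ)} {k : ℕ} {lam : ℝ}
    {x : Fin n → ℝ} : (x, (k : ℝ) + lam) ∈ hilbertKunzRegion P k ↔ (x, (k : ℝ) + lam) ∈ coneOver P ∧
      ∀ g : Fin n → ℤ, (g, (k : ℤ)) ∈ coneSemigroup P → (x - toReal g, lam) ∉ coneOver P := by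
  refine and_congr Iff.rfl (forall₂_congr fun g _ => not_congr ?_)
  have : ((x, (k : ℝ) + lam) : (Fin n → ℝ) × ℝ) - latticeEmb (g, (k : ℤ)) = (x - toReal g, lam) := by
    ext1 <;> simp [latticeEmb]
  rw [this]

namespace IsSpanningPolytope

variable {n : ℕ} {P : Set (Fin n → ℝ)} (hP : IsSpanningPolytope P)
include hP

theorem exists_coord_bound : ∃ ρ : ℕ, ∀ x ∈ P, ∀ i, |x i| ≤ ρ := by
  obtain ⟨R, hR⟩ := hP.isCompact.isBounded.subset_closedBall 0
  refine ⟨⌈R⌉₊, fun x hx i => ?_⟩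
  have := hR hx
  rw [mem_closedBall_zero_iff] at this
  exact ((norm_le_pi_norm x i).trans this).trans (Nat.le_ceil R)

/-- After scaling by `k^n`, the slices of the region converge to `φ_D` times the volume of `P`.
Away from the boundary of the slice of the cone, the slice of the region is the periodic set
`gapSet`, since there all the lattice points of height `k` that matter lie in the semigroup. -/
theorem tendsto_volume_slice {lam : ℝ} (hlam : 0 ≤ lam) :
    Tendsto (fun k : ℕ => volume.real {x | (x, (k : ℝ) + lam) ∈ hilbertKunzRegion P k} /
      (k : ℝ) ^ n) atTop (𝓝 (volume.real P * phi P 0 lam)) := by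
  obtain ⟨a, ha⟩ := hP.nonempty
  obtain ⟨ρ, hρ⟩ := hP.exists_coord_bound
  set p := toReal a with hp
  have hpP : p ∈ P := ha
  have hpC : ∀ t : ℝ, 0 ≤ t → ((t • p, t) : (Fin n → ℝ) × ℝ) ∈ coneOver P := fun t ht =>
    (hP.mem_coneOver_iff _ _).2 ⟨ht, p, hpP, rfl⟩
  set L := ⌈lam⌉₊ with hL
  have hlamL : lam ≤ L := Nat.le_ceil lam
  have hρ0 : (0 : ℝ) ≤ ρ := Nat.cast_nonneg ρ
  -- `(c, m)` absorbs an error of a unit cell and of an element of `t • P` with `t ≤ L`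
  obtain ⟨c, m, hcm⟩ := hP.exists_forall_add_mem_coneOver (1 + L * ρ)
  have hsmall : ∀ (y q : Fin n → ℝ) (t : ℝ), (∀ i, |y i| ≤ 1) → q ∈ P → 0 ≤ t → t ≤ L →
      (toReal c + (y - t • q), (m : ℝ)) ∈ coneOver P := by
    intro y q t hy hq ht htL
    refine hcm _ fun i => ?_
    rw [Pi.sub_apply, Pi.smul_apply, smul_eq_mul]
    refine (abs_sub _ _).trans ?_
    push_cast
    refine add_le_add (hy i) ?_
    rw [abs_mul, abs_of_nonneg ht]
    exact mul_le_mul htL (hρ q hq i) (abs_nonneg _) (ht.trans htL)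
  obtain ⟨b, hbS, hb⟩ := hP.exists_conductor
  obtain ⟨l, hl⟩ := Int.eq_ofNat_of_zero_le (hP.nonneg_of_mem_coneSemigroup hbS)
  have hbC : (toReal b.1, (l : ℝ)) ∈ coneOver P := by
    have := latticeEmb_mem_coneOver hbS
    rwa [latticeEmb, hl] at this
  set N : ℕ → ℝ := fun k => ({u : Fin n → ℤ | (toReal u, (k : ℝ)) ∈ coneOver P}.ncard : ℝ) with hN
  set φ := phi P 0 lam with hφ
  set V := volume.real P with hV
  set Q : ℕ → Set (Fin n → ℝ) := fun k => {x | (x, (k : ℝ) + lam) ∈ coneOver P} with hQ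
  have hQfin : ∀ k, volume (Q k) ≠ ⊤ := fun k => (hP.volume_slice_lt_top _).ne
  set T : ℕ → Set (Fin n → ℝ) := fun k => {x | (x, (k : ℝ) + lam) ∈ hilbertKunzRegion P k} with hT
  have hTQ : ∀ k, T k ⊆ Q k := fun k x hx => hx.1
  have hlower : ∀ k, m ≤ k → N (k - m) * φ ≤ volume.real (T k) := by
    intro k hk
    refine (hP.le_volume_inter_gapSet (lam := lam) (Q := Q k) (c := c) (hQfin k) ?_).trans
      (measureReal_mono ?_ ((measure_mono (hTQ k)).trans_lt (hQfin k).lt_top).ne)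
    · intro w hw x hx
      have h1 := hsmall (x - toReal w - toReal c) p lam (fun i => by
        have := (mem_unitCell_iff _ _).1 hx i
        simp only [Pi.add_apply, Int.cast_add] at this
        simp only [Pi.sub_apply, toReal]
        rw [abs_le]
        constructor <;> linarith) hpP hlam hlamL
      have h2 := add_mem (add_mem hw h1) (hpC lam hlam)
      change (x, (k : ℝ) + lam) ∈ coneOver P
      convert h2 using 1
      rw [Nat.cast_sub hk]
      ext1
      · simp only [Prod.fst_add]; abel
      · simp only [Prod.snd_add]; ring
    · rintro x ⟨hx, hxg⟩
      exact mem_slice_hilbertKunzRegion_iff.2 ⟨hx, fun g _ => hxg g⟩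
  have hupper : ∀ k, l + m ≤ k → volume.real (T k) ≤
      N (k + (L + m)) * φ + (((k : ℝ) + lam) ^ n * V - ((k : ℝ) + -(l + m)) ^ n * V) := by
    intro k hk
    have hk' : (l : ℝ) + m ≤ k := by exact_mod_cast hk
    -- on `Q'`, every lattice point `u` with `x ∈ u + lam • P` is in the semigroup
    set Q' : Set (Fin n → ℝ) :=
      {x | (x - (toReal b.1 + toReal c), (k : ℝ) + -(l + m)) ∈ coneOver P} with hQ'
    have hQ'Q : Q' ⊆ Q k := by
      intro x hx
      have h1 := hsmall 0 p lam (by simp) hpP hlam hlamL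
      have h2 := add_mem (add_mem (add_mem hx hbC) h1) (hpC lam hlam)
      change (x, (k : ℝ) + lam) ∈ coneOver P
      convert h2 using 1
      ext1
      · simp only [Prod.fst_add]; abel
      · simp only [Prod.snd_add]; ring
    have hQ'vol : volume.real Q' = ((k : ℝ) + -(l + m)) ^ n * V := by
      rw [← hP.volume_slice (by linarith), Measure.real, Measure.real,
        ← measure_preimage_add_right volume (-(toReal b.1 + toReal c))
          {x | (x, (k : ℝ) + -(l + m)) ∈ coneOver P}]
      congr 2
    have hQ'meas : MeasurableSet Q' :=
      (hP.isClosed_coneOver.preimage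
        (f := fun x => (x - (toReal b.1 + toReal c), (k : ℝ) + -(l + m))) (by fun_prop)).measurableSet
    have hsub : T k ⊆ (Q k ∩ gapSet P lam) ∪ (Q k \ Q') := by
      intro x hx
      by_cases hxg : x ∈ gapSet P lam
      · exact Or.inl ⟨hTQ k hx, hxg⟩
      refine Or.inr ⟨hTQ k hx, fun hxQ' => ?_⟩
      have hx' := mem_slice_hilbertKunzRegion_iff.1 hx
      simp only [gapSet, Set.mem_ofPred_eq, not_forall, not_not] at hxg
      obtain ⟨u, hu⟩ := hxg
      refine hx'.2 u ?_ hu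
      obtain ⟨-, q, hq, hqx⟩ := (hP.mem_coneOver_iff _ _).1 hu
      have hqx' : lam • q = x - toReal u := hqx
      have h1 := add_mem hxQ' (hsmall 0 q lam (by simp) hq hlam hlamL)
      have h2 : latticeEmb ((u, (k : ℤ)) - b) ∈ coneOver P := by
        convert h1 using 1
        rw [hqx', latticeEmb_sub, latticeEmb, latticeEmb, hl]
        ext1
        · simp only [Prod.fst_add, Prod.fst_sub]; abel
        · simp only [Prod.snd_add, Prod.snd_sub]; push_cast; ring
      have h3 := hb _ h2
      rwa [add_sub_cancel] at h3
    have hfin1 : volume (Q k ∩ gapSet P lam) ≠ ⊤ :=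
      ((measure_mono Set.inter_subset_left).trans_lt (hQfin k).lt_top).ne
    have hfin2 : volume (Q k \ Q') ≠ ⊤ :=
      ((measure_mono Set.sdiff_subset).trans_lt (hQfin k).lt_top).ne
    refine (measureReal_mono hsub (measure_union_lt_top hfin1.lt_top hfin2.lt_top).ne).trans
      ((measureReal_union_le _ _).trans (add_le_add ?_ ?_))
    · refine hP.volume_inter_gapSet_le (c := c) fun x hx => ?_
      have hLl : (0 : ℝ) ≤ L - lam := by linarith
      have h1 := hsmall (toReal (fun i => ⌊x i⌋) - x) p (L - lam) (fun i => by
        simp only [Pi.sub_apply, toReal]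
        rw [abs_le]
        constructor <;> linarith [Int.floor_le (x i), Int.lt_floor_add_one (x i)]) hpP hLl
        (by linarith)
      have h2 := add_mem (add_mem hx h1) (hpC _ hLl)
      convert h2 using 1
      rw [toReal_add]
      ext1
      · simp only [Prod.fst_add]; abel
      · simp only [Prod.snd_add]; push_cast; ring
    · rw [measureReal_sdiff hQ'Q hQ'meas (hQfin k), hQ'vol]
      refine le_of_eq ?_
      congr 1
      exact hP.volume_slice (by positivity)
  have hNlim := hP.tendsto_ncard_slice
  have h1 := ((tendsto_shift_div_pow m hNlim).2).mul_const φ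
  have h2 := (((tendsto_shift_div_pow (L + m) hNlim).1).mul_const φ).add
    (((tendsto_add_pow_div_pow n lam).mul_const V).sub
      ((tendsto_add_pow_div_pow n (-(l + m))).mul_const V))
  rw [sub_self, add_zero] at h2
  refine tendsto_of_tendsto_of_tendsto_of_le_of_le' h1 h2 ?_ ?_
  · filter_upwards [eventually_ge_atTop m] with k hk
    rw [div_mul_eq_mul_div]
    gcongr
    exact hlower k hk
  · filter_upwards [eventually_ge_atTop (l + m)] with k hk
    rw [div_mul_eq_mul_div, div_mul_eq_mul_div, div_mul_eq_mul_div, ← sub_div, ← add_div]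
    gcongr
    exact hupper k hk

/-- A large dilate of `P` meets every class of `ℝⁿ` modulo `ℤⁿ`. -/
theorem gapSet_eq_empty {lam : ℝ} (hlam : (hP.finite.toFinset.card : ℝ) ≤ lam) :
    gapSet P lam = ∅ := by
  rw [Set.eq_empty_iff_forall_notMem]
  intro x hx
  obtain ⟨a, ha⟩ := hP.nonempty
  have hlam0 : 0 ≤ lam := (Nat.cast_nonneg _).trans hlam
  have hpC : ((lam • toReal a, lam) : (Fin n → ℝ) × ℝ) ∈ coneOver P :=
    (hP.mem_coneOver_iff _ _).2 ⟨hlam0, _, ha, rfl⟩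
  obtain ⟨c, m, hcm⟩ := hP.exists_forall_add_mem_coneOver ⌈‖x - lam • toReal a‖⌉₊
  have h1 := add_mem (hcm (x - lam • toReal a) fun i =>
    (norm_le_pi_norm (x - lam • toReal a) i).trans (Nat.le_ceil _)) hpC
  have h2 : ((toReal c + x, (m : ℝ) + lam) : (Fin n → ℝ) × ℝ) ∈ coneOver P := by
    convert h1 using 1
    ext1
    · simp only [Prod.fst_add]; abel
    · simp
  obtain ⟨g, -, hg⟩ := hP.exists_sub_mem_coneOver m h2 (by linarith)
  refine hx (g - c) ?_
  convert hg using 2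
  · rw [toReal_sub]; abel
  · ring

theorem phi_eq_zero {lam : ℝ} (hlam : (hP.finite.toFinset.card : ℝ) ≤ lam) : phi P 0 lam = 0 := by
  rw [phi_eq, hP.gapSet_eq_empty hlam, Set.inter_empty, measureReal_empty]

theorem hasCompactSupport_phi : HasCompactSupport ((Set.Ici (0 : ℝ)).domRestrict (phi P 0)) := by
  refine HasCompactSupport.intro (K := Subtype.val ⁻¹' Set.Icc (0 : ℝ) hP.finite.toFinset.card) ?_ ?_
  · exact isClosed_Ici.isClosedEmbedding_subtypeVal.isCompact_preimage isCompact_Icc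
  · rintro ⟨x, hx⟩ hx'
    refine hP.phi_eq_zero ?_
    by_contra! hcon
    exact hx' ⟨hx, hcon.le⟩

/-- At almost every point `x` of the unit cell the indicator function of `gapSet P lam` is
continuous in `lam` at `lam₀`, since the boundaries of the translates of `lam₀ • P` are null sets.
The hypothesis on `n` makes the slice at height `0`, a single point, have empty interior. -/
theorem continuousOn_phi (hn : 1 ≤ n) : ContinuousOn (phi P 0) (Set.Ici 0) := by
  intro lam₀ hlam₀
  rw [Set.mem_Ici] at hlam₀
  have hphi : ∀ lam, phi P 0 lam = ∫ x in unitCell 0, (gapSet P lam).indicator 1 x := by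
    intro lam
    rw [phi_eq, integral_indicator_one (hP.measurableSet_gapSet lam), Set.inter_comm,
      measureReal_restrict_apply (hP.measurableSet_gapSet lam)]
  have hfin : IsFiniteMeasure (volume.restrict (unitCell (0 : Fin n → ℤ))) := by
    refine ⟨?_⟩
    rw [Measure.restrict_apply_univ, unitCell_eq_Icc]
    exact isCompact_Icc.measure_lt_top
  have hbdry : ∀ᵐ x : Fin n → ℝ, ∀ u : Fin n → ℤ,
      x - toReal u ∉ frontier {y | (y, lam₀) ∈ coneOver P} := by
    rw [ae_all_iff]
    intro u
    rw [ae_iff]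
    simp only [not_not]
    have h1 : Convex ℝ {y | (y, lam₀) ∈ coneOver P} := by
      rw [hP.slice_eq hlam₀]
      exact hP.convex.smul lam₀
    have h2 := measure_preimage_add_right volume (-toReal u) (frontier {y | (y, lam₀) ∈ coneOver P})
    rw [h1.addHaar_frontier volume] at h2
    simp only [← sub_eq_add_neg] at h2
    exact h2
  simp_rw [funext hphi]
  refine continuousWithinAt_of_dominated (bound := fun _ => 1) ?_ ?_ (integrable_const 1) ?_
  · exact Eventually.of_forall fun lam =>
      (measurable_one.indicator (hP.measurableSet_gapSet lam)).aestronglyMeasurable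
  · refine Eventually.of_forall fun lam => Eventually.of_forall fun x => ?_
    by_cases hx : x ∈ gapSet P lam <;> simp [hx]
  · refine ae_restrict_of_ae ?_
    filter_upwards [hbdry] with x hx
    by_cases hxg : x ∈ gapSet P lam₀
    · -- only finitely many translates of the cone come near `x`, and each is closed
      obtain ⟨R, hR⟩ := (hP.isBounded_coneOver (lam₀ + 1)).subset_closedBall 0
      have hF : {u : Fin n → ℤ | ∀ i, |x i - u i| ≤ R}.Finite := by
        refine (Set.finite_Icc (fun i => ⌊x i - R⌋) (fun i => ⌈x i + R⌉)).subset fun u hu => ?_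
        refine ⟨fun i => ?_, fun i => ?_⟩
        · have := abs_le.1 (hu i)
          exact Int.floor_le_iff.2 (by linarith)
        · have := abs_le.1 (hu i)
          exact Int.le_ceil_iff.2 (by linarith)
      have h1 : ∀ᶠ lam in 𝓝 lam₀, ∀ u ∈ {u : Fin n → ℤ | ∀ i, |x i - u i| ≤ R},
          (x - toReal u, lam) ∉ coneOver P := by
        rw [eventually_all_finite hF]
        intro u _
        have hc : Continuous fun lam : ℝ => ((x - toReal u, lam) : (Fin n → ℝ) × ℝ) := by fun_prop
        exact (hP.isClosed_coneOver.isOpen_compl.preimage hc).mem_nhds (hxg u)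
      have h2 : ∀ᶠ lam in 𝓝 lam₀, x ∈ gapSet P lam := by
        filter_upwards [h1, Iic_mem_nhds (lt_add_one lam₀)] with lam hl1 hl2 u hu
        refine hl1 u (fun i => ?_) hu
        have h3 := hR ⟨hu, hl2⟩
        rw [mem_closedBall_zero_iff, Prod.norm_def, max_le_iff] at h3
        exact (norm_le_pi_norm (x - toReal u) i).trans h3.1
      refine (continuousAt_const (y := (1 : ℝ))).congr ?_ |>.continuousWithinAt
      filter_upwards [h2] with lam hl
      simp [hl]
    · have h0 : ∃ u, (x - toReal u, lam₀) ∈ coneOver P := by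
        simpa [gapSet] using hxg
      obtain ⟨u, hu⟩ := h0
      have hint : x - toReal u ∈ interior {y | (y, lam₀) ∈ coneOver P} := by
        by_contra hcon
        exact hx u ⟨subset_closure hu, hcon⟩
      -- for `lam₀ = 0` the slice is a point, which has empty interior
      have hpos : 0 < lam₀ := by
        refine hlam₀.lt_of_ne fun h => ?_
        have h1 : {y | (y, lam₀) ∈ coneOver P} ⊆ {0} := by
          intro y hy
          obtain ⟨-, q, -, hq⟩ := (hP.mem_coneOver_iff _ _).1 hy
          rw [← h] at hq
          simpa using hq.symm
        have : Nonempty (Fin n) := ⟨⟨0, hn⟩⟩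
        have h2 := interior_mono h1 hint
        rw [interior_singleton] at h2
        exact h2
      have h1 : Tendsto (fun lam : ℝ => (lam₀ / lam) • (x - toReal u)) (𝓝 lam₀)
          (𝓝 ((lam₀ / lam₀) • (x - toReal u))) :=
        ((continuousAt_const.div continuousAt_id hpos.ne').smul continuousAt_const)
      rw [div_self hpos.ne', one_smul] at h1
      have h2 : ∀ᶠ lam in 𝓝 lam₀, x ∉ gapSet P lam := by
        filter_upwards [h1 (isOpen_interior.mem_nhds hint), Ioi_mem_nhds hpos] with lam hl hl0 hxl
        have hl0' : 0 < lam := hl0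
        have h4 : ((lam₀ / lam) • (x - toReal u), lam₀) ∈ coneOver P :=
          interior_subset (s := {y | (y, lam₀) ∈ coneOver P}) hl
        have h3 := smul_mem_cone h4 (div_pos hl0' hpos).le
        refine hxl u ?_
        convert h3 using 1
        rw [Prod.smul_mk, smul_smul, smul_eq_mul]
        ext1
        · have : lam / lam₀ * (lam₀ / lam) = 1 := by field_simp
          simp [this]
        · simp [div_mul_cancel₀ _ hpos.ne']
      refine (continuousAt_const (y := (0 : ℝ))).congr ?_ |>.continuousWithinAt
      filter_upwards [h2] with lam hl
      simp [hl]

end IsSpanningPolytope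

end Toric

/-! ### The volume of the region of a Hilbert-Kunz multiplicity -/

namespace Toric

/-- Cavalieri's principle: a volume is the integral of the volumes of the horizontal slices. -/
theorem volume_eq_integral_slice {n : ℕ} {B : Set ((Fin n → ℝ) × ℝ)} (hB : MeasurableSet B)
    (hfin : volume B ≠ ⊤) : volume.real B = ∫ z : ℝ, volume.real {x | (x, z) ∈ B} := by
  rw [Measure.volume_eq_prod] at hfin
  have h := Measure.prod_apply_symm (μ := (volume : Measure (Fin n → ℝ)))
    (ν := (volume : Measure ℝ)) hB
  have hm : Measurable fun z : ℝ => volume ((fun x : Fin n → ℝ => (x, z)) ⁻¹' B) :=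
    measurable_measure_prodMk_right hB
  rw [Measure.real, Measure.volume_eq_prod, h]
  rw [h] at hfin
  exact (integral_toReal hm.aemeasurable (ae_lt_top hm hfin)).symm

namespace IsSpanningPolytope

variable {n : ℕ} {P : Set (Fin n → ℝ)} (hP : IsSpanningPolytope P)
include hP

theorem volume_cone_lt (k : ℕ) : volume.real {x : (Fin n → ℝ) × ℝ | x ∈ coneOver P ∧ x.2 < k} =
    (k : ℝ) ^ (n + 1) * volume.real P / (n + 1) := by
  rw [volume_eq_integral_slice]
  · have h : (fun z : ℝ => volume.real {x | (x, z) ∈ {x : (Fin n → ℝ) × ℝ | x ∈ coneOver P ∧ x.2 < k}}) =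
        (Set.Ico (0 : ℝ) k).indicator fun z => z ^ n * volume.real P := by
      ext z
      by_cases hz : z ∈ Set.Ico (0 : ℝ) k
      · rw [Set.indicator_of_mem hz, ← hP.volume_slice hz.1]
        congr 1
        ext x
        exact and_iff_left hz.2
      · rw [Set.indicator_of_notMem hz]
        have : {x | (x, z) ∈ {x : (Fin n → ℝ) × ℝ | x ∈ coneOver P ∧ x.2 < k}} = ∅ := by
          rw [Set.eq_empty_iff_forall_notMem]
          rintro x ⟨hx1, hx2⟩
          exact hz ⟨((hP.mem_coneOver_iff _ _).1 hx1).1, hx2⟩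
        rw [this, measureReal_empty]
    rw [h, integral_indicator measurableSet_Ico, integral_Ico_eq_integral_Ioc,
      ← intervalIntegral.integral_of_le (Nat.cast_nonneg k), intervalIntegral.integral_mul_const,
      integral_pow]
    simp
    ring
  · exact hP.isClosed_coneOver.measurableSet.inter (measurableSet_lt measurable_snd measurable_const)
  · exact ((hP.isBounded_coneOver k).subset fun x hx => ⟨hx.1, hx.2.le⟩).measure_lt_top.ne

theorem volume_hilbertKunzRegion_lt_top (k : ℕ) : volume (hilbertKunzRegion P k) < ⊤ :=
  ((hP.isBounded_coneOver (k + hP.finite.toFinset.card)).subset fun _ hx =>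
    ⟨hx.1, (hP.lt_of_mem_hilbertKunzRegion hx).le⟩).measure_lt_top

/-- The part of the region below height `k` is the whole of the truncated cone. -/
theorem volume_hilbertKunzRegion (k : ℕ) : volume.real (hilbertKunzRegion P k) =
    (k : ℝ) ^ (n + 1) * volume.real P / (n + 1) +
      ∫ lam in Set.Ioi (0 : ℝ), volume.real {x | (x, (k : ℝ) + lam) ∈ hilbertKunzRegion P k} := by
  have hm := hP.measurableSet_hilbertKunzRegion k
  have hfin := hP.volume_hilbertKunzRegion_lt_top k
  have hlt : MeasurableSet {x : (Fin n → ℝ) × ℝ | x.2 < k} :=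
    measurableSet_lt measurable_snd measurable_const
  rw [← measureReal_inter_add_sdiff hlt hfin.ne, ← hP.volume_cone_lt]
  congr 1
  · congr 1
    ext x
    refine ⟨fun h => ⟨h.1.1, h.2⟩, fun h => ⟨⟨h.1, fun g _ hg => ?_⟩, h.2⟩⟩
    have h1 := ((hP.mem_coneOver_iff _ _).1 hg).1
    have h2 : x.2 < k := h.2
    simp [latticeEmb] at h1
    linarith
  · rw [volume_eq_integral_slice (hm.diff hlt) ((measure_mono Set.sdiff_subset).trans_lt hfin).ne,
      ← integral_add_left_eq_self _ (k : ℝ), ← integral_Ici_eq_integral_Ioi,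
      ← integral_indicator measurableSet_Ici]
    congr 1
    ext lam
    by_cases hl : lam ∈ Set.Ici (0 : ℝ)
    · rw [Set.indicator_of_mem hl]
      congr 1
      ext x
      refine and_iff_left ?_
      have : 0 ≤ lam := hl
      simpa using this
    · rw [Set.indicator_of_notMem hl]
      have : {x | (x, (k : ℝ) + lam) ∈ hilbertKunzRegion P k \ {x : (Fin n → ℝ) × ℝ | x.2 < k}} = ∅ := by
        rw [Set.eq_empty_iff_forall_notMem]
        rintro x ⟨-, hx⟩
        apply hx
        have : lam < 0 := not_le.1 hl
        simpa using this
      rw [this, measureReal_empty]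

/-- Dominated convergence: the slices above height `k` vanish beyond a height independent of `k`
and are bounded by the slices of the cone. -/
theorem tendsto_volume_hilbertKunzRegion : Tendsto (fun k : ℕ =>
    (volume.real (hilbertKunzRegion P k) - (k : ℝ) ^ (n + 1) * volume.real P / (n + 1)) / (k : ℝ) ^ n)
    atTop (𝓝 (volume.real P * ∫ lam in Set.Ioi (0 : ℝ), phi P 0 lam)) := by
  set c := hP.finite.toFinset.card with hc
  simp_rw [hP.volume_hilbertKunzRegion, add_sub_cancel_left, ← integral_div, ← integral_const_mul]
  refine tendsto_integral_filter_of_dominated_convergence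
    ((Set.Iio (c : ℝ)).indicator fun _ => (1 + (c : ℝ)) ^ n * volume.real P) ?_ ?_ ?_ ?_
  · refine Eventually.of_forall fun k => (Measurable.div_const ?_ _).aestronglyMeasurable
    exact ((measurable_measure_prodMk_right (hP.measurableSet_hilbertKunzRegion k)).comp
      (measurable_const_add (k : ℝ))).ennreal_toReal
  · filter_upwards [eventually_ge_atTop 1] with k hk
    rw [ae_restrict_iff' measurableSet_Ioi]
    refine Eventually.of_forall fun lam hlam => ?_
    have hlam0 : 0 < lam := hlam
    have hk1 : (1 : ℝ) ≤ k := by exact_mod_cast hk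
    rw [Real.norm_of_nonneg (by positivity)]
    by_cases hl : lam < c
    · rw [Set.indicator_of_mem (show lam ∈ Set.Iio (c : ℝ) from hl), div_le_iff₀ (by positivity)]
      have h1 : volume.real {x | (x, (k : ℝ) + lam) ∈ hilbertKunzRegion P k} ≤
          ((k : ℝ) + lam) ^ n * volume.real P := by
        rw [← hP.volume_slice (by positivity)]
        exact measureReal_mono (fun x hx => hx.1) (hP.volume_slice_lt_top _).ne
      refine h1.trans ?_
      rw [mul_right_comm, ← mul_pow]
      gcongr
      nlinarith
    · rw [Set.indicator_of_notMem (show lam ∉ Set.Iio (c : ℝ) from hl)]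
      have : {x | (x, (k : ℝ) + lam) ∈ hilbertKunzRegion P k} = ∅ := by
        rw [Set.eq_empty_iff_forall_notMem]
        intro x hx
        have h1 := hP.lt_of_mem_hilbertKunzRegion hx
        simp only at h1
        linarith
      rw [this]
      simp
  · rw [integrable_indicator_iff measurableSet_Iio, IntegrableOn, Measure.restrict_restrict
      measurableSet_Iio]
    refine integrableOn_const ?_ 
    rw [Set.Iio_inter_Ioi]
    simp
  · rw [ae_restrict_iff' measurableSet_Ioi]
    exact Eventually.of_forall fun lam hlam => hP.tendsto_volume_slice (le_of_lt hlam)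

end IsSpanningPolytope

end Toric

/-! ### The dimension of an affine semigroup ring -/

/-- Distinct comparable primes have distinct contractions along an integral extension, so an
integral extension cannot have larger dimension. -/
theorem ringKrullDim_le_of_isIntegral {A B : Type*} [CommRing A] [CommRing B] (f : A →+* B)
    (hf : f.IsIntegral) : ringKrullDim B ≤ ringKrullDim A := by
  algebraize [f]
  refine Order.krullDim_le_of_strictMono (PrimeSpectrum.comap (algebraMap A B)) fun I J h => ?_
  exact Ideal.IsIntegral.comap_lt_comap (R := A) (I := I.asIdeal) (J := J.asIdeal) h

namespace AddMonoidAlgebra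

/-- The group algebra of a lattice is algebraic over the subalgebra of the monomials that generate
the lattice as a group, since inverses of algebraic elements are algebraic. -/
theorem isAlgebraic_adjoin_of'_image {K : Type u} [Field K] {d : ℕ} (T : Set (Fin d → ℤ))
    (hT : AddSubgroup.closure T = ⊤) :
    Algebra.IsAlgebraic (Algebra.adjoin K (AddMonoidAlgebra.of' K (Fin d → ℤ) '' T))
      (AddMonoidAlgebra K (Fin d → ℤ)) := by
  set B := Algebra.adjoin K (AddMonoidAlgebra.of' K (Fin d → ℤ) '' T)
  have hne : ∀ g : Fin d → ℤ, (single g 1 : AddMonoidAlgebra K (Fin d → ℤ)) ≠ 0 := fun g => by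
    simp
  have hmon : ∀ g : Fin d → ℤ, IsAlgebraic B (single g 1 : AddMonoidAlgebra K (Fin d → ℤ)) := by
    intro g
    have hg : g ∈ AddSubgroup.closure T := hT ▸ AddSubgroup.mem_top g
    induction hg using AddSubgroup.closure_induction with
    | mem x hx =>
      exact isAlgebraic_algebraMap (⟨_, Algebra.subset_adjoin ⟨x, hx, rfl⟩⟩ : B)
    | zero => exact isAlgebraic_one
    | add x y _ _ hx hy =>
      have := hx.mul hy
      rwa [single_mul_single, one_mul] at this
    | neg x _ hx =>
      refine IsAlgebraic.of_mul (mem_nonZeroDivisors_of_ne_zero (hne x)) hx ?_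
      rw [single_mul_single, add_neg_cancel, one_mul]
      exact isAlgebraic_one
  refine ⟨fun x => ?_⟩
  induction x using AddMonoidAlgebra.induction_linear with
  | zero => exact isAlgebraic_zero
  | add x y hx hy => exact hx.add hy
  | single g r =>
    have h1 : IsAlgebraic B (single 0 r : AddMonoidAlgebra K (Fin d → ℤ)) :=
      isAlgebraic_algebraMap (R := B) (algebraMap K B r)
    have := h1.mul (hmon g)
    rwa [single_mul_single, zero_add, mul_one] at this

theorem trdeg_pi_int_le {K : Type u} [Field K] (d : ℕ) :
    Algebra.trdeg K (AddMonoidAlgebra K (Fin d → ℤ)) ≤ d := by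
  have hT : AddSubgroup.closure (Set.range fun i : Fin d => (Pi.single i 1 : Fin d → ℤ)) = ⊤ := by
    rw [eq_top_iff]
    intro x _
    rw [← Finset.univ_sum_single x]
    refine sum_mem fun i _ => ?_
    have : Pi.single i (x i) = x i • (Pi.single i 1 : Fin d → ℤ) := by
      rw [← Pi.single_smul]; simp
    rw [this]
    exact AddSubgroup.zsmul_mem _ (AddSubgroup.subset_closure (Set.mem_range_self i)) _
  have := isAlgebraic_adjoin_of'_image (K := K) _ hT
  refine (Algebra.IsAlgebraic.trdeg_le_cardinalMk K (AddMonoidAlgebra.of' K (Fin d → ℤ) ''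
    Set.range fun i : Fin d => (Pi.single i 1 : Fin d → ℤ))).trans ?_
  rw [← Set.range_comp]
  have h2 := Cardinal.mk_range_le_lift (f := AddMonoidAlgebra.of' K (Fin d → ℤ) ∘
    fun i : Fin d => (Pi.single i 1 : Fin d → ℤ))
  simpa using h2

variable {K : Type u} [Field K] {G : Type} [AddCommMonoid G] {d : ℕ} (ι : G →+ (Fin d → ℤ))

/-- By Noether normalization the ring is integral over a polynomial ring, the number of variables
of which is bounded by the transcendence degree of the group algebra of the lattice. -/
theorem ringKrullDim_le_of_injective [AddMonoid.FG G] (hι : Function.Injective ι) :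
    ringKrullDim (AddMonoidAlgebra K G) ≤ d := by
  obtain ⟨s, g, hg, hint⟩ := exists_integral_inj_algHom_of_fg K (AddMonoidAlgebra K G)
  have h1 := ringKrullDim_le_of_isIntegral _ hint
  rw [MvPolynomial.ringKrullDim_of_isNoetherianRing, ringKrullDim_eq_zero_of_field, zero_add,
    Nat.card_fin] at h1
  refine h1.trans ?_
  have h2 : AlgebraicIndependent K fun i : Fin s =>
      mapDomainAlgHom K K ι (g (MvPolynomial.X i)) := by
    have h3 : (MvPolynomial.aeval fun i : Fin s => mapDomainAlgHom K K ι (g (MvPolynomial.X i))) =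
        (mapDomainAlgHom K K ι).comp g := by
      ext i; simp
    rw [AlgebraicIndependent, h3]
    exact (AddMonoidAlgebra.mapDomain_injective hι).comp hg
  have h4 := h2.lift_cardinalMk_le_trdeg.trans (Cardinal.lift_le.2 (trdeg_pi_int_le d))
  have h5 : s ≤ d := by simpa using h4
  exact_mod_cast h5

/-- Projecting the lattice along its first coordinates yields a chain of primes in the semigroup
ring, which is strict as the semigroup generates the lattice. -/
theorem le_ringKrullDim_of_forall_exists (hι : ∀ w, ∃ s t, ι s = ι t + w) :
    (d : WithBot ℕ∞) ≤ ringKrullDim (AddMonoidAlgebra K G) := by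
  classical
  -- `π i` kills the first `i` coordinates
  let π : ℕ → (Fin d → ℤ) →+ (Fin d → ℤ) := fun i =>
    { toFun := fun v j => if (j : ℕ) < i then 0 else v j
      map_zero' := by ext j; simp
      map_add' := fun v w => by ext j; by_cases h : (j : ℕ) < i <;> simp [h] }
  have hπ : ∀ i, (π (i + 1)).comp (π i) = π (i + 1) := by
    intro i
    ext v j
    change (if (j : ℕ) < i + 1 then 0 else if (j : ℕ) < i then 0 else _) =
      if (j : ℕ) < i + 1 then 0 else _
    by_cases h : (j : ℕ) < i + 1
    · simp [h]
    · rw [if_neg h, if_neg (by omega), if_neg h]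
  let f : ℕ → AddMonoidAlgebra K G →ₐ[K] AddMonoidAlgebra K (Fin d → ℤ) := fun i =>
    mapDomainAlgHom K K ((π i).comp ι)
  have hf : ∀ i, f (i + 1) = (mapDomainAlgHom K K (π (i + 1))).comp (f i) := by
    intro i
    rw [← mapDomainAlgHom_comp, ← AddMonoidHom.comp_assoc, hπ]
  let c : LTSeries (PrimeSpectrum (AddMonoidAlgebra K G)) := LTSeries.mk d
    (fun i => ⟨RingHom.ker (f i), RingHom.ker_isPrime _⟩) <| by
      rw [Fin.strictMono_iff_lt_succ]
      intro i
      refine lt_of_le_not_ge (fun x hx => ?_) fun hle => ?_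
      · have hx' : f i x = 0 := hx
        change f (i + 1) x = 0
        rw [hf, AlgHom.comp_apply, hx', map_zero]
      · obtain ⟨s, t, hst⟩ := hι (Pi.single i 1)
        have h1 : single s 1 - single t 1 ∈ RingHom.ker (f (i + 1)) := by
          rw [RingHom.mem_ker, map_sub, sub_eq_zero]
          have : π (i + 1) (ι s) = π (i + 1) (ι t) := by
            rw [hst]
            ext j
            change (if (j : ℕ) < i + 1 then 0 else _) = if (j : ℕ) < i + 1 then 0 else _
            by_cases h : (j : ℕ) < i + 1
            · simp [h]
            · have : j ≠ i := fun h' => h (h' ▸ Nat.lt_succ_self _)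
              simp [h, this]
          simp [f, this]
        have h2 := hle h1
        have h3 : f i (single s 1 - single t 1) = 0 := h2
        rw [map_sub, sub_eq_zero] at h3
        have h4 : π i (ι s) = π i (ι t) := by
          have h5 : (single (π i (ι s)) 1 : AddMonoidAlgebra K (Fin d → ℤ)) =
              single (π i (ι t)) 1 := by simpa [f] using h3
          exact of_injective h5
        have h5 := congrFun h4 i
        rw [hst] at h5
        simp [π] at h5
  exact Order.LTSeries.length_le_krullDim c

/-- The dimension of the ring of an affine semigroup is the rank of the lattice it generates. -/
theorem ringKrullDim_eq_of_forall_exists [AddMonoid.FG G] (hι : Function.Injective ι)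
    (hι' : ∀ w, ∃ s t, ι s = ι t + w) : ringKrullDim (AddMonoidAlgebra K G) = d :=
  le_antisymm (ringKrullDim_le_of_injective ι hι) (le_ringKrullDim_of_forall_exists ι hι')

end AddMonoidAlgebra

namespace Toric

theorem fg_coneSemigroup {n : ℕ} {P : Set (Fin n → ℝ)} (hP : (latticePoints P).Finite) :
    AddMonoid.FG (coneSemigroup P) := by
  rw [AddMonoid.fg_iff_addSubmonoid_fg]
  refine ⟨(hP.image fun u => (u, (1 : ℤ))).toFinset, ?_⟩
  rw [Set.Finite.coe_toFinset]
  rfl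

theorem IsSpanningPolytope.krullDim_coordinateRing (K : Type u) [Field K] {n : ℕ}
    {P : Set (Fin n → ℝ)} (hP : IsSpanningPolytope P) : krullDim (coordinateRing K P) = n + 1 := by
  let e : (Fin n → ℤ) × ℤ →+ (Fin (n + 1) → ℤ) :=
    { toFun := fun x => Fin.cons x.2 x.1
      map_zero' := by ext j; refine Fin.cases ?_ (fun i => ?_) j <;> simp
      map_add' := fun x y => by ext j; refine Fin.cases ?_ (fun i => ?_) j <;> simp }
  have he : Function.Injective e := fun x y h => by
    have h' : (Fin.cons x.2 x.1 : Fin (n + 1) → ℤ) = Fin.cons y.2 y.1 := h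
    rw [Fin.cons_inj] at h'
    exact Prod.ext h'.2 h'.1
  have hfg := fg_coneSemigroup hP.finite
  have h : ringKrullDim (coordinateRing K P) = ((n + 1 : ℕ) : WithBot ℕ∞) := by
    refine AddMonoidAlgebra.ringKrullDim_eq_of_forall_exists (d := n + 1)
      (e.comp (coneSemigroup P).subtype) (he.comp Subtype.val_injective) fun w => ?_
    obtain ⟨s, hs, hsw⟩ := hP.exists_add_mem_coneSemigroup (Fin.tail w, w 0)
    refine ⟨⟨_, hsw⟩, ⟨s, hs⟩, ?_⟩
    change e (s + _) = e s + w
    rw [map_add]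
    congr 1
    exact Fin.cons_self_tail w
  rw [krullDim, h]
  rfl

end Toric

/-! ### Colengths of monomial ideals -/

/-- Adjoining to an ideal an element whose annihilator in the quotient is maximal lowers the
colength by one. -/
theorem Ideal.length_quotient_eq_add_one {R : Type*} [CommRing R] (I m : Ideal R) [m.IsMaximal]
    {x : R} (hx : x ∉ I) (hm : ∀ y ∈ m, y * x ∈ I) :
    Module.length R (R ⧸ I) = Module.length R (R ⧸ (I ⊔ Ideal.span {x})) + 1 := by
  let f : (R ⧸ m) →ₗ[R] R ⧸ I := Submodule.liftQ m
    ((Submodule.mkQ I).comp (LinearMap.toSpanSingleton R R x)) fun y hy => by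
      rw [LinearMap.mem_ker, LinearMap.comp_apply, Submodule.mkQ_apply, Submodule.Quotient.mk_eq_zero]
      exact hm y hy
  have hf : ∀ c : R, f (Submodule.Quotient.mk c) = Submodule.Quotient.mk (c * x) := fun _ => rfl
  have hsimple : IsSimpleModule R (R ⧸ m) := (isSimpleModule_iff_isCoatom).2 Ideal.IsMaximal.out
  have hinj : Function.Injective f := by
    refine f.injective_or_eq_zero.resolve_right fun h => hx ?_
    have h1 := hf 1
    rw [h, LinearMap.zero_apply, one_mul] at h1
    exact (Submodule.Quotient.mk_eq_zero I).1 h1.symm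
  have hle : I ≤ I ⊔ Ideal.span {x} := le_sup_left
  have hexact : Function.Exact f (Submodule.factor hle) := by
    intro z
    obtain ⟨z, rfl⟩ := Submodule.Quotient.mk_surjective _ z
    rw [← Submodule.mkQ_apply, Submodule.factor_mk, Submodule.mkQ_apply,
      Submodule.Quotient.mk_eq_zero]
    constructor
    · intro hz
      obtain ⟨a, ha, b, hb, rfl⟩ := Submodule.mem_sup.1 hz
      obtain ⟨c, rfl⟩ := Ideal.mem_span_singleton'.1 hb
      refine ⟨Submodule.Quotient.mk c, ?_⟩
      rw [hf, Submodule.mkQ_apply, Submodule.Quotient.eq]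
      simpa using I.neg_mem ha
    · rintro ⟨c, hc⟩
      obtain ⟨c, rfl⟩ := Submodule.Quotient.mk_surjective _ c
      rw [hf, Submodule.mkQ_apply, Submodule.Quotient.eq] at hc
      have h1 : z = c * x - (c * x - z) := by ring
      rw [h1]
      exact Ideal.sub_mem _ (Ideal.mem_sup_right (Ideal.mem_span_singleton'.2 ⟨c, rfl⟩))
        (Ideal.mem_sup_left hc)
  rw [Module.length_eq_add_of_exact f (Submodule.factor hle) hinj
    (Submodule.factor_surjective hle) hexact, Module.length_eq_one, add_comm]

namespace AddMonoidAlgebra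

variable {K : Type u} [Field K] {G : Type} [AddCommMonoid G]

/-- The ideal of a monoid algebra generated by the monomials with exponents in `J`. -/
noncomputable def monomialIdeal (K : Type u) [Field K] {G : Type} [AddCommMonoid G] (J : Set G) :
    Ideal (AddMonoidAlgebra K G) :=
  Ideal.span (of' K G '' J)

theorem mem_monomialIdeal_iff {J : Set G} {x : AddMonoidAlgebra K G} :
    x ∈ monomialIdeal K J ↔ ∀ s ∈ x.coeff.support, ∃ j ∈ J, ∃ g, s = g + j :=
  mem_ideal_span_of'_image

theorem single_mem_monomialIdeal_iff {J : Set G} {s : G} :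
    single s 1 ∈ monomialIdeal K J ↔ ∃ j ∈ J, ∃ g, s = g + j := by
  classical
  simp [mem_monomialIdeal_iff]

theorem monomialIdeal_eq_top {J : Set G} (h : (0 : G) ∈ J) : monomialIdeal K J = ⊤ :=
  (Ideal.eq_top_iff_one _).2 (Ideal.subset_span ⟨0, h, rfl⟩)

theorem monomialIdeal_mul (J J' : Set G) :
    monomialIdeal K J * monomialIdeal K J' = monomialIdeal K (J + J') := by
  rw [monomialIdeal, monomialIdeal, Ideal.span_mul_span', monomialIdeal]
  congr 1
  ext x
  simp only [Set.mem_mul, Set.mem_image, Set.mem_add]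
  constructor
  · rintro ⟨_, ⟨a, ha, rfl⟩, _, ⟨b, hb, rfl⟩, rfl⟩
    exact ⟨a + b, ⟨a, ha, b, hb, rfl⟩, by simp [of'_apply, single_mul_single]⟩
  · rintro ⟨_, ⟨a, ha, b, hb, rfl⟩, rfl⟩
    exact ⟨_, ⟨a, ha, rfl⟩, _, ⟨b, hb, rfl⟩, by simp [of'_apply, single_mul_single]⟩

/-- In a monoid algebra graded by a positive degree function, the colength of a monomial ideal is
the number of monomials which it does not contain. -/
theorem length_quotient_monomialIdeal (deg : G →+ ℤ) (hdeg : ∀ g, g ≠ 0 → 0 < deg g) (J : Set G)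
    (hJ : {s | ∀ j ∈ J, ∀ g, s ≠ g + j}.Finite) :
    Module.length (AddMonoidAlgebra K G) (AddMonoidAlgebra K G ⧸ monomialIdeal K J) =
      {s | ∀ j ∈ J, ∀ g, s ≠ g + j}.ncard := by
  classical
  -- the augmentation, whose kernel is spanned by the monomials of positive degree
  let χ : Multiplicative G →* K :=
    { toFun := fun g => if g.toAdd = 0 then 1 else 0
      map_one' := by simp
      map_mul' := fun a b => by
        by_cases ha : a.toAdd = 0
        · simp [ha]
        · have h1 : a.toAdd + b.toAdd ≠ 0 := by
            intro h
            have h2 := congrArg deg h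
            rw [map_add, map_zero] at h2
            have h3 := hdeg _ ha
            by_cases hb : b.toAdd = 0
            · rw [hb, map_zero] at h2; omega
            · have := hdeg _ hb; omega
          simp [ha, h1] }
  let ε : AddMonoidAlgebra K G →ₐ[K] K := lift K K G χ
  have hε : ∀ y, ε y = y.coeff 0 := by
    intro y
    induction y using AddMonoidAlgebra.induction_linear with
    | zero => simp
    | add x y hx hy => simp [hx, hy]
    | single g r =>
      rw [lift_single, coeff_single, Finsupp.single_apply]
      change r • (if g = 0 then (1 : K) else 0) = _
      simp
  have hmax : (RingHom.ker ε).IsMaximal :=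
    RingHom.ker_isMaximal_of_surjective ε fun c => ⟨algebraMap K _ c, ε.commutes c⟩
  generalize hN : {s | ∀ j ∈ J, ∀ g, s ≠ g + j}.ncard = N
  induction N generalizing J with
  | zero =>
    rw [Set.ncard_eq_zero hJ, Set.eq_empty_iff_forall_notMem] at hN
    have h0 : (1 : AddMonoidAlgebra K G) ∈ monomialIdeal K J := by
      rw [one_def, single_mem_monomialIdeal_iff]
      have := hN 0
      simpa using this
    rw [(Ideal.eq_top_iff_one _).2 h0]
    simp
  | succ N ih =>
    have hne : {s | ∀ j ∈ J, ∀ g, s ≠ g + j}.Nonempty := by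
      rw [← Set.ncard_pos hJ, hN]; omega
    -- a missing monomial of maximal degree is annihilated, modulo the ideal, by those of positive degree
    obtain ⟨s, hs, hsmax⟩ := Set.exists_max_image _ deg hJ hne
    have hset : {t | ∀ j ∈ insert s J, ∀ g, t ≠ g + j} = {t | ∀ j ∈ J, ∀ g, t ≠ g + j} \ {s} := by
      ext t
      constructor
      · intro h
        exact ⟨fun j hj => h j (Set.mem_insert_of_mem _ hj), fun hts => h s (Set.mem_insert _ _) 0
          (by rw [zero_add]; exact hts)⟩
      · rintro ⟨h1, h2⟩ j (rfl | hj) g hg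
        · by_cases hg0 : g = 0
          · rw [hg0, zero_add] at hg
            exact h2 hg
          · have h3 := hsmax t h1
            rw [hg, map_add] at h3
            have := hdeg g hg0
            omega
        · exact h1 j hj g hg
    have hcard : {t | ∀ j ∈ insert s J, ∀ g, t ≠ g + j}.ncard = N := by
      rw [hset, Set.ncard_sdiff_singleton_of_mem hs, hN, Nat.add_sub_cancel]
    have hmi : monomialIdeal K (insert s J) = monomialIdeal K J ⊔ Ideal.span {single s 1} := by
      rw [monomialIdeal, Set.image_insert_eq, Ideal.span_insert, sup_comm]
      rfl
    have h1 := ih (insert s J) (by rw [hset]; exact hJ.sdiff) hcard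
    rw [Ideal.length_quotient_eq_add_one (monomialIdeal K J) (RingHom.ker ε) (x := single s 1),
      ← hmi, h1]
    · simp
    · rw [single_mem_monomialIdeal_iff]
      push Not
      exact hs
    · intro y hy
      rw [mem_monomialIdeal_iff]
      intro t ht
      by_contra hcon
      push Not at hcon
      obtain ⟨d, hd, rfl⟩ : ∃ d ∈ y.coeff.support, d + s = t := by
        have := support_coeff_mul_single_subset _ _ _ ht
        simpa using this
      by_cases hd0 : d = 0
      · rw [hd0, Finsupp.mem_support_iff] at hd
        exact hd ((hε y).symm.trans hy)
      · have h2 := hsmax _ hcon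
        rw [map_add] at h2
        have := hdeg d hd0
        omega

/-- Frobenius takes monomials to monomials. -/
theorem map_iterateFrobenius_monomialIdeal (p : ℕ) [Fact p.Prime] [CharP (AddMonoidAlgebra K G) p]
    (J : Set G) (t : ℕ) :
    (monomialIdeal K J).map (iterateFrobenius (AddMonoidAlgebra K G) p t) =
      monomialIdeal K ((fun j => p ^ t • j) '' J) := by
  rw [monomialIdeal, Ideal.map_span, monomialIdeal, Set.image_image, Set.image_image]
  congr 1
  refine Set.image_congr fun j _ => ?_
  rw [iterateFrobenius_def, of'_apply, of'_apply, single_pow, one_pow]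

end AddMonoidAlgebra

/-! ### Multiplicities of the powers of the graded maximal ideal -/

namespace Toric

/-- The grading is standard: an element of degree at least `k` is a multiple of one of degree
`k`. -/
theorem exists_add_eq_of_le {n : ℕ} {P : Set (Fin n → ℝ)} {s : (Fin n → ℤ) × ℤ}
    (hs : s ∈ coneSemigroup P) (k : ℕ) (hk : (k : ℤ) ≤ s.2) :
    ∃ a ∈ coneSemigroup P, ∃ b ∈ coneSemigroup P, a.2 = k ∧ b + a = s := by
  induction hs using AddSubmonoid.closure_induction generalizing k with
  | mem s hs =>
    have hs' : s ∈ coneSemigroup P := AddSubmonoid.subset_closure hs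
    obtain ⟨u, hu, rfl⟩ := hs
    have hk' : (k : ℤ) ≤ 1 := hk
    obtain rfl | rfl : k = 0 ∨ k = 1 := by omega
    · exact ⟨0, zero_mem _, _, hs', rfl, add_zero _⟩
    · exact ⟨_, hs', 0, zero_mem _, rfl, zero_add _⟩
  | zero =>
    have hk' : (k : ℤ) ≤ 0 := hk
    obtain rfl : k = 0 := by omega
    exact ⟨0, zero_mem _, 0, zero_mem _, rfl, zero_add _⟩
  | add x y hx hy ihx ihy =>
    rw [Prod.snd_add] at hk
    by_cases hkx : (k : ℤ) ≤ x.2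
    · obtain ⟨a, ha, b, hb, hak, rfl⟩ := ihx k hkx
      exact ⟨a, ha, b + y, add_mem hb hy, hak, by abel⟩
    · obtain ⟨a, ha, b, hb, hak, rfl⟩ := ihy (k - x.2).toNat (by omega)
      refine ⟨x + a, add_mem hx ha, b, hb, ?_, by abel⟩
      rw [Prod.snd_add, hak]
      omega

theorem pos_of_mem_coneSemigroup {n : ℕ} {P : Set (Fin n → ℝ)} {s : (Fin n → ℤ) × ℤ}
    (hs : s ∈ coneSemigroup P) (h0 : s ≠ 0) : 0 < s.2 := by
  suffices h : s = 0 ∨ 0 < s.2 from h.resolve_left h0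
  clear h0
  induction hs using AddSubmonoid.closure_induction with
  | mem s hs =>
    obtain ⟨u, hu, rfl⟩ := hs
    exact Or.inr one_pos
  | zero => exact Or.inl rfl
  | add x y _ _ hx hy =>
    rcases hx with rfl | hx
    · rwa [zero_add]
    · rcases hy with rfl | hy
      · rw [add_zero]; exact Or.inr hx
      · exact Or.inr (add_pos hx hy)

/-- The grading of the semigroup by the last coordinate. -/
def degree {n : ℕ} (P : Set (Fin n → ℝ)) : coneSemigroup P →+ ℤ :=
  (AddMonoidHom.snd _ _).comp (coneSemigroup P).subtype

theorem degree_apply {n : ℕ} {P : Set (Fin n → ℝ)} (s : coneSemigroup P) :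
    degree P s = s.1.2 := rfl

theorem degree_pos {n : ℕ} {P : Set (Fin n → ℝ)} (s : coneSemigroup P) (hs : s ≠ 0) :
    0 < degree P s :=
  pos_of_mem_coneSemigroup s.2 fun h => hs (Subtype.ext h)

theorem degree_nonneg {n : ℕ} {P : Set (Fin n → ℝ)} (s : coneSemigroup P) : 0 ≤ degree P s := by
  by_cases hs : s = 0
  · rw [hs, map_zero]
  · exact (degree_pos s hs).le

open AddMonoidAlgebra in
/-- As the grading is standard, `𝔪ᵗ` is spanned by the monomials of degree at least `t`. -/
theorem gradedMaximalIdeal_pow (K : Type u) [Field K] {n : ℕ} (P : Set (Fin n → ℝ)) (t : ℕ) :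
    gradedMaximalIdeal K P ^ t = monomialIdeal K {s | (t : ℤ) ≤ degree P s} := by
  have h1 : gradedMaximalIdeal K P = monomialIdeal K {s | 1 ≤ degree P s} := by
    rw [gradedMaximalIdeal, monomialIdeal]
    congr 1
    ext x
    constructor
    · rintro ⟨s, hs, rfl⟩
      exact ⟨s, hs, rfl⟩
    · rintro ⟨s, hs, rfl⟩
      exact ⟨s, hs, rfl⟩
  induction t with
  | zero =>
    rw [pow_zero, Ideal.one_eq_top, monomialIdeal_eq_top]
    simp
  | succ t ih =>
    rw [pow_succ, ih, h1, monomialIdeal_mul]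
    congr 1
    ext s
    constructor
    · rintro ⟨a, ha, b, hb, rfl⟩
      have ha' : (t : ℤ) ≤ degree P a := ha
      have hb' : 1 ≤ degree P b := hb
      change ((t + 1 : ℕ) : ℤ) ≤ degree P (a + b)
      rw [map_add]
      push_cast
      omega
    · intro hs
      have hs' : ((t + 1 : ℕ) : ℤ) ≤ s.1.2 := hs
      obtain ⟨a, ha, b, hb, hat, hab⟩ := exists_add_eq_of_le s.2 1 (by push_cast at hs' ⊢; omega)
      refine ⟨⟨b, hb⟩, ?_, ⟨a, ha⟩, ?_, Subtype.ext hab⟩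
      · change (t : ℤ) ≤ b.2
        rw [← hab, Prod.snd_add, hat] at hs'
        push_cast at hs'
        omega
      · exact hat.ge

/-- As `x ↦ x^q` is a ring homomorphism, `I^[q]` is generated by its values on generators. -/
theorem frobeniusPower_eq_map {R : Type*} [CommRing R] (p : ℕ) [Fact p.Prime] [CharP R p]
    (I : Ideal R) (t : ℕ) : frobeniusPower I (p ^ t) = I.map (iterateFrobenius R p t) := rfl

namespace IsSpanningPolytope

variable {n : ℕ} {P : Set (Fin n → ℝ)} (hP : IsSpanningPolytope P)
include hP

/-- The hypothesis on `N` makes the colength finite; otherwise `colength` would take the value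
`0`. -/
theorem colength_monomialIdeal (K : Type u) [Field K] (J : Set (coneSemigroup P)) (N : ℤ)
    (hJ : ∀ s : coneSemigroup P, N ≤ degree P s → ∃ j ∈ J, ∃ g, s = g + j) :
    colength (AddMonoidAlgebra.monomialIdeal K J) =
      ((Subtype.val '' {s : coneSemigroup P | ∀ j ∈ J, ∀ g, s ≠ g + j}).ncard : ℝ) := by
  have hfin : {s : coneSemigroup P | ∀ j ∈ J, ∀ g, s ≠ g + j}.Finite := by
    refine ((hP.finite_of_le_cone N).preimage (f := Subtype.val)
      Subtype.val_injective.injOn).subset fun s hs => ⟨latticeEmb_mem_coneOver s.2, ?_⟩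
    by_contra! hcon
    obtain ⟨j, hj, g, hg⟩ := hJ s (by exact_mod_cast hcon.le)
    exact hs j hj g hg
  rw [colength, AddMonoidAlgebra.length_quotient_monomialIdeal (degree P) degree_pos J hfin,
    ENat.toNat_natCast, Set.ncard_image_of_injective _ Subtype.val_injective]

theorem colength_gradedMaximalIdeal_pow (K : Type u) [Field K] (t : ℕ) :
    colength (gradedMaximalIdeal K P ^ t) =
      ({s : (Fin n → ℤ) × ℤ | s ∈ coneSemigroup P ∧ s.2 < t}.ncard : ℝ) := by
  rw [gradedMaximalIdeal_pow, hP.colength_monomialIdeal K {s | (t : ℤ) ≤ degree P s} t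
    fun s hs => ⟨s, hs, 0, (zero_add s).symm⟩]
  congr 2
  ext s
  constructor
  · rintro ⟨s, hs, rfl⟩
    refine ⟨s.2, ?_⟩
    by_contra! hcon
    exact hs s hcon 0 (zero_add s).symm
  · rintro ⟨hs, hst⟩
    refine ⟨⟨s, hs⟩, fun j hj g hg => ?_, rfl⟩
    have h1 := congrArg (degree P) hg
    rw [map_add, degree_apply] at h1
    have h2 := degree_nonneg g
    have h3 : (t : ℤ) ≤ degree P j := hj
    simp only at h1
    omega

theorem colength_frobeniusPower (K : Type u) [Field K] (p : ℕ) [Fact p.Prime] [CharP K p] (k t : ℕ) :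
    colength (frobeniusPower (gradedMaximalIdeal K P ^ k) (p ^ t)) =
      ({s : (Fin n → ℤ) × ℤ | s ∈ coneSemigroup P ∧
        ∀ g : Fin n → ℤ, (g, (k : ℤ)) ∈ coneSemigroup P →
          s - p ^ t • ((g, k) : (Fin n → ℤ) × ℤ) ∉ coneSemigroup P}.ncard : ℝ) := by
  have hchar : CharP (coordinateRing K P) p :=
    charP_of_injective_algebraMap (algebraMap K (coordinateRing K P)).injective p
  have hp : 0 < p ^ t := pow_pos (Nat.Prime.pos Fact.out) t
  rw [frobeniusPower_eq_map, gradedMaximalIdeal_pow,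
    AddMonoidAlgebra.map_iterateFrobenius_monomialIdeal]
  -- a multiple of `q • j` with `deg j ≥ k` is a multiple of `q • a` with `deg a = k`
  have hsplit : ∀ (j : coneSemigroup P), (k : ℤ) ≤ degree P j →
      ∃ a b : (Fin n → ℤ) × ℤ, a ∈ coneSemigroup P ∧ b ∈ coneSemigroup P ∧ a.2 = k ∧ b + a = j.1 := by
    intro j hj
    obtain ⟨a, ha, b, hb, h1, h2⟩ := exists_add_eq_of_le j.2 k hj
    exact ⟨a, b, ha, hb, h1, h2⟩
  rw [hP.colength_monomialIdeal K _ ((p ^ t : ℕ) * (k + hP.finite.toFinset.card))]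
  · congr 2
    ext s
    constructor
    · rintro ⟨s, hs, rfl⟩
      refine ⟨s.2, fun g hg hsg => hs _ ⟨⟨_, hg⟩, le_refl (k : ℤ), rfl⟩ ⟨_, hsg⟩ (Subtype.ext ?_)⟩
      exact (sub_add_cancel _ _).symm
    · rintro ⟨hs, hsg⟩
      refine ⟨⟨s, hs⟩, ?_, rfl⟩
      rintro _ ⟨j, hj, rfl⟩ g hg
      obtain ⟨a, b, ha, hb, hak, hab⟩ := hsplit j hj
      have ha' : (a.1, (k : ℤ)) = a := Prod.ext rfl hak.symm
      refine hsg a.1 (by rwa [ha']) ?_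
      rw [ha']
      have h1 : s = g.1 + p ^ t • j.1 := congrArg Subtype.val hg
      have h2 : s - p ^ t • a = g.1 + p ^ t • b := by
        rw [h1, ← hab, smul_add]; abel
      rw [h2]
      exact add_mem g.2 (nsmul_mem hb _)
  · intro s hs
    obtain ⟨g, hg, hsg⟩ := hP.exists_sub_mem_coneSemigroup _ k hp s.2 (by exact_mod_cast hs)
    exact ⟨_, ⟨⟨_, hg⟩, le_refl (k : ℤ), rfl⟩, ⟨_, hsg⟩, Subtype.ext (sub_add_cancel _ _).symm⟩

theorem tendsto_samuelSeq (K : Type u) [Field K] (k : ℕ) :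
    Tendsto (samuelSeq (gradedMaximalIdeal K P ^ k)) atTop
      (𝓝 (n.factorial * ((k : ℝ) ^ (n + 1) * volume.real P))) := by
  have h := (hP.tendsto_ncard_degree_lt k).const_mul (((n + 1).factorial : ℕ) : ℝ)
  rw [hP.volume_cone_lt] at h
  have h1 : (((n + 1).factorial : ℕ) : ℝ) * ((k : ℝ) ^ (n + 1) * volume.real P / (n + 1)) =
      n.factorial * ((k : ℝ) ^ (n + 1) * volume.real P) := by
    rw [Nat.factorial_succ]
    push_cast
    field_simp
  rw [h1] at h
  refine h.congr fun t => ?_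
  rw [samuelSeq, hP.krullDim_coordinateRing K, ← pow_mul, hP.colength_gradedMaximalIdeal_pow,
    mul_div_assoc]
  push_cast
  rfl

theorem e0_gradedMaximalIdeal_pow (K : Type u) [Field K] (k : ℕ) :
    e0 (gradedMaximalIdeal K P ^ k) = n.factorial * ((k : ℝ) ^ (n + 1) * volume.real P) :=
  (hP.tendsto_samuelSeq K k).limUnder_eq

theorem tendsto_hilbertKunzSeq (K : Type u) [Field K] (p : ℕ) [Fact p.Prime] [CharP K p] (k : ℕ) :
    Tendsto (hilbertKunzSeq p (gradedMaximalIdeal K P ^ k)) atTop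
      (𝓝 (volume.real (hilbertKunzRegion P k))) := by
  refine ((hP.tendsto_ncard_hilbertKunz k).comp
    (tendsto_pow_atTop_atTop_of_one_lt (Nat.Prime.one_lt (Fact.out : p.Prime)))).congr fun t => ?_
  rw [hilbertKunzSeq, hP.krullDim_coordinateRing K, hP.colength_frobeniusPower]
  rfl

theorem eHK_gradedMaximalIdeal_pow (K : Type u) [Field K] (p : ℕ) [Fact p.Prime] [CharP K p]
    (k : ℕ) : eHK p (gradedMaximalIdeal K P ^ k) = volume.real (hilbertKunzRegion P k) :=
  (hP.tendsto_hilbertKunzSeq K p k).limUnder_eq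

end IsSpanningPolytope

end Toric

theorem theorem1p3 {K : Type u} [Field K] [IsAlgClosed K] (p : ℕ) [Fact p.Prime] [CharP K p]
    {n : ℕ} (hn : 1 ≤ n) (Δ : Toric.Fan n) (hΔ : Δ.IsComplete) (a : Δ.rays → ℤ)
    (hC : Δ.IsCartier a) (hD : Δ.IsVeryAmple K a) :
    -- the limits that define the multiplicities exist
    (∀ k : ℕ, 1 ≤ k →
      Tendsto (Toric.hilbertKunzSeq p (Toric.gradedMaximalIdeal K (Δ.polytope a) ^ k)) atTop
        (𝓝 (Toric.eHK p (Toric.gradedMaximalIdeal K (Δ.polytope a) ^ k))) ∧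
      Tendsto (Toric.samuelSeq (Toric.gradedMaximalIdeal K (Δ.polytope a) ^ k)) atTop
        (𝓝 (Toric.e0 (Toric.gradedMaximalIdeal K (Δ.polytope a) ^ k)))) ∧
    -- the function does not depend on the choice of the unit cell
    (∀ (v : Fin n → ℤ) (lam : ℝ), 0 ≤ lam →
      Toric.phi (Δ.polytope a) v lam = Toric.phi (Δ.polytope a) 0 lam) ∧
    ContinuousOn (Toric.phi (Δ.polytope a) 0) (Set.Ici 0) ∧
    HasCompactSupport ((Set.Ici (0 : ℝ)).domRestrict (Toric.phi (Δ.polytope a) 0)) ∧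
    Tendsto (fun k : ℕ =>
        (Toric.eHK p (Toric.gradedMaximalIdeal K (Δ.polytope a) ^ k) -
          Toric.e0 (Toric.gradedMaximalIdeal K (Δ.polytope a) ^ k) / ((n + 1).factorial : ℝ)) / (k : ℝ) ^ n)
      atTop
      (𝓝 (Toric.e0 (Toric.gradedMaximalIdeal K (Δ.polytope a)) / (n.factorial : ℝ) *
        ∫ lam in Set.Ioi (0 : ℝ), Toric.phi (Δ.polytope a) 0 lam)) := by
  have hP := hD.isSpanningPolytope hΔ
  refine ⟨fun k _ => ⟨?_, ?_⟩, fun v lam _ => Toric.phi_eq_phi_zero _ v lam,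
    hP.continuousOn_phi hn, hP.hasCompactSupport_phi, ?_⟩
  · rw [hP.eHK_gradedMaximalIdeal_pow]
    exact hP.tendsto_hilbertKunzSeq K p k
  · rw [hP.e0_gradedMaximalIdeal_pow]
    exact hP.tendsto_samuelSeq K k
  · have hfac : (n.factorial : ℝ) ≠ 0 := by exact_mod_cast n.factorial_ne_zero
    have h1 : Toric.e0 (Toric.gradedMaximalIdeal K (Δ.polytope a)) / (n.factorial : ℝ) =
        volume.real (Δ.polytope a) := by
      have := hP.e0_gradedMaximalIdeal_pow K 1
      rw [pow_one] at this
      rw [this]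
      field_simp
      simp
    rw [h1]
    refine hP.tendsto_volume_hilbertKunzRegion.congr fun k => ?_
    rw [hP.eHK_gradedMaximalIdeal_pow, hP.e0_gradedMaximalIdeal_pow, Nat.factorial_succ]
    push_cast
    congr 2
    field_simp
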